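/- Let $p$ be a prime, $k$ a perfect field of characteristic $p$, $N$ a commutative monoid and $\beta\colon N\to (k,\cdot)$ a monoid map; write $\underline k=(k,N)$ and $W(\underline k)=(W(k),[\beta]\colon N\to W(k))$, where $[\,\cdot\,]$ is the Teichmüller lift. A log algebra over a log ring $(K,N)$ is a commutative $K$-algebra $R$ with a commutative monoid $M$, a monoid map $\alpha\colon M\to(R,\cdot)$ and a monoid map $N\to M$ compatible with $N\to K\to R$; morphisms are the evident pairs of maps. A log Dieudonné $W(\underline k)$-algebra is a commutative differential graded $W(k)$-algebra $(A^*=\bigoplus_{i\ge0}A^i,d)$ (odd elements having square zero) with a graded ring endomorphism $F$ such that $F(x)\equiv x^p \bmod pA^0$ for $x\in A^0$ and $dF=pFd$, a log algebra structure $\alpha\colon L\to A^0$ over $W(\underline k)$, a monoid map $\delta\colon L\to A^1$ with $d\alpha(m)=\alpha(m)\delta(m)$, $d\delta=0$ and $\delta|_N=0$, and a monoid endomorphism $F_L$ of $L$ with $F\alpha=\alpha F_L$ and $\delta F_L=pF\delta$. Morphisms are pairs of a morphism of graded $W(k)$-algebras and a morphism of monoids under $N$, compatible with $d,F,\alpha,\delta,F_L$.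 It is $p$-compatible if $F_L$ is multiplication by $p$. It is saturated if it is $p$-torsion free and $\phi_F=p^iF\colon A^i\to(\eta_pA)^i=\{x\in p^iA^i: dx\in p^{i+1}A^{i+1}\}$ is bijective for all $i$; then $V\colon A^*\to A^*$ is the unique map with $FV=p$, and one puts $\mathrm{Fil}^r=V^rA^*+dV^rA^*$ and $W_r(A^*)=A^*/\mathrm{Fil}^r$. The $V$-completion of a saturated $A^*$ is $W(A^*)=\varprojlim_r W_r(A^*)$ (limit in each degree), with the same monoid $L$ and the induced structure; $A^*$ is strict if it is saturated and $A^*\to W(A^*)$ is an isomorphism. The saturation of a log Dieudonné algebra $A^*$ is the colimit of $T^*\to\eta_pT^*\to\eta_p\eta_pT^*\to\cdots$ along $\phi_F$, where $T^*=A^*/A^*[p^\infty]$, with the same monoid $L$. Theorem. For every log algebra $\underline R=(R,M)$ over $\underline k$ the saturated log de Rham–Witt complex $\mathcal W\omega^*_{\underline R/\underline k}$ exists: there are a strict $p$-compatible log Dieudonné $W(\underline k)$-algebra $\mathcal W\omega^*=\mathcal W\omega^*_{\underline R/\underline k}$ and a morphism $u_{\underline R}\colon\underline R\to(\mathcal W\omega^0/V\mathcal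 W\omega^0,L)$ of log algebras over $\underline k$ such that, for every strict $p$-compatible log Dieudonné $W(\underline k)$-algebra $B^*$ with monoid $L_B$, the natural map $$\mathrm{Hom}(\mathcal W\omega^*_{\underline R/\underline k},B^*)\longrightarrow \mathrm{Hom}_{\underline k}\big(\underline R,(B^0/VB^0,L_B)\big)$$ is bijective. It may be taken to be the $V$-completion of the saturation of the log de Rham complex $\omega^*=\Lambda^*\omega^1$ of $W(\underline R_{\mathrm{red}})=(W(R_{\mathrm{red}}),[\alpha]\colon M\to W(R_{\mathrm{red}}))$ over $W(\underline k)$, where $R_{\mathrm{red}}$ is the reduced quotient of $R$, $F_L=p$, and $F$ is the graded ring endomorphism which is the Witt vector Frobenius $\varphi$ in degree $0$ and satisfies $F(dx)=x^{p-1}dx+d\big(\tfrac{\varphi(x)-x^p}{p}\big)$ and $F(\mathrm{dlog}\,m)=\mathrm{dlog}\,m$; here $\omega^1$ is the module of relative log differentials, i.e. the target of the universal log derivation $(d,\mathrm{dlog})$, and $u_{\underline R}$ is induced by $W(R)\to W(R_{\mathrm{red}})=\omega^0\to\mathcal W\omega^0$ and by the identity of $M$. Moreover $\underline R\mapsto\mathcal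 W\omega^*_{\underline R/\underline k}$ is a functor, and $u_{\underline R}$ is natural in $\underline R$. -/

import Mathlib

open CategoryTheory TensorProduct

universe u

noncomputable section

/-! ### Log algebras over a base log ring -/

/-- A log algebra over the base log ring `(K, β : N → K)`: a commutative `K`-algebra `carrier`
with a commutative monoid `M` (written multiplicatively), a structure map `α : M → carrier`
to the multiplicative monoid, and a map `ι : N → M` over `β`. No further condition is imposed
on the monoids. -/
structure LogAlg {K N : Type u} [CommRing K] [CommMonoid N] (β : N →* K) where
  carrier : Type u
  [commRing : CommRing carrier]
  [algebra : Algebra K carrier]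
  M : Type u
  [commMonoid : CommMonoid M]
  α : M →* carrier
  ι : N →* M
  α_ι : ∀ n, α (ι n) = algebraMap K carrier (β n)

attribute [instance] LogAlg.commRing LogAlg.algebra LogAlg.commMonoid

namespace LogAlg

variable {K N : Type u} [CommRing K] [CommMonoid N] {β : N →* K}

/-- Morphisms of log algebras over `(K, N)`. -/
@[ext]
structure Hom (A B : LogAlg β) where
  f : A.carrier →ₐ[K] B.carrier
  ψ : A.M →* B.M
  f_α : ∀ m, f (A.α m) = B.α (ψ m)
  ψ_ι : ∀ n, ψ (A.ι n) = B.ι n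

instance : Category (LogAlg β) where
  Hom := Hom
  id A := ⟨AlgHom.id K _, MonoidHom.id _, fun _ => rfl, fun _ => rfl⟩
  comp g h := ⟨h.f.comp g.f, h.ψ.comp g.ψ,
    fun m => by simp [g.f_α, h.f_α], fun n => by simp [g.ψ_ι, h.ψ_ι]⟩

/-- The submodule of relations `(d α(m), 0) = (0, α(m) ⊗ m)` and `(0, 1 ⊗ ι(n)) = 0`. -/
def omegaRel (A : LogAlg β) : Submodule A.carrier
    (Ω[A.carrier⁄K] × (A.carrier ⊗[ℤ] Additive (Algebra.GrothendieckGroup A.M))) :=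
  Submodule.span A.carrier
    (Set.range (fun m : A.M =>
        (KaehlerDifferential.D K A.carrier (A.α m),
          -(A.α m ⊗ₜ[ℤ] Additive.ofMul (Algebra.GrothendieckGroup.of m)))) ∪
      Set.range (fun n : N =>
        (0, 1 ⊗ₜ[ℤ] Additive.ofMul (Algebra.GrothendieckGroup.of (A.ι n)))))

/-- The module of relative log differentials `ω¹` of `A` over `(K, N)`. -/
abbrev Omega (A : LogAlg β) : Type u :=
  (Ω[A.carrier⁄K] × (A.carrier ⊗[ℤ] Additive (Algebra.GrothendieckGroup A.M))) ⧸ A.omegaRel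

/-- The universal derivation `d : A → ω¹`. -/
def dOmega (A : LogAlg β) (a : A.carrier) : A.Omega :=
  A.omegaRel.mkQ (KaehlerDifferential.D K A.carrier a, 0)

/-- The universal log derivation `dlog : M → ω¹`. -/
def dlog (A : LogAlg β) (m : A.M) : A.Omega :=
  A.omegaRel.mkQ (0, 1 ⊗ₜ[ℤ] Additive.ofMul (Algebra.GrothendieckGroup.of m))

/-- The reduced quotient of a log algebra, with the induced log structure. -/
def red (A : LogAlg β) : LogAlg β where
  carrier := A.carrier ⧸ nilradical A.carrier
  M := A.M
  α := (Ideal.Quotient.mk (nilradical A.carrier)).toMonoidHom.comp A.α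
  ι := A.ι
  α_ι n := by
    change Ideal.Quotient.mk (nilradical A.carrier) (A.α (A.ι n)) = _
    rw [A.α_ι]
    rfl

end LogAlg

/-- The Teichmüller lift `[β] : N → W(k)` of a log structure `β : N → k`. -/
abbrev teichLog (p : ℕ) [Fact p.Prime] {k N : Type u} [CommRing k] [CommMonoid N] (β : N →* k) :
    N →* WittVector p k :=
  (WittVector.teichmuller p).comp β

/-- The log algebra `W(R, M) = (W(R), [α] : M → W(R))` over `W(k, N)`. -/
def LogAlg.witt (p : ℕ) [Fact p.Prime] {k N : Type u} [CommRing k] [CommMonoid N] {β : N →* k}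
    (A : LogAlg β) : LogAlg (teichLog p β) where
  carrier := WittVector p A.carrier
  algebra := (WittVector.map (algebraMap k A.carrier)).toAlgebra
  M := A.M
  α := (WittVector.teichmuller p).comp A.α
  ι := A.ι
  α_ι n := by
    change WittVector.teichmuller p (A.α (A.ι n)) =
      WittVector.map (algebraMap k A.carrier) (WittVector.teichmuller p (β n))
    rw [A.α_ι, WittVector.map_teichmuller]

/-! ### Log Dieudonné algebras -/

/-- A log Dieudonné algebra over the base log ring `(W, β : N → W)`: a cdga `A = ⨁ A^i` over `W`
(internally graded by `gr`), with a Frobenius `F`, a log structure `α : L → A^0`, a log derivation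
`(d, δ)` relative to `(W, N)` and a Frobenius `FL` on `L`. -/
structure LogDieudonneAlg (p : ℕ) {W N : Type u} [CommRing W] [CommMonoid N] (β : N →* W) where
  carrier : Type u
  [ring : Ring carrier]
  [algebra : Algebra W carrier]
  gr : ℕ → Submodule W carrier
  [graded : GradedAlgebra gr]
  graded_comm : ∀ i j, ∀ a ∈ gr i, ∀ b ∈ gr j, a * b = (-1) ^ (i * j) * (b * a)
  sq_odd : ∀ i, Odd i → ∀ a ∈ gr i, a * a = 0
  d : carrier →ₗ[W] carrier
  d_mem : ∀ i, ∀ a ∈ gr i, d a ∈ gr (i + 1)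
  d_mul : ∀ i, ∀ a ∈ gr i, ∀ b, d (a * b) = d a * b + (-1) ^ i * (a * d b)
  d_d : ∀ a, d (d a) = 0
  F : carrier →+* carrier
  F_mem : ∀ i, ∀ a ∈ gr i, F a ∈ gr i
  F_frob : ∀ a ∈ gr 0, ∃ b ∈ gr 0, F a = a ^ p + (p : carrier) * b
  d_F : ∀ a, d (F a) = (p : carrier) * F (d a)
  L : Type u
  [commMonoid : CommMonoid L]
  α : L →* carrier
  α_mem : ∀ m, α m ∈ gr 0
  ι : N →* L
  α_ι : ∀ n, α (ι n) = algebraMap W carrier (β n)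
  δ : L → carrier
  δ_mem : ∀ m, δ m ∈ gr 1
  δ_one : δ 1 = 0
  δ_mul : ∀ m m', δ (m * m') = δ m + δ m'
  d_α : ∀ m, d (α m) = α m * δ m
  δ_ι : ∀ n, δ (ι n) = 0
  d_δ : ∀ m, d (δ m) = 0
  FL : L →* L
  δ_FL : ∀ m, δ (FL m) = (p : carrier) * F (δ m)
  F_α : ∀ m, F (α m) = α (FL m)

attribute [instance] LogDieudonneAlg.ring LogDieudonneAlg.algebra LogDieudonneAlg.graded
  LogDieudonneAlg.commMonoid

namespace LogDieudonneAlg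

variable {p : ℕ} {W N : Type u} [CommRing W] [CommMonoid N] {β : N →* W}

/-- Morphisms of log Dieudonné algebras over `(W, N)`. -/
@[ext]
structure Hom (A B : LogDieudonneAlg p β) where
  f : A.carrier →ₐ[W] B.carrier
  f_mem : ∀ i, ∀ a ∈ A.gr i, f a ∈ B.gr i
  f_d : ∀ a, f (A.d a) = B.d (f a)
  f_F : ∀ a, f (A.F a) = B.F (f a)
  ψ : A.L →* B.L
  ψ_ι : ∀ n, ψ (A.ι n) = B.ι n
  f_α : ∀ m, f (A.α m) = B.α (ψ m)
  ψ_FL : ∀ m, ψ (A.FL m) = B.FL (ψ m)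
  f_δ : ∀ m, f (A.δ m) = B.δ (ψ m)

instance : Category (LogDieudonneAlg p β) where
  Hom := Hom
  id A :=
    { f := AlgHom.id W _
      f_mem := fun _ _ h => h
      f_d := fun _ => rfl
      f_F := fun _ => rfl
      ψ := MonoidHom.id _
      ψ_ι := fun _ => rfl
      f_α := fun _ => rfl
      ψ_FL := fun _ => rfl
      f_δ := fun _ => rfl }
  comp g h :=
    { f := h.f.comp g.f
      f_mem := fun i a ha => h.f_mem i _ (g.f_mem i a ha)
      f_d := fun a => by simp [g.f_d, h.f_d]
      f_F := fun a => by simp [g.f_F, h.f_F]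
      ψ := h.ψ.comp g.ψ
      ψ_ι := fun n => by simp [g.ψ_ι, h.ψ_ι]
      f_α := fun m => by simp [g.f_α, h.f_α]
      ψ_FL := fun m => by simp [g.ψ_FL, h.ψ_FL]
      f_δ := fun m => by simp [g.f_δ, h.f_δ] }

/-- `A` is `p`-compatible if the Frobenius of the monoid is "multiplication by `p`", that is
`m ↦ m ^ p` in multiplicative notation. -/
def IsPCompatible (A : LogDieudonneAlg p β) : Prop := ∀ m, A.FL m = m ^ p

/-! #### Degree zero -/

instance (A : LogDieudonneAlg p β) : CommRing (A.gr 0) :=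
  { (inferInstance : Ring (A.gr 0)) with
    mul_comm := fun a b => Subtype.ext (by
      simpa using A.graded_comm 0 0 a a.2 b b.2) }

/-- The log algebra `(A^0, L)` over `(W, N)`. -/
def zero (A : LogDieudonneAlg p β) : LogAlg β where
  carrier := A.gr 0
  M := A.L
  α :=
    { toFun := fun m => ⟨A.α m, A.α_mem m⟩
      map_one' := Subtype.ext (map_one A.α)
      map_mul' := fun a b => Subtype.ext (map_mul A.α a b) }
  ι := A.ι
  α_ι n := Subtype.ext (A.α_ι n)

/-- The inclusion `A^0 → A`. -/
def zeroVal (A : LogDieudonneAlg p β) (a : A.zero.carrier) : A.carrier :=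
  ((show A.gr 0 from a) : A.carrier)

/-- The ring homomorphism `A^0 → B^0` induced by a morphism `A → B`. -/
def Hom.zeroMap {A B : LogDieudonneAlg p β} (g : A ⟶ B) : A.gr 0 →+* B.gr 0 where
  toFun a := ⟨Hom.f g a.1, Hom.f_mem g 0 _ a.2⟩
  map_one' := Subtype.ext (map_one (Hom.f g))
  map_mul' a b := Subtype.ext (map_mul (Hom.f g) a.1 b.1)
  map_zero' := Subtype.ext (map_zero (Hom.f g))
  map_add' a b := Subtype.ext (map_add (Hom.f g) a.1 b.1)

/-- The morphism `(A^0, L_A) → (B^0, L_B)` induced by a morphism `A → B`. -/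
def Hom.zero {A B : LogDieudonneAlg p β} (g : A ⟶ B) : A.zero ⟶ B.zero where
  f :=
    { Hom.zeroMap g with
      commutes' := fun w => Subtype.ext ((Hom.f g).commutes w) }
  ψ := Hom.ψ g
  f_α m := Subtype.ext (Hom.f_α g m)
  ψ_ι := Hom.ψ_ι g

/-! #### The décalage operator and saturated objects -/

/-- The décalage operator `η_p`, applied to a family `G` of subsets `G^i ⊆ A^i`:
`(η_p G)^i = {x ∈ p^i G^i : d x ∈ p^(i+1) G^(i+1)}`. -/
def etaP (A : LogDieudonneAlg p β) (G : ℕ → Set A.carrier) (i : ℕ) : Set A.carrier :=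
  {x | (∃ y ∈ G i, x = (p : A.carrier) ^ i * y) ∧
    ∃ z ∈ G (i + 1), A.d x = (p : A.carrier) ^ (i + 1) * z}

/-- `η_p^n A`, as a graded subset of `A`. -/
def etaIter (A : LogDieudonneAlg p β) (n : ℕ) : ℕ → Set A.carrier :=
  (A.etaP)^[n] (fun i => (A.gr i : Set A.carrier))

/-- The map `φ_F = p^i F` on degree `i`. -/
def phiF (A : LogDieudonneAlg p β) (i : ℕ) (x : A.carrier) : A.carrier :=
  (p : A.carrier) ^ i * A.F x

/-- `A` is saturated if it is `p`-torsion free and `φ_F : A → η_p A` is an isomorphism. -/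
structure IsSaturated (A : LogDieudonneAlg p β) : Prop where
  torsionFree : ∀ x : A.carrier, (p : A.carrier) * x = 0 → x = 0
  bijOn : ∀ i, Set.BijOn (A.phiF i) (A.gr i) (A.etaIter 1 i)

namespace IsSaturated

variable {A : LogDieudonneAlg p β}

theorem cancel (h : A.IsSaturated) (n : ℕ) {x y : A.carrier}
    (hxy : (p : A.carrier) ^ n * x = (p : A.carrier) ^ n * y) : x = y := by
  induction n with
  | zero => simpa using hxy
  | succ n ih =>
    apply ih
    have : (p : A.carrier) * ((p : A.carrier) ^ n * x - (p : A.carrier) ^ n * y) = 0 := by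
      rw [mul_sub, ← mul_assoc, ← mul_assoc, ← pow_succ', hxy, sub_self]
    exact sub_eq_zero.1 (h.torsionFree _ this)

theorem decompose_F (A : LogDieudonneAlg p β) (x : A.carrier) (i : ℕ) :
    (DirectSum.decompose A.gr (A.F x) i : A.carrier) =
      A.F (DirectSum.decompose A.gr x i : A.carrier) := by
  induction x using DirectSum.Decomposition.inductionOn A.gr with
  | zero => simp
  | @homogeneous j m =>
    by_cases hij : j = i
    · subst hij
      rw [DirectSum.decompose_of_mem_same _ (A.F_mem _ _ m.2),
        DirectSum.decompose_of_mem_same _ m.2]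
    · rw [DirectSum.decompose_of_mem_ne _ (A.F_mem _ _ m.2) hij,
        DirectSum.decompose_of_mem_ne _ m.2 hij, map_zero]
  | add x y hx hy => simp [hx, hy]

theorem F_injective (h : A.IsSaturated) : Function.Injective A.F := by
  classical
  rw [injective_iff_map_eq_zero]
  intro x hx
  rw [← DirectSum.sum_support_decompose A.gr x]
  refine Finset.sum_eq_zero fun i _ => ?_
  apply (h.bijOn i).injOn (SetLike.coe_mem _) (zero_mem (A.gr i))
  simp only [phiF, map_zero, mul_zero]
  rw [← decompose_F, hx]
  simp

theorem exists_V (h : A.IsSaturated) (x : A.carrier) : ∃ y, A.F y = (p : A.carrier) * x := by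
  induction x using DirectSum.Decomposition.inductionOn A.gr with
  | zero => exact ⟨0, by simp⟩
  | @homogeneous i m =>
    have hp : (p : A.carrier) * m ∈ A.gr i := by
      rw [← nsmul_eq_mul]; exact nsmul_mem m.2 p
    obtain ⟨y, -, hy⟩ := (h.bijOn i).surjOn
      (a := (p : A.carrier) ^ i * ((p : A.carrier) * m))
      ⟨⟨_, hp, rfl⟩, A.d m, A.d_mem i _ m.2, by
        rw [← mul_assoc, ← pow_succ, ← Nat.cast_pow, ← nsmul_eq_mul, map_nsmul, nsmul_eq_mul]⟩
    exact ⟨y, h.cancel i hy⟩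
  | add x y hx hy =>
    obtain ⟨a, ha⟩ := hx
    obtain ⟨b, hb⟩ := hy
    exact ⟨a + b, by rw [map_add, ha, hb, mul_add]⟩

/-- The Verschiebung of a saturated log Dieudonné algebra: `V x` is the unique element with
`F (V x) = p x`. -/
def V (h : A.IsSaturated) : AddMonoid.End A.carrier where
  toFun x := (h.exists_V x).choose
  map_zero' := h.F_injective (by rw [(h.exists_V 0).choose_spec]; simp)
  map_add' x y := h.F_injective (by
    rw [map_add, (h.exists_V _).choose_spec, (h.exists_V x).choose_spec,
      (h.exists_V y).choose_spec, mul_add])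

theorem F_V (h : A.IsSaturated) (x : A.carrier) : A.F (h.V x) = (p : A.carrier) * x :=
  (h.exists_V x).choose_spec

theorem mul_V (h : A.IsSaturated) (x y : A.carrier) : x * h.V y = h.V (A.F x * y) := by
  apply h.F_injective
  rw [map_mul, h.F_V, h.F_V, ← mul_assoc, ← mul_assoc, (Nat.cast_commute p (A.F x)).eq]

/-- The ideal `V A^0` of `A^0`. -/
def VIdeal (h : A.IsSaturated) : Ideal (A.gr 0) where
  carrier := {x | ∃ y : A.gr 0, (x : A.carrier) = h.V y}
  zero_mem' := ⟨0, by simp⟩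
  add_mem' := by
    rintro a b ⟨x, hx⟩ ⟨y, hy⟩
    exact ⟨x + y, by simp [hx, hy]⟩
  smul_mem' := by
    rintro c x ⟨y, hy⟩
    refine ⟨⟨A.F c * y, ?_⟩, ?_⟩
    · simpa using SetLike.mul_mem_graded (A.F_mem 0 _ c.2) y.2
    · rw [← h.mul_V, ← hy]; rfl

/-- The `V`-filtration `Fil^r = V^r A + d V^r A`. -/
def Fil (h : A.IsSaturated) (r : ℕ) : AddSubgroup A.carrier :=
  AddMonoidHom.range (h.V ^ r : AddMonoid.End A.carrier) ⊔
    (AddMonoidHom.range (h.V ^ r : AddMonoid.End A.carrier)).map A.d.toAddMonoidHom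

/-- `W_r(A) = A / Fil^r` (as an abelian group). -/
abbrev Wr (h : A.IsSaturated) (r : ℕ) : Type u := A.carrier ⧸ h.Fil r

theorem Fil_succ_le (h : A.IsSaturated) (r : ℕ) : h.Fil (r + 1) ≤ h.Fil r := by
  have : AddMonoidHom.range (h.V ^ (r + 1) : AddMonoid.End A.carrier) ≤
      AddMonoidHom.range (h.V ^ r : AddMonoid.End A.carrier) := by
    rintro _ ⟨x, rfl⟩
    exact ⟨h.V x, by rw [pow_succ]; rfl⟩
  exact sup_le_sup this (AddSubgroup.map_mono this)

/-- The restriction map `W_(r+1)(A) → W_r(A)`. -/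
def res (h : A.IsSaturated) (r : ℕ) : h.Wr (r + 1) →+ h.Wr r :=
  QuotientAddGroup.map _ _ (AddMonoidHom.id _) (h.Fil_succ_le r)

/-- The canonical map `A → ∏ W_r(A)`. -/
def toWr (h : A.IsSaturated) (x : A.carrier) : ∀ r, h.Wr r := fun _ => QuotientAddGroup.mk x

/-- The degree `i` part of `W(A) = lim W_r(A)`: compatible sequences of elements of
`W_r(A)^i`. -/
def lim (h : A.IsSaturated) (i : ℕ) : Set (∀ r, h.Wr r) :=
  {s | (∀ r, ∃ a ∈ A.gr i, s r = h.toWr a r) ∧ ∀ r, h.res r (s (r + 1)) = s r}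

end IsSaturated

/-- A saturated `A` is strict if the canonical map `A → W(A) = lim W_r(A)` is an isomorphism. -/
def IsStrict (A : LogDieudonneAlg p β) : Prop :=
  ∃ h : A.IsSaturated, ∀ i, Set.BijOn h.toWr (A.gr i) (h.lim i)

/-! #### Saturation and `V`-completion -/

/-- `q : A → T` exhibits `T` as the quotient of `A` by its `p`-power torsion, with the same
monoid. -/
structure IsTorsionFreeQuotient {A T : LogDieudonneAlg p β} (q : A ⟶ T) : Prop where
  surjective : Function.Surjective (Hom.f q)
  ker : ∀ x, Hom.f q x = 0 ↔ ∃ n : ℕ, (p : A.carrier) ^ n * x = 0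
  bijective_ψ : Function.Bijective (Hom.ψ q)

/-- For `p`-torsion free `T`, the morphism `j : T → S` exhibits `S` as the colimit of
`T → η_p T → η_p η_p T → ⋯` (transition maps `φ_F`), with the same monoid.
The maps `c n : η_p^n T → S` are the structure maps of the colimit; only their values on
`η_p^n T ⊆ T` matter. -/
structure IsEtaColimit {T S : LogDieudonneAlg p β} (j : T ⟶ S) (c : ℕ → T.carrier → S.carrier) :
    Prop where
  c_zero : ∀ x, c 0 x = Hom.f j x
  c_mem : ∀ n i, ∀ x ∈ T.etaIter n i, c n x ∈ S.gr i
  c_one : ∀ n, c n 1 = 1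
  c_add : ∀ n i, ∀ x ∈ T.etaIter n i, ∀ y ∈ T.etaIter n i, c n (x + y) = c n x + c n y
  c_mul : ∀ n i j, ∀ x ∈ T.etaIter n i, ∀ y ∈ T.etaIter n j, c n (x * y) = c n x * c n y
  c_d : ∀ n i, ∀ x ∈ T.etaIter n i, c n (T.d x) = S.d (c n x)
  c_F : ∀ n i, ∀ x ∈ T.etaIter n i, c n (T.F x) = S.F (c n x)
  c_phiF : ∀ n i, ∀ x ∈ T.etaIter n i, c (n + 1) (T.phiF i x) = c n x
  surj : ∀ i, ∀ s ∈ S.gr i, ∃ n, ∃ x ∈ T.etaIter n i, c n x = s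
  inj : ∀ n i, ∀ x ∈ T.etaIter n i, ∀ y ∈ T.etaIter n i, c n x = c n y →
    ∃ m : ℕ, (T.phiF i)^[m] x = (T.phiF i)^[m] y
  bijective_ψ : Function.Bijective (Hom.ψ j)

/-- `s : A → S` exhibits `S` as the saturation of `A`: first divide by the `p`-power torsion, then
take the colimit of the iterates of `η_p` along `φ_F`. -/
def IsSaturation {A S : LogDieudonneAlg p β} (s : A ⟶ S) : Prop :=
  ∃ (T : LogDieudonneAlg p β) (q : A ⟶ T) (j : T ⟶ S) (c : ℕ → T.carrier → S.carrier),
    IsTorsionFreeQuotient q ∧ IsEtaColimit j c ∧ s = q ≫ j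

/-- `ρ : S → C` exhibits `C` as the `V`-completion `W(S) = lim W_r(S)` of the saturated `S`, with
the same monoid. The map `π : C → ∏ W_r(S)` identifies `C^i` with the limit of the `W_r(S)^i`,
the algebra structure, `d` and `F : W_(r+1)(S) → W_r(S)` being the induced ones. -/
structure IsVCompletionVia {S C : LogDieudonneAlg p β} (h : S.IsSaturated) (ρ : S ⟶ C)
    (π : C.carrier →+ ∀ r, h.Wr r) : Prop where
  bijOn : ∀ i, Set.BijOn π (C.gr i) (h.lim i)
  π_ρ : ∀ x, π (Hom.f ρ x) = h.toWr x
  π_mul : ∀ r x y a b, π x r = h.toWr a r → π y r = h.toWr b r → π (x * y) r = h.toWr (a * b) r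
  π_d : ∀ r x a, π x r = h.toWr a r → π (C.d x) r = h.toWr (S.d a) r
  π_F : ∀ r x a, π x (r + 1) = h.toWr a (r + 1) → π (C.F x) r = h.toWr (S.F a) r
  bijective_ψ : Function.Bijective (Hom.ψ ρ)

/-- `ρ : S → C` exhibits `C` as the `V`-completion of the saturated log Dieudonné algebra `S`. -/
def IsVCompletion {S C : LogDieudonneAlg p β} (ρ : S ⟶ C) : Prop :=
  ∃ (h : S.IsSaturated) (π : C.carrier →+ ∀ r, h.Wr r), IsVCompletionVia h ρ π

/-! #### The log de Rham complex with its Frobenius -/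

/-- The log Dieudonné algebra `E`, together with `i : A ≅ (E^0, L)`, is the log de Rham complex
`ω^* = Λ^* ω¹` of the log algebra `A` over `(W, N)`, with the canonical Frobenius attached to a
lift `φ : A → A` of Frobenius: `F` extends `φ`, `F (d a) = a^(p-1) da + d((φ(a) - a^p)/p)`,
`F (dlog m) = dlog m`, and `F_L = p`. The map `e` is the isomorphism of graded algebras
`Λ^* ω¹ ≅ E`. -/
structure IsLogDeRhamVia (A : LogAlg β) (φ : A.carrier →+* A.carrier) (E : LogDieudonneAlg p β)
    (i : A ≅ E.zero) (e : ExteriorAlgebra A.carrier A.Omega ≃+* E.carrier) : Prop where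
  e_algebraMap : ∀ a, e (algebraMap A.carrier _ a) = E.zeroVal (LogAlg.Hom.f i.hom a)
  e_mem : ∀ n, ∀ x ∈ (⋀[A.carrier]^n A.Omega), e x ∈ E.gr n
  e_d : ∀ a, e (ExteriorAlgebra.ι A.carrier (A.dOmega a)) = E.d (e (algebraMap A.carrier _ a))
  e_dlog : ∀ m, e (ExteriorAlgebra.ι A.carrier (A.dlog m)) = E.δ (LogAlg.Hom.ψ i.hom m)
  F_algebraMap : ∀ a, E.F (e (algebraMap A.carrier _ a)) = e (algebraMap A.carrier _ (φ a))
  F_d : ∀ a t, φ a = a ^ p + (p : A.carrier) * t →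
    E.F (e (ExteriorAlgebra.ι A.carrier (A.dOmega a))) =
      e (ExteriorAlgebra.ι A.carrier (a ^ (p - 1) • A.dOmega a + A.dOmega t))
  F_dlog : ∀ m, E.F (E.δ m) = E.δ m
  pCompatible : E.IsPCompatible

/-- `E` with `i : A ≅ (E^0, L)` is the log de Rham complex of `A` with the Frobenius attached to
`φ`. -/
def IsLogDeRham (A : LogAlg β) (φ : A.carrier →+* A.carrier) (E : LogDieudonneAlg p β)
    (i : A ≅ E.zero) : Prop :=
  ∃ e : ExteriorAlgebra A.carrier A.Omega ≃+* E.carrier, IsLogDeRhamVia A φ E i e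

end LogDieudonneAlg

/-! ### Strict `p`-compatible objects over `W(k, N)` and the functor `A ↦ A^0 / V A^0` -/

/-- The category of strict `p`-compatible log Dieudonné `W(k, N)`-algebras. -/
abbrev StrictLogDieudonneAlg (p : ℕ) [Fact p.Prime] {k N : Type u} [CommRing k] [CommMonoid N]
    (β : N →* k) :=
  ObjectProperty.FullSubcategory
    (fun A : LogDieudonneAlg p (teichLog p β) => A.IsPCompatible ∧ A.IsStrict)

namespace StrictLogDieudonneAlg

variable {p : ℕ} [Fact p.Prime] {k N : Type u} [CommMonoid N]

theorem isSaturated [CommRing k] {β : N →* k} (A : StrictLogDieudonneAlg p β) :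
    A.obj.IsSaturated := A.property.2.choose

theorem constantCoeff_surjective [CommRing k] :
    Function.Surjective (WittVector.constantCoeff : WittVector p k →+* k) := fun a =>
  ⟨WittVector.teichmuller p a, WittVector.teichmuller_coeff_zero p a⟩

theorem map_VIdeal_le [CommRing k] {β : N →* k} {A B : StrictLogDieudonneAlg p β} (g : A ⟶ B) :
    A.isSaturated.VIdeal ≤
      B.isSaturated.VIdeal.comap (LogDieudonneAlg.Hom.zeroMap g.hom) := by
  rintro x ⟨y, hy⟩
  refine ⟨LogDieudonneAlg.Hom.zeroMap g.hom y, ?_⟩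
  apply B.isSaturated.F_injective
  rw [B.isSaturated.F_V]
  change B.obj.F (LogDieudonneAlg.Hom.f g.hom x.1) = p * LogDieudonneAlg.Hom.f g.hom y.1
  rw [← LogDieudonneAlg.Hom.f_F, hy, A.isSaturated.F_V]
  simp

variable [Field k] [CharP k p] [PerfectRing k p] {β : N →* k}

theorem ker_le (A : StrictLogDieudonneAlg p β) :
    RingHom.ker (WittVector.constantCoeff : WittVector p k →+* k) ≤
      RingHom.ker ((Ideal.Quotient.mk A.isSaturated.VIdeal).comp
        (algebraMap (WittVector p k) (A.obj.gr 0))) := by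
  intro x hx
  rw [RingHom.mem_ker] at hx ⊢
  have hx' : x ∈ Ideal.span {(p : WittVector p k)} :=
    (WittVector.mem_span_p_iff_coeff_zero_eq_zero x).2 hx
  obtain ⟨y, rfl⟩ := Ideal.mem_span_singleton.1 hx'
  rw [RingHom.comp_apply, Ideal.Quotient.eq_zero_iff_mem, map_mul, map_natCast]
  refine Ideal.mul_mem_right _ _ ⟨1, ?_⟩
  apply A.isSaturated.F_injective
  rw [A.isSaturated.F_V]
  simp

/-- The map `k → A^0 / V A^0` through which `W(k) → A^0 → A^0 / V A^0` factors. -/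
def baseMap (A : StrictLogDieudonneAlg p β) : k →+* A.obj.gr 0 ⧸ A.isSaturated.VIdeal :=
  RingHom.liftOfSurjective (WittVector.constantCoeff : WittVector p k →+* k)
    constantCoeff_surjective ⟨_, A.ker_le⟩

theorem baseMap_coeff (A : StrictLogDieudonneAlg p β) (x : WittVector p k) :
    A.baseMap (x.coeff 0) = Ideal.Quotient.mk A.isSaturated.VIdeal (algebraMap _ _ x) :=
  RingHom.liftOfRightInverse_comp_apply _ _ _ ⟨_, A.ker_le⟩ x

/-- The log algebra `(A^0 / V A^0, L)` over `(k, N)`. -/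
def modVObj (A : StrictLogDieudonneAlg p β) : LogAlg β where
  carrier := A.obj.gr 0 ⧸ A.isSaturated.VIdeal
  commRing := inferInstance
  algebra := A.baseMap.toAlgebra
  M := A.obj.L
  α := (Ideal.Quotient.mk A.isSaturated.VIdeal).toMonoidHom.comp A.obj.zero.α
  ι := A.obj.ι
  α_ι n := by
    have h := A.baseMap_coeff (WittVector.teichmuller p (β n))
    rw [WittVector.teichmuller_coeff_zero] at h
    change Ideal.Quotient.mk A.isSaturated.VIdeal (A.obj.zero.α (A.obj.zero.ι n)) =
      A.baseMap (β n)
    rw [A.obj.zero.α_ι, h]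
    rfl

/-- The projection `A^0 → A^0 / V A^0`. -/
def proj (A : StrictLogDieudonneAlg p β) : A.obj.zero.carrier →+* A.modVObj.carrier :=
  Ideal.Quotient.mk A.isSaturated.VIdeal

/-- The morphism `A^0 / V A^0 → B^0 / V B^0` induced by a morphism `A → B`. -/
def modVMap {A B : StrictLogDieudonneAlg p β} (g : A ⟶ B) : A.modVObj ⟶ B.modVObj where
  f :=
    { Ideal.quotientMap B.isSaturated.VIdeal
        (LogDieudonneAlg.Hom.zeroMap g.hom) (map_VIdeal_le g) with
      commutes' := fun a => by
        obtain ⟨x, rfl⟩ := constantCoeff_surjective (p := p) a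
        change Ideal.quotientMap B.isSaturated.VIdeal _ (map_VIdeal_le g)
          (A.baseMap (x.coeff 0)) = B.baseMap (x.coeff 0)
        rw [A.baseMap_coeff, B.baseMap_coeff, Ideal.quotientMap_mk]
        exact congrArg _ ((LogAlg.Hom.f (LogDieudonneAlg.Hom.zero g.hom)).commutes x) }
  ψ := LogDieudonneAlg.Hom.ψ g.hom
  f_α m := congrArg (Ideal.Quotient.mk B.isSaturated.VIdeal)
    (LogAlg.Hom.f_α (LogDieudonneAlg.Hom.zero g.hom) m)
  ψ_ι := LogDieudonneAlg.Hom.ψ_ι g.hom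

/-- The functor `A ↦ (A^0 / V A^0, L)` from strict `p`-compatible log Dieudonné
`W(k, N)`-algebras to log algebras over `(k, N)`. -/
def modV (p : ℕ) [Fact p.Prime] {k N : Type u} [CommMonoid N] [Field k] [CharP k p]
    [PerfectRing k p] (β : N →* k) : StrictLogDieudonneAlg p β ⥤ LogAlg β where
  obj A := A.modVObj
  map g := modVMap g
  map_id A := by
    refine LogAlg.Hom.ext (AlgHom.ext fun x => ?_) rfl
    obtain ⟨x, rfl⟩ := Ideal.Quotient.mk_surjective x
    rfl
  map_comp g h := by
    refine LogAlg.Hom.ext (AlgHom.ext fun x => ?_) rfl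
    obtain ⟨x, rfl⟩ := Ideal.Quotient.mk_surjective x
    rfl

/-- `C`, together with `u : R → C^0 / V C^0`, is a saturated log de Rham–Witt complex of
the log algebra `R` over `(k, N)`: for every strict `p`-compatible log Dieudonné
`W(k, N)`-algebra `B`, the natural map `Hom(C, B) → Hom(R, B^0 / V B^0)` is bijective. -/
def IsSaturatedLogDRW {R : LogAlg β} {C : StrictLogDieudonneAlg p β}
    (u : R ⟶ (modV p β).obj C) : Prop :=
  ∀ B : StrictLogDieudonneAlg p β,
    Function.Bijective (fun g : C ⟶ B => u ≫ (modV p β).map g)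

/-- `C`, together with `u : R → C^0 / V C^0`, is obtained from `R` as follows: `E` is the log
de Rham complex of `W(R_red)` over `W(k, N)` with the Frobenius attached to the Witt vector
Frobenius, `S` is its saturation and `C` is the `V`-completion of `S`; and `u` is induced by
`W(R) → W(R_red) = E^0 → S^0 → C^0`. -/
def IsCompletedSaturatedLogDeRham {R : LogAlg β} {C : StrictLogDieudonneAlg p β}
    (u : R ⟶ (modV p β).obj C) : Prop :=
  ∃ (E S : LogDieudonneAlg p (teichLog p β)) (i : R.red.witt p ≅ E.zero) (s : E ⟶ S)
    (ρ : S ⟶ C.obj),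
    LogDieudonneAlg.IsLogDeRham (R.red.witt p)
      (WittVector.frobenius : WittVector p R.red.carrier →+* WittVector p R.red.carrier) E i ∧
    LogDieudonneAlg.IsSaturation s ∧ LogDieudonneAlg.IsVCompletion ρ ∧
    (∀ x : WittVector p R.carrier,
      LogAlg.Hom.f u (x.coeff 0) = C.proj
        (LogAlg.Hom.f (i.hom ≫ LogDieudonneAlg.Hom.zero (s ≫ ρ))
          (WittVector.map (Ideal.Quotient.mk (nilradical R.carrier)) x))) ∧
    ∀ m : R.M, LogAlg.Hom.ψ u m = LogAlg.Hom.ψ (i.hom ≫ LogDieudonneAlg.Hom.zero (s ≫ ρ)) m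

end StrictLogDieudonneAlg

end

/-! For a strict `p`-compatible `B`, both sides of the asserted bijection compute morphisms from the
log de Rham complex `E` of `W(R_red)` to `B`, so the proof consists of a formal chain of universal
properties and one arithmetic comparison.

Formal side. Since `B` is `p`-torsion free, saturated and strict, a morphism `E → B` factors
uniquely through the torsion-free quotient (`IsTorsionFreeQuotient.exists_lift`), then through the
saturation (`IsSaturationMap.exists_lift`), then through the `V`-completion
(`completion_exists_lift`). The completion must itself be strict (`isStrict_completion`). This rests
on the fact that division by `p` and extraction of `F`-preimages work modulo `Fil^r` with a bounded
loss in `r` (`mem_Fil_of_p_mul_mem`, `exists_sub_F_mem_Fil`), and that an element of the completion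
lies in `Fil^s` exactly when its `s`-th term does (`lim_mem_Fil_iff`).

Arithmetic side. A morphism `E → B` is determined by a map of log algebras `W(R_red) → B^0`
commuting with Frobenius, and every such map extends (`exists_logDeRham_lift`): `d` and `dlog` force
the values in degree one, and compatibility with `F` can be tested after multiplication by `p`.
Next, `B^0` is `p`-torsion free with a lift of Frobenius and is `V`-complete, and `B^0/VB^0` is
reduced, so the section `B^0 → W(B^0)` from Dwork's lemma induces `B^0 ≅ W(B^0/VB^0)`
(`toWitt_injective`, `toWitt_surjective`). Hence a ring map `R → B^0/VB^0` kills nilpotents and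
lifts uniquely to a Frobenius-equivariant map `W(R_red) → B^0`. It is `W(k)`-linear because `k` is
perfect (`hom_ext_of_perfect`). It respects the log structures because `p`-compatibility gives `F
α(m) = α(m)^p`, and solutions of `φ b = b^p` are determined modulo `V` (`eq_of_φ_eq_pow`).

Functoriality and naturality follow from representability: the pointwise universal objects assemble
into a left adjoint of `modV` whose unit is `u`. -/

noncomputable section

/-! ### Gradings recovered from projections -/

/-- A grading on an algebra from a family of projections with finite support. -/
theorem nonempty_gradedAlgebra_of_proj {W S : Type*} [CommRing W] [Ring S] [Algebra W S]
    (gr : ℕ → Submodule W S) (one_mem : (1 : S) ∈ gr 0)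
    (mul_mem : ∀ i j, ∀ x ∈ gr i, ∀ y ∈ gr j, x * y ∈ gr (i + j))
    (P : ℕ → S →+ S) (hmem : ∀ i x, P i x ∈ gr i) (hsame : ∀ i, ∀ x ∈ gr i, P i x = x)
    (hne : ∀ i j, j ≠ i → ∀ x ∈ gr j, P i x = 0)
    (hfin : ∀ x, ∃ n : ℕ, x = ∑ i ∈ Finset.range n, P i x) : Nonempty (GradedAlgebra gr) := by
  classical
  have hgm : SetLike.GradedMonoid gr :=
    { one_mem := one_mem
      mul_mem := fun i j x y hx hy => mul_mem i j x hx y hy }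
  have hinternal : DirectSum.IsInternal gr := by
    constructor
    · rw [injective_iff_map_eq_zero]
      intro f hf
      -- `P i` reads the `i`-th component of a formal sum off its image, which gives injectivity;
      -- `hfin` gives surjectivity.
      have key : ∀ i, ∀ g : DirectSum ℕ fun i => gr i,
          P i (DirectSum.coeAddMonoidHom gr g) = g i := by
        intro i g
        induction g using DirectSum.induction_on with
        | zero => simp
        | of j x =>
          rw [DirectSum.coeAddMonoidHom_of]
          by_cases hij : j = i
          · subst hij
            rw [hsame _ _ x.2, DirectSum.of_eq_same]
          · rw [hne _ _ hij _ x.2, DirectSum.of_eq_of_ne _ _ _ (Ne.symm hij)]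
            rfl
        | add x y hx hy => simp [hx, hy]
      ext i
      rw [← key i f, hf]
      simp
    · intro x
      obtain ⟨n, hn⟩ := hfin x
      refine ⟨∑ i ∈ Finset.range n, DirectSum.of (fun i => gr i) i ⟨P i x, hmem i x⟩, ?_⟩
      conv_rhs => rw [hn]
      simp [map_sum]
  exact ⟨{ hgm, hinternal.chooseDecomposition with }⟩

/-! ### Homogeneous components and the calculus of `d` and `F` -/

namespace LogDieudonneAlg

variable {p : ℕ} {W N : Type u} [CommRing W] [CommMonoid N] {β : N →* W}

section Components

variable (A : LogDieudonneAlg p β)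

/-- The projection of a log Dieudonné algebra to its part of degree `i`. -/
def pr (i : ℕ) : A.carrier →+ A.carrier := GradedRing.proj A.gr i

theorem pr_mem (i : ℕ) (x : A.carrier) : A.pr i x ∈ A.gr i := SetLike.coe_mem _

variable {A}

theorem pr_same {i : ℕ} {x : A.carrier} (hx : x ∈ A.gr i) : A.pr i x = x :=
  DirectSum.decompose_of_mem_same _ hx

theorem pr_ne {i j : ℕ} {x : A.carrier} (hx : x ∈ A.gr j) (h : j ≠ i) : A.pr i x = 0 :=
  DirectSum.decompose_of_mem_ne _ hx h

theorem exists_sum_pr (x : A.carrier) : ∃ n : ℕ, x = ∑ i ∈ Finset.range n, A.pr i x := by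
  classical
  refine ⟨(DirectSum.decompose A.gr x).support.sup id + 1, ?_⟩
  conv_lhs => rw [← DirectSum.sum_support_decompose A.gr x]
  refine Finset.sum_subset (fun i hi => ?_) (fun i _ hi => ?_)
  · exact Finset.mem_range.2 (Nat.lt_succ_of_le (Finset.le_sup (f := id) hi))
  · simpa using hi

theorem homogeneous_induction {P : A.carrier → Prop} (x : A.carrier)
    (hom : ∀ i, ∀ y ∈ A.gr i, P y) (add : ∀ y z, P y → P z → P (y + z)) : P x := by
  induction x using DirectSum.Decomposition.inductionOn A.gr with
  | zero => exact hom 0 0 (zero_mem _)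
  | homogeneous m => exact hom _ _ m.2
  | add x y hx hy => exact add _ _ hx hy

theorem ext_pr {x y : A.carrier} (h : ∀ i, A.pr i x = A.pr i y) : x = y := by
  apply (DirectSum.decompose A.gr).injective
  ext i
  exact h i

theorem pr_F (i : ℕ) (x : A.carrier) : A.pr i (A.F x) = A.F (A.pr i x) :=
  IsSaturated.decompose_F A x i

theorem pr_d (i : ℕ) (x : A.carrier) : A.pr (i + 1) (A.d x) = A.d (A.pr i x) := by
  induction x using homogeneous_induction with
  | hom j y hy =>
    by_cases hij : j = i
    · subst hij
      rw [pr_same hy, pr_same (A.d_mem _ _ hy)]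
    · rw [pr_ne hy hij, pr_ne (A.d_mem _ _ hy) (by omega), map_zero]
  | add y z hy hz => simp [hy, hz]

theorem pr_zero_d (x : A.carrier) : A.pr 0 (A.d x) = 0 := by
  induction x using homogeneous_induction with
  | hom j y hy => rw [pr_ne (A.d_mem _ _ hy) (by omega)]
  | add y z hy hz => simp [hy, hz]

theorem pow_mul_eq_nsmul {R : Type*} [Ring R] (n m : ℕ) (x : R) : (n : R) ^ m * x = (n ^ m) • x := by
  rw [nsmul_eq_mul, Nat.cast_pow]

theorem pr_p_mul (i : ℕ) (x : A.carrier) : A.pr i ((p : A.carrier) * x) = p * A.pr i x := by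
  rw [← nsmul_eq_mul, map_nsmul, nsmul_eq_mul]

theorem pr_p_pow_mul (i n : ℕ) (x : A.carrier) :
    A.pr i ((p : A.carrier) ^ n * x) = (p : A.carrier) ^ n * A.pr i x := by
  rw [pow_mul_eq_nsmul, map_nsmul, pow_mul_eq_nsmul]

theorem d_p_mul (x : A.carrier) : A.d ((p : A.carrier) * x) = p * A.d x := by
  rw [← nsmul_eq_mul, map_nsmul, nsmul_eq_mul]

theorem d_p_pow_mul (n : ℕ) (x : A.carrier) :
    A.d ((p : A.carrier) ^ n * x) = (p : A.carrier) ^ n * A.d x := by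
  rw [pow_mul_eq_nsmul, map_nsmul, pow_mul_eq_nsmul]

theorem p_mul_mem {i : ℕ} {x : A.carrier} (hx : x ∈ A.gr i) : (p : A.carrier) * x ∈ A.gr i := by
  rw [← nsmul_eq_mul]; exact nsmul_mem hx p

theorem p_pow_mul_mem {i : ℕ} (n : ℕ) {x : A.carrier} (hx : x ∈ A.gr i) :
    (p : A.carrier) ^ n * x ∈ A.gr i := by
  rw [pow_mul_eq_nsmul]; exact nsmul_mem hx _

theorem F_p_mul (x : A.carrier) : A.F ((p : A.carrier) * x) = p * A.F x := by simp

theorem Fpow_succ (n : ℕ) (x : A.carrier) : (A.F ^ (n + 1)) x = A.F ((A.F ^ n) x) := by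
  rw [pow_succ']; rfl

theorem Fpow_succ' (n : ℕ) (x : A.carrier) : (A.F ^ (n + 1)) x = (A.F ^ n) (A.F x) := by
  rw [pow_succ]; rfl

theorem Fpow_add (m n : ℕ) (x : A.carrier) : (A.F ^ (m + n)) x = (A.F ^ m) ((A.F ^ n) x) := by
  rw [pow_add]; rfl

theorem Fpow_mem (n i : ℕ) {x : A.carrier} (hx : x ∈ A.gr i) : (A.F ^ n) x ∈ A.gr i := by
  induction n with
  | zero => exact hx
  | succ n ih => rw [Fpow_succ]; exact A.F_mem _ _ ih

theorem d_Fpow (n : ℕ) (x : A.carrier) : A.d ((A.F ^ n) x) = (p : A.carrier) ^ n * (A.F ^ n) (A.d x) := by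
  induction n with
  | zero => simp
  | succ n ih =>
    rw [Fpow_succ, A.d_F, ih, map_mul, map_pow, map_natCast, ← mul_assoc, ← pow_succ', Fpow_succ]

theorem d_algebraMap (w : W) : A.d (algebraMap W A.carrier w) = 0 := by
  have h1 : A.d (1 : A.carrier) = 0 := by
    have := A.d_mul 0 1 SetLike.GradedOne.one_mem 1
    simpa using this
  rw [Algebra.algebraMap_eq_smul_one, map_smul, h1, smul_zero]

theorem d_one : A.d (1 : A.carrier) = 0 := by
  simpa using A.d_algebraMap (1 : W)

theorem d_zero_mul {a : A.carrier} (ha : a ∈ A.gr 0) (b : A.carrier) :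
    A.d (a * b) = A.d a * b + a * A.d b := by
  simpa using A.d_mul 0 a ha b

theorem zero_comm {i : ℕ} {a b : A.carrier} (ha : a ∈ A.gr 0) (hb : b ∈ A.gr i) :
    a * b = b * a := by
  simpa using A.graded_comm 0 i a ha b hb

theorem d_pow_zero {a : A.carrier} (ha : a ∈ A.gr 0) (n : ℕ) :
    A.d (a ^ n) = n * a ^ (n - 1) * A.d a := by
  induction n with
  | zero => simpa using A.d_one
  | succ n ih =>
    rw [pow_succ', A.d_zero_mul ha, ih]
    have hcomm : A.d a * a ^ n = a ^ n * A.d a :=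
      (A.zero_comm (i := 1) (by simpa using SetLike.pow_mem_graded n ha) (A.d_mem 0 a ha)).symm
    rw [hcomm]
    -- The exponent `n - 1` is truncated, so `a * a ^ (n - 1) = a ^ n` needs `n` positive.
    rcases n with _ | n
    · simp
    · rw [Nat.add_sub_cancel, Nat.add_sub_cancel, ← mul_assoc a, ← mul_assoc a,
        (Nat.cast_commute (n + 1) a).symm.eq, mul_assoc _ a, ← pow_succ' a n]
      push_cast
      noncomm_ring

end Components

namespace Hom

variable {A B : LogDieudonneAlg p β}

theorem f_pr (g : Hom A B) (i : ℕ) (x : A.carrier) : g.f (A.pr i x) = B.pr i (g.f x) := by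
  induction x using homogeneous_induction with
  | hom j y hy =>
    by_cases hij : j = i
    · subst hij
      rw [pr_same hy, pr_same (g.f_mem _ _ hy)]
    · rw [pr_ne hy hij, pr_ne (g.f_mem _ _ hy) hij, map_zero]
  | add y z hy hz => simp [hy, hz]

theorem f_Fpow (g : Hom A B) (n : ℕ) (x : A.carrier) : g.f ((A.F ^ n) x) = (B.F ^ n) (g.f x) := by
  induction n with
  | zero => rfl
  | succ n ih => rw [Fpow_succ, g.f_F, ih, Fpow_succ]

theorem f_V (g : Hom A B) (hA : A.IsSaturated) (hB : B.IsSaturated) (x : A.carrier) :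
    g.f (hA.V x) = hB.V (g.f x) := by
  apply hB.F_injective
  rw [← g.f_F, hA.F_V, hB.F_V]
  simp

theorem f_Vpow (g : Hom A B) (hA : A.IsSaturated) (hB : B.IsSaturated) (n : ℕ) (x : A.carrier) :
    g.f ((hA.V ^ n) x) = (hB.V ^ n) (g.f x) := by
  induction n generalizing x with
  | zero => rfl
  | succ n ih =>
    rw [pow_succ, pow_succ]
    change g.f ((hA.V ^ n) (hA.V x)) = (hB.V ^ n) (hB.V (g.f x))
    rw [ih, g.f_V hA hB]

end Hom

/-! ### Verschiebung and the filtration `Fil^r` of a saturated object -/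

namespace IsSaturated

variable {A : LogDieudonneAlg p β} (h : A.IsSaturated)

theorem Fpow_injective (h : A.IsSaturated) (n : ℕ) : Function.Injective (A.F ^ n) := by
  induction n with
  | zero => exact fun _ _ h => h
  | succ n ih =>
    intro x y hxy
    rw [Fpow_succ, Fpow_succ] at hxy
    exact ih (h.F_injective hxy)

theorem cancel_p (h : A.IsSaturated) {x y : A.carrier} (hxy : (p : A.carrier) * x = p * y) : x = y :=
  h.cancel 1 (by simpa using hxy)

theorem eq_V_of_F_eq {x y : A.carrier} (hxy : A.F y = p * x) : y = h.V x :=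
  h.F_injective (by rw [hxy, h.F_V])

theorem V_F (x : A.carrier) : h.V (A.F x) = p * x :=
  (h.eq_V_of_F_eq (F_p_mul x)).symm

theorem Vpow_succ (n : ℕ) (x : A.carrier) : (h.V ^ (n + 1)) x = h.V ((h.V ^ n) x) := by
  rw [pow_succ']; rfl

theorem Vpow_succ' (n : ℕ) (x : A.carrier) : (h.V ^ (n + 1)) x = (h.V ^ n) (h.V x) := by
  rw [pow_succ]; rfl

theorem Vpow_p_mul (n : ℕ) (x : A.carrier) : (h.V ^ n) (p * x) = p * (h.V ^ n) x := by
  rw [← nsmul_eq_mul, map_nsmul, nsmul_eq_mul]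

/-- `p F d V = d F V = p d`, and `p` is a nonzerodivisor. -/
theorem F_d_V (x : A.carrier) : A.F (A.d (h.V x)) = A.d x := by
  apply h.cancel_p
  rw [← A.d_F, h.F_V, d_p_mul]

theorem V_d (x : A.carrier) : h.V (A.d x) = p * A.d (h.V x) := by
  symm
  apply h.eq_V_of_F_eq
  rw [F_p_mul, h.F_d_V]

theorem V_mem {i : ℕ} {x : A.carrier} (hx : x ∈ A.gr i) : h.V x ∈ A.gr i := by
  have : A.pr i (h.V x) = h.V x := by
    apply h.F_injective
    rw [← pr_F, h.F_V, pr_p_mul, pr_same hx]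
  rw [← this]
  exact A.pr_mem _ _

theorem pr_V (i : ℕ) (x : A.carrier) : A.pr i (h.V x) = h.V (A.pr i x) := by
  apply h.eq_V_of_F_eq
  rw [← pr_F, h.F_V, pr_p_mul]

theorem pr_Vpow (i n : ℕ) (x : A.carrier) : A.pr i ((h.V ^ n) x) = (h.V ^ n) (A.pr i x) := by
  induction n with
  | zero => rfl
  | succ n ih => rw [h.Vpow_succ, h.pr_V, ih, h.Vpow_succ]

theorem Vpow_mem (n : ℕ) {i : ℕ} {x : A.carrier} (hx : x ∈ A.gr i) : (h.V ^ n) x ∈ A.gr i := by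
  induction n with
  | zero => exact hx
  | succ n ih => rw [h.Vpow_succ]; exact h.V_mem ih

theorem V_mul (x y : A.carrier) : h.V x * y = h.V (x * A.F y) := by
  apply h.F_injective
  rw [map_mul, h.F_V, h.F_V, mul_assoc]

theorem mul_Vpow (n : ℕ) (x y : A.carrier) : x * (h.V ^ n) y = (h.V ^ n) ((A.F ^ n) x * y) := by
  induction n generalizing x with
  | zero => rfl
  | succ n ih => rw [h.Vpow_succ, h.mul_V, ih, h.Vpow_succ, ← Fpow_succ']

theorem Vpow_mul (n : ℕ) (x y : A.carrier) : (h.V ^ n) x * y = (h.V ^ n) (x * (A.F ^ n) y) := by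
  induction n generalizing y with
  | zero => rfl
  | succ n ih => rw [h.Vpow_succ, h.V_mul, ih, h.Vpow_succ, ← Fpow_succ']

theorem Fpow_d_Vpow (n : ℕ) (x : A.carrier) : (A.F ^ n) (A.d ((h.V ^ n) x)) = A.d x := by
  induction n with
  | zero => rfl
  | succ n ih => rw [Fpow_succ', h.Vpow_succ, h.F_d_V, ih]

/-- In a saturated log Dieudonné algebra, `F` hits everything whose differential is divisible
by `p`. -/
theorem exists_F_eq (h : A.IsSaturated) {x z : A.carrier} (hx : A.d x = p * z) : ∃ y, A.F y = x := by
  have hom : ∀ i, ∃ y, A.F y = A.pr i x := by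
    intro i
    -- Scaling the `i`-th component by `p^i` puts it in `η_p A`, the image of `φ_F = p^i F`.
    obtain ⟨y, -, hy⟩ := (h.bijOn i).surjOn
      (a := (p : A.carrier) ^ i * A.pr i x)
      ⟨⟨_, A.pr_mem i x, rfl⟩, A.pr (i + 1) z, A.pr_mem _ _, by
        rw [d_p_pow_mul, ← pr_d, hx, pr_p_mul, ← mul_assoc, ← pow_succ]⟩
    exact ⟨y, h.cancel i hy⟩
  choose y hy using hom
  obtain ⟨n, hn⟩ := exists_sum_pr x
  exact ⟨∑ i ∈ Finset.range n, y i, by rw [map_sum, Finset.sum_congr rfl fun i _ => hy i, ← hn]⟩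

/-- Extract one `F` at a time: with `x = F y`, `F (d y) = p^n z`, and `d y` must again be divisible
by `p^n`. For `n > 0`, `F V = p` gives `d y = p^(n-1) V z`; moreover `d z = 0`, so `z = F w` and `V
z = p w`, which supplies the missing factor `p`. -/
theorem exists_Fpow_eq (h : A.IsSaturated) (n : ℕ) {x z : A.carrier} (hx : A.d x = (p : A.carrier) ^ n * z) :
    ∃ y, (A.F ^ n) y = x := by
  induction n generalizing x z with
  | zero => exact ⟨x, rfl⟩
  | succ n ih =>
    obtain ⟨y, rfl⟩ := h.exists_F_eq (x := x) (z := (p : A.carrier) ^ n * z) (by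
      rw [hx, pow_succ', mul_assoc])
    have h1 : A.F (A.d y) = (p : A.carrier) ^ n * z := by
      apply h.cancel_p
      rw [← A.d_F, hx, pow_succ', mul_assoc]
    rcases n with _ | n
    · exact ⟨y, rfl⟩
    · have h2 : A.d (A.d y) = 0 := A.d_d y
      have h3 : A.d y = (p : A.carrier) ^ n * h.V z := by
        apply h.F_injective
        rw [h1, map_mul, map_pow, map_natCast, h.F_V, ← mul_assoc, pow_succ]
      obtain ⟨w, hw⟩ := h.exists_F_eq (x := z) (z := 0) (by
        have : (p : A.carrier) ^ (n + 1) * A.d z = (p : A.carrier) ^ (n + 1) * 0 := by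
          rw [← d_p_pow_mul, ← h1, A.d_F, h2]; simp
        rw [h.cancel _ this]; simp)
      obtain ⟨y', hy'⟩ := ih (x := y) (z := w) (by
        rw [h3, ← hw, h.V_F, ← mul_assoc, pow_succ])
      exact ⟨y', by rw [Fpow_succ, hy']⟩

theorem mem_Fil {r : ℕ} {x : A.carrier} :
    x ∈ h.Fil r ↔ ∃ a b, x = (h.V ^ r) a + A.d ((h.V ^ r) b) := by
  rw [Fil, AddSubgroup.mem_sup]
  constructor
  · rintro ⟨_, ⟨a, rfl⟩, _, ⟨_, ⟨b, rfl⟩, rfl⟩, rfl⟩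
    exact ⟨a, b, rfl⟩
  · rintro ⟨a, b, rfl⟩
    exact ⟨_, ⟨a, rfl⟩, _, ⟨_, ⟨b, rfl⟩, rfl⟩, rfl⟩

theorem Vpow_mem_Fil (r : ℕ) (a : A.carrier) : (h.V ^ r) a ∈ h.Fil r :=
  h.mem_Fil.2 ⟨a, 0, by simp⟩

theorem d_Vpow_mem_Fil (r : ℕ) (a : A.carrier) : A.d ((h.V ^ r) a) ∈ h.Fil r :=
  h.mem_Fil.2 ⟨0, a, by simp⟩

theorem Fil_le {r s : ℕ} (hrs : r ≤ s) : h.Fil s ≤ h.Fil r := by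
  induction s, hrs using Nat.le_induction with
  | base => exact le_rfl
  | succ s _ ih => exact (h.Fil_succ_le s).trans ih

theorem d_mem_Fil {r : ℕ} {x : A.carrier} (hx : x ∈ h.Fil r) : A.d x ∈ h.Fil r := by
  obtain ⟨a, b, rfl⟩ := h.mem_Fil.1 hx
  rw [map_add, A.d_d, add_zero]
  exact h.d_Vpow_mem_Fil r a

theorem F_mem_Fil {r : ℕ} {x : A.carrier} (hx : x ∈ h.Fil (r + 1)) : A.F x ∈ h.Fil r := by
  obtain ⟨a, b, rfl⟩ := h.mem_Fil.1 hx
  rw [map_add, h.Vpow_succ, h.Vpow_succ, h.F_V, h.F_d_V, ← h.Vpow_p_mul]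
  exact add_mem (h.Vpow_mem_Fil r _) (h.d_Vpow_mem_Fil r _)

theorem V_mem_Fil {r : ℕ} {x : A.carrier} (hx : x ∈ h.Fil r) : h.V x ∈ h.Fil (r + 1) := by
  obtain ⟨a, b, rfl⟩ := h.mem_Fil.1 hx
  rw [map_add, ← h.Vpow_succ, h.V_d, ← h.Vpow_succ, ← d_p_mul, ← h.Vpow_p_mul]
  exact add_mem (h.Vpow_mem_Fil _ _) (h.d_Vpow_mem_Fil _ _)

theorem pr_mem_Fil {r : ℕ} (i : ℕ) {x : A.carrier} (hx : x ∈ h.Fil r) : A.pr i x ∈ h.Fil r := by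
  obtain ⟨a, b, rfl⟩ := h.mem_Fil.1 hx
  rw [map_add, h.pr_Vpow]
  refine add_mem (h.Vpow_mem_Fil _ _) ?_
  rcases i with _ | i
  · rw [pr_zero_d]; exact zero_mem _
  · rw [pr_d, h.pr_Vpow]; exact h.d_Vpow_mem_Fil _ _

theorem neg_one_pow_mul_mem {S : AddSubgroup A.carrier} (i : ℕ) {x : A.carrier}
    (hx : (-1) ^ i * x ∈ S) : x ∈ S := by
  rcases neg_one_pow_eq_or A.carrier i with hi | hi
  · simpa [hi] using hx
  · simpa [hi] using hx

/-- The projection formula `x V^r y = V^r (F^r x · y)` handles the first summand. For the second,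
Leibniz turns `x · d V^r b` into `± (d (x V^r b) - d x · V^r b)`; the sign depends on the degree of
`x`, hence the reduction to homogeneous `x`. -/
theorem mul_mem_Fil {r : ℕ} (x : A.carrier) {y : A.carrier} (hy : y ∈ h.Fil r) :
    x * y ∈ h.Fil r := by
  obtain ⟨a, b, rfl⟩ := h.mem_Fil.1 hy
  rw [mul_add, h.mul_Vpow]
  refine add_mem (h.Vpow_mem_Fil _ _) ?_
  clear hy
  induction x using homogeneous_induction with
  | hom i y hy =>
    apply neg_one_pow_mul_mem i
    have := A.d_mul i y hy ((h.V ^ r) b)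
    rw [← sub_eq_iff_eq_add'.2 this, h.mul_Vpow, h.mul_Vpow]
    exact sub_mem (h.d_Vpow_mem_Fil _ _) (h.Vpow_mem_Fil _ _)
  | add y z hy hz =>
    rw [add_mul]
    exact add_mem hy hz

/-- Mirror image of `mul_mem_Fil`; the Leibniz sign now depends on the degree of `b`. -/
theorem mem_Fil_mul {r : ℕ} {x : A.carrier} (y : A.carrier) (hx : x ∈ h.Fil r) :
    x * y ∈ h.Fil r := by
  obtain ⟨a, b, rfl⟩ := h.mem_Fil.1 hx
  rw [add_mul, h.Vpow_mul]
  refine add_mem (h.Vpow_mem_Fil _ _) ?_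
  clear hx
  induction b using homogeneous_induction with
  | hom i b hb =>
    have := A.d_mul i _ (h.Vpow_mem r hb) y
    rw [← sub_eq_iff_eq_add.2 this, h.Vpow_mul, h.Vpow_mul]
    refine sub_mem (h.d_Vpow_mem_Fil _ _) ?_
    apply neg_one_pow_mul_mem i
    rw [← mul_assoc, ← pow_add, (Even.add_self i).neg_one_pow, one_mul]
    exact h.Vpow_mem_Fil _ _
  | add b c hb hc =>
    rw [map_add, map_add, add_mul]
    exact add_mem hb hc

/-- Let `p x = V^(r+1) a + d V^(r+1) b`. Applying `F^(r+1) d` shows that `p` divides `d a`, so `a =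
F a'` and `V^(r+1) a = p V^r a'`. After subtracting this, `F^(r+1)` shows that `p` divides `d b`, so
`b = F b'` likewise, and `p` cancels. This is what keeps the completion torsion free. -/
theorem mem_Fil_of_p_mul_mem {r : ℕ} {x : A.carrier} (hx : p * x ∈ h.Fil (r + 1)) :
    x ∈ h.Fil r := by
  obtain ⟨a, b, hab⟩ := h.mem_Fil.1 hx
  obtain ⟨a', rfl⟩ := h.exists_F_eq (x := a) (z := (A.F ^ (r + 1)) (A.d x)) (by
    rw [← h.Fpow_d_Vpow (r + 1) a]
    have : A.d ((h.V ^ (r + 1)) a) = p * A.d x := by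
      rw [← d_p_mul, hab, map_add, A.d_d, add_zero]
    rw [this, map_mul, map_natCast])
  rw [h.Vpow_succ' r (A.F a'), h.V_F, h.Vpow_p_mul] at hab
  obtain ⟨b', rfl⟩ := h.exists_F_eq (x := b) (z := (A.F ^ (r + 1)) (x - (h.V ^ r) a')) (by
    rw [← h.Fpow_d_Vpow (r + 1) b, ← sub_eq_iff_eq_add'.2 hab, ← mul_sub, map_mul, map_natCast])
  rw [h.Vpow_succ' r (A.F b'), h.V_F, h.Vpow_p_mul, d_p_mul, ← mul_add] at hab
  exact h.mem_Fil.2 ⟨a', b', h.cancel_p hab⟩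

/-- `V F = p`: applying `V` gains a step of the filtration and dividing by `p` loses it again. -/
theorem mem_Fil_of_F_mem {r : ℕ} {x : A.carrier} (hx : A.F x ∈ h.Fil r) : x ∈ h.Fil r := by
  apply h.mem_Fil_of_p_mul_mem
  rw [← h.V_F]
  exact h.V_mem_Fil hx

/-- A version of `exists_F_eq` modulo the filtration. If `d x = p y + V^(r+1) a + d V^(r+1) b`,
applying `d` shows that `p` divides `d a`, whence `V^(r+1) a = p V^r a'`. Then `d (x - V^(r+1) b)`
is divisible by `p`, so `x - V^(r+1) b` is a value of `F`. -/
theorem exists_sub_F_mem_Fil {r : ℕ} {x y : A.carrier} (hxy : A.d x - p * y ∈ h.Fil (r + 1)) :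
    ∃ z, x - A.F z ∈ h.Fil (r + 1) := by
  obtain ⟨a, b, hab⟩ := h.mem_Fil.1 hxy
  obtain ⟨a', rfl⟩ := h.exists_F_eq (x := a) (z := -(A.F ^ (r + 1)) (A.d y)) (by
    rw [← h.Fpow_d_Vpow (r + 1) a]
    have : A.d ((h.V ^ (r + 1)) a) = p * (-A.d y) := by
      have := congrArg A.d hab
      rw [map_sub, map_add, A.d_d, A.d_d, d_p_mul, add_zero, zero_sub] at this
      rw [← this, mul_neg]
    rw [this, map_mul, map_natCast, map_neg])
  rw [h.Vpow_succ' r (A.F a'), h.V_F, h.Vpow_p_mul] at hab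
  obtain ⟨z, hz⟩ := h.exists_F_eq (x := x - (h.V ^ (r + 1)) b) (z := y + (h.V ^ r) a') (by
    rw [map_sub, mul_add, sub_eq_iff_eq_add, add_assoc, ← hab]; abel)
  exact ⟨z, by rw [hz, sub_sub_cancel]; exact h.Vpow_mem_Fil _ _⟩

/-- A differential has no component of degree zero, so only `V^r A^0` survives in degree zero. -/
theorem mem_Fil_of_mem_gr_zero {r : ℕ} {x : A.carrier} (hx : x ∈ A.gr 0) (hr : x ∈ h.Fil r) :
    ∃ a ∈ A.gr 0, x = (h.V ^ r) a := by
  obtain ⟨a, b, hab⟩ := h.mem_Fil.1 hr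
  refine ⟨A.pr 0 a, A.pr_mem _ _, ?_⟩
  rw [← pr_same hx, hab, map_add, pr_zero_d, add_zero, h.pr_Vpow]

end IsSaturated

theorem Hom.f_mem_Fil {A B : LogDieudonneAlg p β} (g : Hom A B) (hA : A.IsSaturated)
    (hB : B.IsSaturated) {r : ℕ} {x : A.carrier} (hx : x ∈ hA.Fil r) : g.f x ∈ hB.Fil r := by
  obtain ⟨a, b, rfl⟩ := hA.mem_Fil.1 hx
  rw [map_add, g.f_d, g.f_Vpow hA hB, g.f_Vpow hA hB]
  exact add_mem (hB.Vpow_mem_Fil _ _) (hB.d_Vpow_mem_Fil _ _)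

/-! ### Limits in strict objects -/

namespace IsStrict

variable {A : LogDieudonneAlg p β}

theorem isSaturated (hA : A.IsStrict) : A.IsSaturated := hA.choose

theorem eq_zero (hA : A.IsStrict) {x : A.carrier} (hx : ∀ r, x ∈ hA.isSaturated.Fil r) : x = 0 := by
  apply ext_pr
  intro i
  rw [map_zero]
  apply (hA.choose_spec i).injOn (A.pr_mem i x) (zero_mem _)
  funext r
  exact (QuotientAddGroup.eq_zero_iff _).2 (hA.isSaturated.pr_mem_Fil i (hx r))

theorem eq_of_sub_mem (hA : A.IsStrict) {x y : A.carrier}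
    (hx : ∀ r, x - y ∈ hA.isSaturated.Fil r) : x = y :=
  sub_eq_zero.1 (hA.eq_zero hx)

theorem exists_limit_of_mem (hA : A.IsStrict) {i : ℕ} {x : ℕ → A.carrier} (hi : ∀ r, x r ∈ A.gr i)
    (hx : ∀ r, x (r + 1) - x r ∈ hA.isSaturated.Fil r) :
    ∃ y ∈ A.gr i, ∀ r, y - x r ∈ hA.isSaturated.Fil r := by
  obtain ⟨y, hy, hy'⟩ := (hA.choose_spec i).surjOn
    (a := fun r => QuotientAddGroup.mk (s := hA.isSaturated.Fil r) (x r))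
    ⟨fun r => ⟨x r, hi r, rfl⟩, fun r => by
      change QuotientAddGroup.mk (s := hA.isSaturated.Fil r) (x (r + 1)) = _
      rw [QuotientAddGroup.eq_iff_sub_mem]
      exact hx r⟩
  refine ⟨y, hy, fun r => ?_⟩
  rw [← QuotientAddGroup.eq_iff_sub_mem]
  exact congrFun hy' r

/-- A compatible sequence of bounded degree in a strict log Dieudonné algebra has a limit. -/
theorem exists_limit (hA : A.IsStrict) {n : ℕ} {x : ℕ → A.carrier}
    (hn : ∀ r, x r = ∑ i ∈ Finset.range n, A.pr i (x r))
    (hx : ∀ r, x (r + 1) - x r ∈ hA.isSaturated.Fil r) :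
    ∃ y, ∀ r, y - x r ∈ hA.isSaturated.Fil r := by
  -- Strictness controls one degree at a time; the bound `n` makes the sum of the degreewise limits
  -- finite.
  have : ∀ i, ∃ y ∈ A.gr i, ∀ r, y - A.pr i (x r) ∈ hA.isSaturated.Fil r := fun i =>
    hA.exists_limit_of_mem (fun r => A.pr_mem i (x r)) fun r => by
      rw [← map_sub]; exact hA.isSaturated.pr_mem_Fil i (hx r)
  choose y _ hy using this
  refine ⟨∑ i ∈ Finset.range n, y i, fun r => ?_⟩
  rw [hn r, ← Finset.sum_sub_distrib]
  exact sum_mem fun i _ => hy i r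

end IsStrict

end LogDieudonneAlg

/-! ### Sign rules in the exterior algebra -/

namespace ExteriorAlgebra

variable {R M : Type*} [CommRing R] [AddCommGroup M] [Module R M]

theorem ι_mul_eq_involute_mul (m : M) (x : ExteriorAlgebra R M) :
    ι R m * x = CliffordAlgebra.involute x * ι R m := by
  induction x using CliffordAlgebra.left_induction with
  | algebraMap r => rw [AlgHom.commutes, Algebra.commutes]
  | add x y hx hy => rw [mul_add, hx, hy, map_add, add_mul]
  | ι_mul x m' hx =>
    rw [map_mul, CliffordAlgebra.involute_ι, mul_assoc, ← hx, ← mul_assoc, ← mul_assoc,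
      eq_neg_of_add_eq_zero_left (ι_add_mul_swap m m'), neg_mul, neg_mul, neg_mul]

theorem involute_of_mem {n : ℕ} {x : ExteriorAlgebra R M} (hx : x ∈ ⋀[R]^n M) :
    CliffordAlgebra.involute x = (-1) ^ n * x := by
  induction hx using Submodule.pow_induction_on_left' with
  | algebraMap r => simp
  | add x y i hx hy hx' hy' => rw [map_add, hx', hy', mul_add]
  | mem_mul m hm i x hx ih =>
    obtain ⟨m, rfl⟩ := hm
    rw [map_mul, CliffordAlgebra.involute_ι, ih, pow_succ', ← mul_assoc, ← mul_assoc,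
      neg_mul, neg_one_mul, neg_mul, neg_mul, ((Commute.neg_one_right _).pow_right i).eq, neg_mul]

theorem mul_comm_of_mem {i j : ℕ} {x y : ExteriorAlgebra R M} (hx : x ∈ ⋀[R]^i M)
    (hy : y ∈ ⋀[R]^j M) : x * y = (-1) ^ (i * j) * (y * x) := by
  induction hx using Submodule.pow_induction_on_left' with
  | algebraMap r => simp [Algebra.commutes]
  | add x x' i hx hx' h h' => rw [add_mul, h, h', mul_add, mul_add]
  | mem_mul m hm i x hx ih =>
    obtain ⟨m, rfl⟩ := hm
    have h1 : ι R m * y = (-1) ^ j * (y * ι R m) := by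
      rw [ι_mul_eq_involute_mul, involute_of_mem hy, mul_assoc]
    have hc : ∀ (z : ExteriorAlgebra R M) (n : ℕ), z * (-1) ^ n = (-1) ^ n * z := fun z n =>
      ((Commute.neg_one_right z).pow_right n).eq
    rw [mul_assoc, ih, ← mul_assoc (ι R m), hc, mul_assoc, ← mul_assoc (ι R m), h1, Nat.succ_mul,
      pow_add]
    simp only [mul_assoc]

/-- Graded commutativity alone yields only `2 x² = 0`. An odd element is a sum of products `m · y`
with `y` of even degree; each product squares to zero because `y` commutes with `m` and `m² = 0`,
and the cross terms cancel. -/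
theorem sq_eq_zero_of_mem {n : ℕ} (hn : Odd n) {x : ExteriorAlgebra R M} (hx : x ∈ ⋀[R]^n M) :
    x * x = 0 := by
  obtain ⟨k, rfl⟩ := hn
  have hx' : x ∈ (LinearMap.range (ι R (M := M))) * (⋀[R]^(2 * k) M) := by
    rw [← pow_succ']; exact hx
  -- The degree is carried through the induction, since cancelling the cross terms of a sum requires
  -- it.
  suffices x ∈ ⋀[R]^(2 * k + 1) M ∧ x * x = 0 from this.2
  clear hx
  induction hx' using Submodule.mul_induction_on' with
  | mem_mul_mem m hm y hy =>
    obtain ⟨m, rfl⟩ := hm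
    refine ⟨?_, ?_⟩
    · change _ ∈ (LinearMap.range (ι R)) ^ (2 * k + 1)
      rw [pow_succ']
      exact Submodule.mul_mem_mul ⟨m, rfl⟩ hy
    · have hc : y * ι R m = ι R m * y := by
        rw [ι_mul_eq_involute_mul, involute_of_mem hy]; simp
      have hm : ι R m * ι R m = 0 := ι_sq_zero m
      change ι R m * y * (ι R m * y) = 0
      rw [mul_assoc, ← mul_assoc y, hc, ← mul_assoc, ← mul_assoc, hm, zero_mul, zero_mul]
  | add x _ y _ hx hy =>
    refine ⟨add_mem hx.1 hy.1, ?_⟩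
    have : x * y = - (y * x) := by
      rw [mul_comm_of_mem hx.1 hy.1, Odd.neg_one_pow, neg_one_mul]
      exact Odd.mul ⟨k, rfl⟩ ⟨k, rfl⟩
    rw [mul_add, add_mul, add_mul, hx.2, hy.2, this]
    abel

end ExteriorAlgebra

/-! ### Universal properties of the log differentials and of their exterior algebra -/

namespace LogAlg

variable {W N : Type u} [CommRing W] [CommMonoid N] {β : N →* W} (A : LogAlg β)

theorem dOmega_add (a b : A.carrier) : A.dOmega (a + b) = A.dOmega a + A.dOmega b := by
  simp only [dOmega, ← map_add, Prod.mk_add_mk, add_zero]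

theorem dOmega_mul (a b : A.carrier) : A.dOmega (a * b) = a • A.dOmega b + b • A.dOmega a := by
  simp only [dOmega, ← map_add, ← map_smul, Prod.mk_add_mk, add_zero, Prod.smul_mk, smul_zero,
    Derivation.leibniz]

theorem dOmega_algebraMap (w : W) : A.dOmega (algebraMap W A.carrier w) = 0 := by
  rw [dOmega, Derivation.map_algebraMap, ← Prod.zero_eq_mk, map_zero]

/-- The universal derivation, as a derivation. -/
def derivOmega : Derivation W A.carrier A.Omega :=
  (A.omegaRel.mkQ.comp (LinearMap.inl A.carrier _ _)).compDer (KaehlerDifferential.D W A.carrier)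

theorem derivOmega_apply (a : A.carrier) : A.derivOmega a = A.dOmega a := rfl

theorem dlog_one : A.dlog 1 = 0 := by
  rw [dlog, map_one, ofMul_one, TensorProduct.tmul_zero, ← Prod.zero_eq_mk, map_zero]

theorem dlog_mul (m n : A.M) : A.dlog (m * n) = A.dlog m + A.dlog n := by
  simp only [dlog, ← map_add, Prod.mk_add_mk, add_zero, map_mul, ofMul_mul, TensorProduct.tmul_add]

theorem dOmega_α (m : A.M) : A.dOmega (A.α m) = A.α m • A.dlog m := by
  rw [dOmega, dlog, ← map_smul, ← sub_eq_zero, ← map_sub, ← LinearMap.mem_ker, Submodule.ker_mkQ]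
  refine Submodule.subset_span (Or.inl ⟨m, ?_⟩)
  simp [TensorProduct.smul_tmul']

theorem dlog_ι (n : N) : A.dlog (A.ι n) = 0 := by
  rw [dlog, ← LinearMap.mem_ker, Submodule.ker_mkQ]
  exact Submodule.subset_span (Or.inr ⟨n, rfl⟩)

theorem span_omega_eq_top :
    Submodule.span A.carrier (Set.range A.dOmega ∪ Set.range A.dlog) = ⊤ := by
  rw [eq_top_iff]
  rintro x -
  obtain ⟨⟨x, t⟩, rfl⟩ := A.omegaRel.mkQ_surjective x
  have hx : A.omegaRel.mkQ (x, 0) ∈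
      Submodule.span A.carrier (Set.range A.dOmega ∪ Set.range A.dlog) := by
    have : x ∈ Submodule.span A.carrier (Set.range (KaehlerDifferential.D W A.carrier)) := by
      rw [KaehlerDifferential.span_range_derivation]; trivial
    induction this using Submodule.span_induction with
    | mem x h =>
      obtain ⟨a, rfl⟩ := h
      exact Submodule.subset_span (Or.inl ⟨a, rfl⟩)
    | zero => rw [← Prod.zero_eq_mk, map_zero]; exact zero_mem _
    | add x y _ _ hx hy =>
      rw [← add_zero (0 : A.carrier ⊗[ℤ] Additive (Algebra.GrothendieckGroup A.M)),
        ← Prod.mk_add_mk, map_add]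
      exact add_mem hx hy
    | smul a x _ hx =>
      rw [← smul_zero a, ← Prod.smul_mk, map_smul]
      exact Submodule.smul_mem _ _ hx
  have hlog : ∀ g : Algebra.GrothendieckGroup A.M, A.omegaRel.mkQ (0, 1 ⊗ₜ Additive.ofMul g) ∈
      Submodule.span A.carrier (Set.range A.dOmega ∪ Set.range A.dlog) := by
    intro g
    -- The group completion consists of quotients `m / n`, whose class is `dlog m - dlog n`.
    obtain ⟨m, n, rfl⟩ : ∃ m n : A.M, g = Algebra.GrothendieckGroup.of m *
        (Algebra.GrothendieckGroup.of n)⁻¹ := by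
      obtain ⟨⟨m, n⟩, h⟩ := (Localization.monoidOf (⊤ : Submonoid A.M)).surj g
      exact ⟨m, n, eq_mul_inv_of_mul_eq h⟩
    rw [ofMul_mul, ofMul_inv, TensorProduct.tmul_add, TensorProduct.tmul_neg, ← sub_eq_add_neg,
      ← sub_zero (0 : Ω[A.carrier⁄W]), ← Prod.mk_sub_mk, map_sub]
    exact sub_mem (Submodule.subset_span (Or.inr ⟨m, rfl⟩))
      (Submodule.subset_span (Or.inr ⟨n, rfl⟩))
  have ht : A.omegaRel.mkQ (0, t) ∈
      Submodule.span A.carrier (Set.range A.dOmega ∪ Set.range A.dlog) := by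
    induction t using TensorProduct.induction_on with
    | zero => rw [← Prod.zero_eq_mk, map_zero]; exact zero_mem _
    | tmul a g =>
      have : ((0, a ⊗ₜ g) : Ω[A.carrier⁄W] × (A.carrier ⊗[ℤ] Additive (Algebra.GrothendieckGroup A.M)))
          = a • (0, 1 ⊗ₜ[ℤ] g) := by
        simp [TensorProduct.smul_tmul']
      rw [this, map_smul]
      exact Submodule.smul_mem _ _ (hlog g.toMul)
    | add x y hx hy =>
      rw [← add_zero (0 : Ω[A.carrier⁄W]), ← Prod.mk_add_mk, map_add]
      exact add_mem hx hy
  have := add_mem hx ht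
  rwa [← map_add, Prod.mk_add_mk, add_zero, zero_add] at this

/-- The universal property of the module of log differentials. -/
theorem exists_omega_lift {M : Type*} [AddCommGroup M] [Module A.carrier M]
    (D : A.carrier →+ M) (δ : A.M → M)
    (D_mul : ∀ a b, D (a * b) = a • D b + b • D a) (D_alg : ∀ w, D (algebraMap W A.carrier w) = 0)
    (δ_one : δ 1 = 0) (δ_mul : ∀ m n, δ (m * n) = δ m + δ n)
    (D_α : ∀ m, D (A.α m) = A.α m • δ m) (δ_ι : ∀ n, δ (A.ι n) = 0) :
    ∃ f : A.Omega →ₗ[A.carrier] M, (∀ a, f (A.dOmega a) = D a) ∧ ∀ m, f (A.dlog m) = δ m := by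
  let _ : Module W M := Module.compHom M (algebraMap W A.carrier)
  have _ : IsScalarTower W A.carrier M := IsScalarTower.of_algebraMap_smul fun _ _ => rfl
  let D' : Derivation W A.carrier M := Derivation.mk'
    { toFun := D
      map_add' := map_add D
      map_smul' := fun w a => by
        rw [Algebra.smul_def, D_mul, D_alg, smul_zero, add_zero]; rfl } D_mul
  let l : A.M →* Multiplicative M :=
    { toFun := fun m => Multiplicative.ofAdd (δ m)
      map_one' := by rw [δ_one]; rfl
      map_mul' := fun m n => by rw [δ_mul]; rfl }
  let l' : Additive (Algebra.GrothendieckGroup A.M) →+ M :=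
    MonoidHom.toAdditiveLeft (Algebra.GrothendieckGroup.lift l)
  have hl' : ∀ m, l' (Additive.ofMul (Algebra.GrothendieckGroup.of m)) = δ m := fun m => by
    have : (Algebra.GrothendieckGroup.lift l) (Algebra.GrothendieckGroup.of m) = l m :=
      DFunLike.congr_fun (Algebra.GrothendieckGroup.lift.symm_apply_apply l) m
    exact congrArg Multiplicative.toAdd this
  let g : (Ω[A.carrier⁄W] × (A.carrier ⊗[ℤ] Additive (Algebra.GrothendieckGroup A.M)))
      →ₗ[A.carrier] M :=
    D'.liftKaehlerDifferential.coprod (LinearMap.liftBaseChange A.carrier l'.toIntLinearMap)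
  have hg : A.omegaRel ≤ LinearMap.ker g := by
    rw [omegaRel, Submodule.span_le]
    rintro _ (⟨m, rfl⟩ | ⟨n, rfl⟩)
    · rw [SetLike.mem_coe, LinearMap.mem_ker, LinearMap.coprod_apply, map_neg,
        LinearMap.liftBaseChange_tmul, Derivation.liftKaehlerDifferential_comp_D]
      change D (A.α m) + -(A.α m • l' _) = 0
      rw [hl', D_α, add_neg_cancel]
    · rw [SetLike.mem_coe, LinearMap.mem_ker, LinearMap.coprod_apply,
        LinearMap.liftBaseChange_tmul, map_zero, zero_add, one_smul]
      exact (hl' _).trans (δ_ι n)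
  refine ⟨A.omegaRel.liftQ g hg, fun a => ?_, fun m => ?_⟩
  · rw [dOmega, Submodule.mkQ_apply, Submodule.liftQ_apply, LinearMap.coprod_apply, map_zero,
      add_zero, Derivation.liftKaehlerDifferential_comp_D]
    rfl
  · rw [dlog, Submodule.mkQ_apply, Submodule.liftQ_apply, LinearMap.coprod_apply, map_zero,
      zero_add, LinearMap.liftBaseChange_tmul, one_smul]
    exact hl' m

/-- The exterior algebra on the log differentials. -/
abbrev Ext : Type u := ExteriorAlgebra A.carrier A.Omega

/-- The degree one element `d a` of the exterior algebra. -/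
abbrev extDa (a : A.carrier) : A.Ext := ExteriorAlgebra.ι A.carrier (A.dOmega a)

/-- The degree one element `dlog m` of the exterior algebra. -/
abbrev extDlog (m : A.M) : A.Ext := ExteriorAlgebra.ι A.carrier (A.dlog m)

theorem extDa_mul (a b : A.carrier) : A.extDa (a * b) =
    algebraMap _ _ a * A.extDa b + algebraMap _ _ b * A.extDa a := by
  rw [extDa, dOmega_mul, map_add, map_smul, map_smul, Algebra.smul_def, Algebra.smul_def]

theorem extDa_add (a b : A.carrier) : A.extDa (a + b) = A.extDa a + A.extDa b := by
  rw [extDa, dOmega_add, map_add]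

theorem extDa_algebraMap (w : W) : A.extDa (algebraMap W A.carrier w) = 0 := by
  rw [extDa, dOmega_algebraMap, map_zero]

theorem extDa_α (m : A.M) : A.extDa (A.α m) = algebraMap _ _ (A.α m) * A.extDlog m := by
  rw [extDa, dOmega_α, map_smul, Algebra.smul_def]

variable {A} in
-- Left multiplication by `a`, `d a` and `dlog m` generates everything additively from `1`. The
-- predicate need not be linear over the coefficients, so this applies to `d` and `F`.
theorem ext_induction {P : A.Ext → Prop} (x : A.Ext) (one : P 1)
    (add : ∀ x y, P x → P y → P (x + y)) (algebraMap_mul : ∀ (a : A.carrier) x, P x → P (algebraMap _ _ a * x))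
    (da_mul : ∀ a x, P x → P (A.extDa a * x)) (dlog_mul : ∀ m x, P x → P (A.extDlog m * x)) :
    P x := by
  induction x using CliffordAlgebra.left_induction with
  | algebraMap r => simpa using algebraMap_mul r 1 one
  | add x y hx hy => exact add x y hx hy
  | ι_mul x w hx =>
    have hw : w ∈ Submodule.span A.carrier (Set.range A.dOmega ∪ Set.range A.dlog) := by
      rw [span_omega_eq_top]; trivial
    change P (ExteriorAlgebra.ι A.carrier w * x)
    induction hw using Submodule.span_induction with
    | mem y h =>
      rcases h with ⟨a, rfl⟩ | ⟨m, rfl⟩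
      · exact da_mul a x hx
      · exact dlog_mul m x hx
    | zero => simpa using algebraMap_mul 0 1 one
    | add y z _ _ hy hz => rw [map_add, add_mul]; exact add _ _ hy hz
    | smul a y _ hy =>
      rw [map_smul, Algebra.smul_def, mul_assoc]
      exact algebraMap_mul _ _ hy

/-- The universal property of the log de Rham complex, forgetting the differential. -/
theorem exists_ext_lift_of_algebra {B : Type*} [Ring B] [Algebra A.carrier B]
    (D : A.carrier →+ B) (δ : A.M → B)
    (D_mul : ∀ a b, D (a * b) = a • D b + b • D a) (D_alg : ∀ w, D (algebraMap W A.carrier w) = 0)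
    (δ_one : δ 1 = 0) (δ_mul : ∀ m n, δ (m * n) = δ m + δ n)
    (D_α : ∀ m, D (A.α m) = A.α m • δ m) (δ_ι : ∀ n, δ (A.ι n) = 0)
    (sq : ∀ x ∈ Set.range D ∪ Set.range δ, x * x = 0)
    (anti : ∀ x ∈ Set.range D ∪ Set.range δ, ∀ y ∈ Set.range D ∪ Set.range δ, x * y + y * x = 0) :
    ∃ f : A.Ext →ₐ[A.carrier] B, (∀ a, f (A.extDa a) = D a) ∧ ∀ m, f (A.extDlog m) = δ m := by
  obtain ⟨f, hD, hδ⟩ := A.exists_omega_lift D δ D_mul D_alg δ_one δ_mul D_α δ_ι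
  have hgen : ∀ w ∈ Set.range A.dOmega ∪ Set.range A.dlog, f w ∈ Set.range D ∪ Set.range δ := by
    rintro _ (⟨a, rfl⟩ | ⟨m, rfl⟩)
    · exact Or.inl ⟨a, (hD a).symm⟩
    · exact Or.inr ⟨m, (hδ m).symm⟩
  have hspan : ∀ w, w ∈ Submodule.span A.carrier (Set.range A.dOmega ∪ Set.range A.dlog) := by
    intro w
    rw [span_omega_eq_top]; trivial
  -- Anticommutation is bilinear and extends from the generators; vanishing of squares is not
  -- additive, and `hsq` uses `hanti` for its cross terms.
  have hanti : ∀ w v, f w * f v + f v * f w = 0 := by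
    intro w v
    induction hspan w using Submodule.span_induction with
    | mem w hw =>
      induction hspan v using Submodule.span_induction with
      | mem v hv => exact anti _ (hgen w hw) _ (hgen v hv)
      | zero => simp
      | add x y _ _ hx hy =>
        rw [map_add, mul_add, add_mul, add_add_add_comm, hx, hy, add_zero]
      | smul a x _ hx => rw [map_smul, mul_smul_comm, smul_mul_assoc, ← smul_add, hx, smul_zero]
    | zero => simp
    | add x y _ _ hx hy => rw [map_add, mul_add, add_mul, add_add_add_comm, hx, hy, add_zero]
    | smul a x _ hx => rw [map_smul, mul_smul_comm, smul_mul_assoc, ← smul_add, hx, smul_zero]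
  have hsq : ∀ w, f w * f w = 0 := by
    intro w
    induction hspan w using Submodule.span_induction with
    | mem w hw => exact sq _ (hgen w hw)
    | zero => simp
    | add x y _ _ hx hy =>
      rw [map_add, mul_add, add_mul, add_mul, hx, hy, zero_add, add_zero, add_comm, hanti]
    | smul a x _ hx => rw [map_smul, mul_smul_comm, smul_mul_assoc, hx, smul_zero, smul_zero]
  refine ⟨ExteriorAlgebra.lift A.carrier ⟨f, hsq⟩, fun a => ?_, fun m => ?_⟩
  · rw [ExteriorAlgebra.lift_ι_apply, hD]
  · rw [ExteriorAlgebra.lift_ι_apply, hδ]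

/-- The universal property of the log de Rham complex, forgetting the differential, for a ring
in which the image of the coefficients need not be central. -/
theorem exists_ext_lift {B : Type*} [Ring B] (g : A.carrier →+* B)
    (D : A.carrier →+ B) (δ : A.M → B)
    (g_D : ∀ a b, g a * D b = D b * g a) (g_δ : ∀ a m, g a * δ m = δ m * g a)
    (D_mul : ∀ a b, D (a * b) = g a * D b + g b * D a)
    (D_alg : ∀ w, D (algebraMap W A.carrier w) = 0)
    (δ_one : δ 1 = 0) (δ_mul : ∀ m n, δ (m * n) = δ m + δ n)
    (D_α : ∀ m, D (A.α m) = g (A.α m) * δ m) (δ_ι : ∀ n, δ (A.ι n) = 0)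
    (sq : ∀ x ∈ Set.range D ∪ Set.range δ, x * x = 0)
    (anti : ∀ x ∈ Set.range D ∪ Set.range δ, ∀ y ∈ Set.range D ∪ Set.range δ, x * y + y * x = 0) :
    ∃ f : A.Ext →+* B, (∀ a, f (algebraMap _ _ a) = g a) ∧
      (∀ a, f (A.extDa a) = D a) ∧ ∀ m, f (A.extDlog m) = δ m := by
  -- The centralizer of the image of `g` contains all the given data, and inside it `g` is central;
  -- so the version for algebras applies to `C`.
  let C : Subring B := Subring.centralizer (Set.range g)
  have hg : ∀ a, g a ∈ C := fun a => by
    rintro _ ⟨b, rfl⟩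
    rw [← map_mul, ← map_mul, mul_comm]
  have hD : ∀ a, D a ∈ C := fun a => by
    rintro _ ⟨b, rfl⟩
    exact g_D b a
  have hδ : ∀ m, δ m ∈ C := fun m => by
    rintro _ ⟨b, rfl⟩
    exact g_δ b m
  let _ : Algebra A.carrier C := RingHom.toAlgebra' (g.codRestrict C hg) fun a x =>
    Subtype.ext (x.2 _ ⟨a, rfl⟩)
  have hsmul : ∀ (a : A.carrier) (x : C), ((a • x : C) : B) = g a * x := fun a x => by
    rw [Algebra.smul_def]; rfl
  obtain ⟨f, hfD, hfδ⟩ := A.exists_ext_lift_of_algebra (B := C)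
    ⟨⟨fun a => ⟨D a, hD a⟩, Subtype.ext (map_zero D)⟩, fun a b => Subtype.ext (map_add D a b)⟩
    (fun m => ⟨δ m, hδ m⟩)
    (fun a b => Subtype.ext (by
      rw [Subring.coe_add, hsmul, hsmul]; exact D_mul a b))
    (fun w => Subtype.ext (D_alg w)) (Subtype.ext δ_one) (fun m n => Subtype.ext (δ_mul m n))
    (fun m => Subtype.ext (by rw [hsmul]; exact D_α m)) (fun n => Subtype.ext (δ_ι n))
    (by
      rintro _ (⟨a, rfl⟩ | ⟨m, rfl⟩)
      · exact Subtype.ext (sq _ (Or.inl ⟨a, rfl⟩))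
      · exact Subtype.ext (sq _ (Or.inr ⟨m, rfl⟩)))
    (by
      rintro _ (⟨a, rfl⟩ | ⟨m, rfl⟩) _ (⟨b, rfl⟩ | ⟨n, rfl⟩)
      · exact Subtype.ext (anti _ (Or.inl ⟨a, rfl⟩) _ (Or.inl ⟨b, rfl⟩))
      · exact Subtype.ext (anti _ (Or.inl ⟨a, rfl⟩) _ (Or.inr ⟨n, rfl⟩))
      · exact Subtype.ext (anti _ (Or.inr ⟨m, rfl⟩) _ (Or.inl ⟨b, rfl⟩))
      · exact Subtype.ext (anti _ (Or.inr ⟨m, rfl⟩) _ (Or.inr ⟨n, rfl⟩)))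
  refine ⟨C.subtype.comp f.toRingHom, fun a => ?_, fun a => ?_, fun m => ?_⟩
  · exact congrArg Subtype.val (f.commutes a)
  · exact congrArg Subtype.val (hfD a)
  · exact congrArg Subtype.val (hfδ m)

variable {A} in
theorem ext_hom_ext {B : Type*} [Ring B] {f g : A.Ext →+* B}
    (h : ∀ a : A.carrier, f (algebraMap _ _ a) = g (algebraMap _ _ a))
    (hD : ∀ a, f (A.extDa a) = g (A.extDa a)) (hδ : ∀ m, f (A.extDlog m) = g (A.extDlog m)) :
    f = g := by
  ext x
  induction x using ext_induction with
  | one => rw [map_one, map_one]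
  | add x y hx hy => rw [map_add, map_add, hx, hy]
  | algebraMap_mul a x hx => rw [map_mul, map_mul, hx, h]
  | da_mul a x hx => rw [map_mul, map_mul, hx, hD]
  | dlog_mul m x hx => rw [map_mul, map_mul, hx, hδ]

end LogAlg

/-! ### Twisted derivations as triangular matrices -/

section UpperTriangular

variable {R : Type*} [Ring R]

/-- An upper triangular `2 × 2` matrix. -/
def upperTri (a b c : R) : Matrix (Fin 2) (Fin 2) R := !![a, b; 0, c]

theorem upperTri_mul (a b c a' b' c' : R) :
    upperTri a b c * upperTri a' b' c' = upperTri (a * a') (a * b' + b * c') (c * c') := by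
  simp [upperTri]

theorem upperTri_add (a b c a' b' c' : R) :
    upperTri a b c + upperTri a' b' c' = upperTri (a + a') (b + b') (c + c') := by
  ext i j; fin_cases i <;> fin_cases j <;> simp [upperTri]

theorem upperTri_zero : upperTri (0 : R) 0 0 = 0 := by
  ext i j; fin_cases i <;> fin_cases j <;> simp [upperTri]

theorem upperTri_one : upperTri (1 : R) 0 1 = 1 := by
  ext i j; fin_cases i <;> fin_cases j <;> simp [upperTri]

theorem upperTri_inj {a b c a' b' c' : R} (h : upperTri a b c = upperTri a' b' c') : b = b' := by
  simpa [upperTri] using congrFun (congrFun h 0) 1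

/-- A ring homomorphism `x ↦ (σ x, d x; 0, x)` is the same as a `σ`-twisted derivation `d`. -/
theorem exists_twisted_derivation (σ : R →+* R) (f : R →+* Matrix (Fin 2) (Fin 2) R)
    (hf : ∀ x, ∃ b, f x = upperTri (σ x) b x) :
    ∃ d : R →+ R, (∀ x, f x = upperTri (σ x) (d x) x) ∧ ∀ x y, d (x * y) = d x * y + σ x * d y := by
  choose d hd using hf
  refine ⟨AddMonoidHom.mk' d fun x y => ?_, hd, fun x y => ?_⟩
  · apply upperTri_inj (a := σ (x + y)) (c := x + y) (a' := σ x + σ y) (c' := x + y)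
    rw [← hd, map_add, hd x, hd y, upperTri_add]
  · apply upperTri_inj (a := σ (x * y)) (c := x * y) (a' := σ x * σ y) (c' := x * y)
    change upperTri _ (d _) _ = upperTri _ (d x * y + σ x * d y) _
    rw [← hd, map_mul, hd x, hd y, upperTri_mul, add_comm]

end UpperTriangular

/-! ### The exterior differential -/

namespace LogAlg

variable {W N : Type u} [CommRing W] [CommMonoid N] {β : N →* W} (A : LogAlg β)

/-- Log derivations of degree one give ring homomorphisms to upper triangular matrices. -/
theorem exists_ext_lift_upperTri {B : Type*} [Ring B] (c : A.carrier →+* B)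
    (D : A.carrier →+ B) (δ : A.M → B) (c_comm : ∀ a x, c a * x = x * c a)
    (D_mul : ∀ a b, D (a * b) = c a * D b + c b * D a)
    (D_alg : ∀ w, D (algebraMap W A.carrier w) = 0)
    (δ_one : δ 1 = 0) (δ_mul : ∀ m n, δ (m * n) = δ m + δ n)
    (D_α : ∀ m, D (A.α m) = c (A.α m) * δ m) (δ_ι : ∀ n, δ (A.ι n) = 0)
    (sq : ∀ x ∈ Set.range D ∪ Set.range δ, x * x = 0)
    (anti : ∀ x ∈ Set.range D ∪ Set.range δ, ∀ y ∈ Set.range D ∪ Set.range δ, x * y = -(y * x)) :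
    ∃ f : A.Ext →+* Matrix (Fin 2) (Fin 2) B,
      (∀ a, f (algebraMap _ _ a) = upperTri (c a) (D a) (c a)) ∧
      (∀ a, f (A.extDa a) = upperTri (-D a) 0 (D a)) ∧
      ∀ m, f (A.extDlog m) = upperTri (-δ m) 0 (δ m) := by
  have h1 : D 1 = 0 := by simpa using D_alg 1
  let g : A.carrier →+* Matrix (Fin 2) (Fin 2) B :=
    { toFun := fun a => upperTri (c a) (D a) (c a)
      map_one' := by rw [h1, map_one, upperTri_one]
      map_mul' := fun a b => by rw [upperTri_mul, D_mul, map_mul, c_comm b (D a)]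
      map_zero' := by rw [map_zero, map_zero, upperTri_zero]
      map_add' := fun a b => by rw [upperTri_add, map_add, map_add] }
  have hg : ∀ a, g a = upperTri (c a) (D a) (c a) := fun _ => rfl
  -- The matrix of a degree one generator `w` is `(-w, 0; 0, w)`: the involution negates `w`, and `d
  -- w = 0`.
  let D' : A.carrier →+ Matrix (Fin 2) (Fin 2) B :=
    { toFun := fun a => upperTri (-D a) 0 (D a)
      map_zero' := by rw [map_zero, neg_zero, upperTri_zero]
      map_add' := fun a b => by rw [upperTri_add, map_add, neg_add, add_zero] }
  have hD' : ∀ a, D' a = upperTri (-D a) 0 (D a) := fun _ => rfl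
  have hcomm : ∀ a, ∀ w ∈ Set.range D ∪ Set.range δ,
      g a * upperTri (-w) 0 w = upperTri (-w) 0 w * g a := by
    intro a w hw
    rw [hg, upperTri_mul, upperTri_mul, mul_zero, zero_add, zero_mul, add_zero, neg_mul,
      neg_mul, mul_neg, anti _ (Or.inl ⟨a, rfl⟩) w hw, c_comm]
  have hmem : ∀ x ∈ Set.range D' ∪ Set.range (fun m => upperTri (-δ m) 0 (δ m)),
      ∃ w ∈ Set.range D ∪ Set.range δ, x = upperTri (-w) 0 w := by
    rintro _ (⟨a, rfl⟩ | ⟨m, rfl⟩)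
    · exact ⟨_, Or.inl ⟨a, rfl⟩, hD' a⟩
    · exact ⟨_, Or.inr ⟨m, rfl⟩, rfl⟩
  obtain ⟨f, hf, hD, hδ⟩ := A.exists_ext_lift g D'
    (fun m => upperTri (-δ m) 0 (δ m))
    (fun a b => hcomm a _ (Or.inl ⟨b, rfl⟩)) (fun a m => hcomm a _ (Or.inr ⟨m, rfl⟩))
    (fun a b => by
      rw [hD', hg, hg, hD', hD', upperTri_mul, upperTri_mul, upperTri_add, D_mul, mul_zero,
        mul_zero, zero_add, zero_add, anti _ (Or.inl ⟨a, rfl⟩) _ (Or.inl ⟨b, rfl⟩),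
        neg_add_cancel, neg_add, mul_neg, mul_neg])
    (fun w => by rw [hD', D_alg, neg_zero, upperTri_zero])
    (by rw [δ_one, neg_zero, upperTri_zero])
    (fun m n => by rw [upperTri_add, δ_mul, neg_add, add_zero])
    (fun m => by
      rw [hD', hg, upperTri_mul, D_α, mul_assoc, sq _ (Or.inr ⟨m, rfl⟩), mul_zero, add_zero,
        mul_neg])
    (fun n => by rw [δ_ι, neg_zero, upperTri_zero])
    (fun x hx => by
      obtain ⟨w, hw, rfl⟩ := hmem x hx
      rw [upperTri_mul, neg_mul_neg, sq w hw, mul_zero, zero_mul, add_zero, upperTri_zero])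
    (fun x hx y hy => by
      obtain ⟨w, hw, rfl⟩ := hmem x hx
      obtain ⟨v, hv, rfl⟩ := hmem y hy
      rw [upperTri_mul, upperTri_mul, upperTri_add, neg_mul_neg, neg_mul_neg, anti w hw v hv,
        mul_zero, zero_mul, mul_zero, zero_mul, add_zero, neg_add_cancel, add_zero,
        upperTri_zero])
  exact ⟨f, hf, hD, hδ⟩

/-- Existence of the exterior differential: `x ↦ (σ x, d x; 0, x)` is multiplicative, where `σ` is
the grading involution. -/
theorem exists_extD : ∃ d : A.Ext →+ A.Ext,
    (∀ a : A.carrier, d (algebraMap _ _ a) = A.extDa a) ∧ (∀ a, d (A.extDa a) = 0) ∧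
    (∀ m, d (A.extDlog m) = 0) ∧
    ∀ x y, d (x * y) = d x * y + CliffordAlgebra.involute x * d y := by
  let D : A.carrier →+ A.Ext :=
    ⟨⟨A.extDa, by simpa using A.extDa_algebraMap 0⟩, A.extDa_add⟩
  have hmem : ∀ x ∈ Set.range D ∪ Set.range A.extDlog, ∃ w, x = ExteriorAlgebra.ι A.carrier w := by
    rintro _ (⟨a, rfl⟩ | ⟨m, rfl⟩)
    · exact ⟨_, rfl⟩
    · exact ⟨_, rfl⟩
  obtain ⟨f, hf, hD, hδ⟩ := A.exists_ext_lift_upperTri (algebraMap A.carrier A.Ext) D A.extDlog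
    Algebra.commutes A.extDa_mul A.extDa_algebraMap (by rw [extDlog, dlog_one, map_zero])
    (fun m n => by rw [extDlog, dlog_mul, map_add]) A.extDa_α
    (fun n => by rw [extDlog, dlog_ι, map_zero])
    (fun x hx => by
      obtain ⟨w, rfl⟩ := hmem x hx
      exact ExteriorAlgebra.ι_sq_zero w)
    (fun x hx y hy => by
      obtain ⟨w, rfl⟩ := hmem x hx
      obtain ⟨v, rfl⟩ := hmem y hy
      exact eq_neg_of_add_eq_zero_left (ExteriorAlgebra.ι_add_mul_swap w v))
  -- The diagonal `(σ x, x)` is verified on generators; `d` is then the upper right entry, so no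
  -- choice of a presentation of `x` is needed.
  obtain ⟨d, hd, hmul⟩ := exists_twisted_derivation
      (CliffordAlgebra.involute : A.Ext →ₐ[A.carrier] A.Ext).toRingHom f (by
    intro x
    change ∃ b, f x = upperTri (CliffordAlgebra.involute x) b x
    induction x using ext_induction with
    | one => exact ⟨0, by rw [map_one, map_one, upperTri_one]⟩
    | add x y hx hy =>
      obtain ⟨b, hb⟩ := hx
      obtain ⟨b', hb'⟩ := hy
      exact ⟨b + b', by rw [map_add, map_add, hb, hb', upperTri_add]⟩
    | algebraMap_mul a x hx =>
      obtain ⟨b, hb⟩ := hx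
      exact ⟨_, by rw [map_mul, map_mul, hb, hf, upperTri_mul, AlgHom.commutes]⟩
    | da_mul a x hx =>
      obtain ⟨b, hb⟩ := hx
      exact ⟨_, by rw [map_mul, map_mul, hb, hD, upperTri_mul, CliffordAlgebra.involute_ι]; rfl⟩
    | dlog_mul m x hx =>
      obtain ⟨b, hb⟩ := hx
      exact ⟨_, by rw [map_mul, map_mul, hb, hδ, upperTri_mul, CliffordAlgebra.involute_ι]⟩)
  exact ⟨d, fun a => upperTri_inj ((hd _).symm.trans (hf a)),
    fun a => upperTri_inj ((hd _).symm.trans (hD a)),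
    fun m => upperTri_inj ((hd _).symm.trans (hδ m)), hmul⟩

/-- The exterior differential of the log de Rham complex. -/
def extD : A.Ext →+ A.Ext := A.exists_extD.choose

theorem extD_algebraMap (a : A.carrier) : A.extD (algebraMap _ _ a) = A.extDa a :=
  A.exists_extD.choose_spec.1 a

theorem extD_extDa (a : A.carrier) : A.extD (A.extDa a) = 0 := A.exists_extD.choose_spec.2.1 a

theorem extD_extDlog (m : A.M) : A.extD (A.extDlog m) = 0 := A.exists_extD.choose_spec.2.2.1 m

theorem extD_mul (x y : A.Ext) :
    A.extD (x * y) = A.extD x * y + CliffordAlgebra.involute x * A.extD y :=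
  A.exists_extD.choose_spec.2.2.2 x y

theorem extD_algebraMap_mul (a : A.carrier) (x : A.Ext) :
    A.extD (algebraMap _ _ a * x) = A.extDa a * x + algebraMap _ _ a * A.extD x := by
  rw [extD_mul, AlgHom.commutes, extD_algebraMap]

theorem extD_da_mul (a : A.carrier) (x : A.Ext) :
    A.extD (A.extDa a * x) = - (A.extDa a * A.extD x) := by
  rw [extD_mul, extD_extDa, CliffordAlgebra.involute_ι, zero_mul, zero_add, neg_mul]

theorem extD_dlog_mul (m : A.M) (x : A.Ext) :
    A.extD (A.extDlog m * x) = - (A.extDlog m * A.extD x) := by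
  rw [extD_mul, extD_extDlog, CliffordAlgebra.involute_ι, zero_mul, zero_add, neg_mul]

theorem extD_one : A.extD 1 = 0 := by
  rw [← map_one (algebraMap A.carrier A.Ext), extD_algebraMap]
  simpa using A.extDa_algebraMap 1

theorem extD_extD (x : A.Ext) : A.extD (A.extD x) = 0 := by
  induction x using ext_induction with
  | one => rw [extD_one, map_zero]
  | add x y hx hy => rw [map_add, map_add, hx, hy, add_zero]
  | algebraMap_mul a x hx =>
    rw [extD_algebraMap_mul, map_add, extD_da_mul, extD_algebraMap_mul, hx, mul_zero, add_zero,
      neg_add_cancel]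
  | da_mul a x hx => rw [extD_da_mul, map_neg, extD_da_mul, hx, mul_zero, neg_zero, neg_zero]
  | dlog_mul m x hx => rw [extD_dlog_mul, map_neg, extD_dlog_mul, hx, mul_zero, neg_zero, neg_zero]

theorem ι_mem_exteriorPower_one (w : A.Omega) :
    ExteriorAlgebra.ι A.carrier w ∈ ⋀[A.carrier]^1 A.Omega := by
  rw [ExteriorAlgebra.exteriorPower, pow_one]; exact ⟨w, rfl⟩

/-- On a multiple `a · w` the Leibniz rule gives `d a · w + a · d w`, and the generators `d a`,
`dlog m` are closed. -/
theorem extD_ι_mem (w : A.Omega) :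
    A.extD (ExteriorAlgebra.ι A.carrier w) ∈ ⋀[A.carrier]^2 A.Omega := by
  have hw : w ∈ Submodule.span A.carrier (Set.range A.dOmega ∪ Set.range A.dlog) := by
    rw [span_omega_eq_top]; trivial
  induction hw using Submodule.span_induction with
  | mem w hw =>
    rcases hw with ⟨a, rfl⟩ | ⟨m, rfl⟩
    · rw [extD_extDa]; exact zero_mem _
    · rw [extD_extDlog]; exact zero_mem _
  | zero => rw [map_zero, map_zero]; exact zero_mem _
  | add x y _ _ hx hy => rw [map_add, map_add]; exact add_mem hx hy
  | smul a x _ hx =>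
    rw [map_smul, Algebra.smul_def, extD_algebraMap_mul, ← Algebra.smul_def]
    exact add_mem (SetLike.mul_mem_graded (A.ι_mem_exteriorPower_one _)
      (A.ι_mem_exteriorPower_one _)) (Submodule.smul_mem _ _ hx)

theorem extD_mem {n : ℕ} {x : A.Ext} (hx : x ∈ ⋀[A.carrier]^n A.Omega) :
    A.extD x ∈ ⋀[A.carrier]^(n + 1) A.Omega := by
  induction hx using Submodule.pow_induction_on_left' with
  | algebraMap r => rw [extD_algebraMap]; exact A.ι_mem_exteriorPower_one _
  | add x y i hx hy hx' hy' => rw [map_add]; exact add_mem hx' hy'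
  | mem_mul m hm i x hx ih =>
    obtain ⟨w, rfl⟩ := hm
    rw [extD_mul, CliffordAlgebra.involute_ι]
    refine add_mem ?_ ?_
    · have := SetLike.mul_mem_graded (A.extD_ι_mem w) hx
      rwa [add_comm 2 i] at this
    · have := SetLike.mul_mem_graded (neg_mem (A.ι_mem_exteriorPower_one w)) ih
      rwa [add_comm 1] at this

/-! ### Frobenius on the log de Rham complex -/

section Frobenius

variable (p : ℕ)

/-- The divided Frobenius `(φ(a) - a^p) / p` of a lift of Frobenius is well defined. -/
structure IsFrobeniusLift (φ : A.carrier →+* A.carrier) : Prop where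
  torsionFree : ∀ a : A.carrier, (p : A.carrier) * a = 0 → a = 0
  exists_eq : ∀ a, ∃ t, φ a = a ^ p + (p : A.carrier) * t
  exists_eq_algebraMap : ∀ w, ∃ t, φ (algebraMap W A.carrier w) =
    algebraMap W A.carrier w ^ p + (p : A.carrier) * algebraMap W A.carrier t
  φ_α : ∀ m, φ (A.α m) = A.α m ^ p

namespace IsFrobeniusLift

variable {A p} {φ : A.carrier →+* A.carrier} (h : A.IsFrobeniusLift p φ)

/-- The divided Frobenius `(φ(a) - a^p) / p`. -/
def θ (a : A.carrier) : A.carrier := (h.exists_eq a).choose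

theorem φ_eq (a : A.carrier) : φ a = a ^ p + (p : A.carrier) * h.θ a := (h.exists_eq a).choose_spec

theorem cancel (h : A.IsFrobeniusLift p φ) {a b : A.carrier} (hab : (p : A.carrier) * a = p * b) :
    a = b :=
  sub_eq_zero.1 (h.torsionFree _ (by rw [mul_sub, hab, sub_self]))

theorem θ_unique {a t : A.carrier} (ht : φ a = a ^ p + (p : A.carrier) * t) : t = h.θ a := by
  apply h.cancel
  rw [h.φ_eq] at ht
  exact (add_left_cancel ht).symm

theorem θ_mul (a b : A.carrier) :
    h.θ (a * b) = a ^ p * h.θ b + b ^ p * h.θ a + p * (h.θ a * h.θ b) := by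
  symm
  apply h.θ_unique
  rw [map_mul, h.φ_eq a, h.φ_eq b]
  ring

/-- A derivation on a polynomial expression in two elements. -/
theorem deriv_aeval {R M : Type*} [CommRing R] [AddCommGroup M] [Module R M]
    (D : Derivation ℤ R M) (v : Fin 2 → R) (P : MvPolynomial (Fin 2) ℤ) :
    D (MvPolynomial.aeval v P) = ∑ i, MvPolynomial.aeval v (MvPolynomial.pderiv i P) • D (v i) := by
  induction P using MvPolynomial.induction_on with
  | C a => simp
  | add P Q hP hQ => simp only [map_add, hP, hQ, add_smul, Finset.sum_add_distrib]
  | mul_X P j hP =>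
    fin_cases j <;>
    · simp only [Fin.sum_univ_two] at hP ⊢
      simp [hP, MvPolynomial.pderiv_X]
      module

/-- Multiplied by `p` this is additivity of `d φ`, but `ω¹` may have `p`-torsion. The division is
therefore done in `ℤ[X, Y]`: if `(X + Y)^p = X^p + Y^p + p P`, the partial derivatives of `P` are
`(X + Y)^(p-1) - X^(p-1)` and `(X + Y)^(p-1) - Y^(p-1)`. Differentiating `θ a + θ b = θ (a + b) +
P(a, b)` gives the claim. -/
theorem deriv_θ_add [Fact p.Prime] (a b : A.carrier) :
    (a + b) ^ (p - 1) • A.dOmega (a + b) + A.dOmega (h.θ (a + b)) =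
      (a ^ (p - 1) • A.dOmega a + A.dOmega (h.θ a)) +
        (b ^ (p - 1) • A.dOmega b + A.dOmega (h.θ b)) := by
  let X : MvPolynomial (Fin 2) ℤ := MvPolynomial.X 0
  let Y : MvPolynomial (Fin 2) ℤ := MvPolynomial.X 1
  obtain ⟨P, hP⟩ : ∃ P : MvPolynomial (Fin 2) ℤ, (X + Y) ^ p = X ^ p + Y ^ p + p * P :=
    ⟨_, by rw [add_pow_prime_eq Fact.out, mul_assoc, mul_assoc]⟩
  have hθ : h.θ a + h.θ b = h.θ (a + b) + MvPolynomial.aeval ![a, b] P := by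
    have h1 := congrArg (MvPolynomial.aeval ![a, b]) hP
    simp only [map_pow, map_add, X, Y, map_mul, map_natCast, MvPolynomial.aeval_X,
      Matrix.cons_val_zero, Matrix.cons_val_one] at h1
    apply h.cancel
    have h2 := h.φ_eq (a + b)
    rw [map_add, h.φ_eq a, h.φ_eq b] at h2
    linear_combination h2 + h1
  have hp0 : (p : MvPolynomial (Fin 2) ℤ) ≠ 0 := by
    exact_mod_cast (Fact.out : p.Prime).ne_zero
  have hd : ∀ i : Fin 2, MvPolynomial.pderiv i P =
      (X + Y) ^ (p - 1) - MvPolynomial.X i ^ (p - 1) := by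
    intro i
    apply mul_left_cancel₀ hp0
    have h1 := congrArg (MvPolynomial.pderiv i) hP
    fin_cases i <;>
    · simp [-mul_eq_mul_left_iff, Derivation.leibniz_pow, MvPolynomial.pderiv_X, X, Y] at h1 ⊢
      linear_combination -h1
  have hD := deriv_aeval (A.derivOmega.restrictScalars ℤ) ![a, b] P
  simp only [hd, Fin.sum_univ_two] at hD
  simp only [map_sub, map_pow, map_add, X, Y, MvPolynomial.aeval_X, Matrix.cons_val_zero,
      Matrix.cons_val_one] at hD
  change A.dOmega _ = _ • A.dOmega a + _ • A.dOmega b at hD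
  have h3 := congrArg A.dOmega hθ
  rw [dOmega_add, dOmega_add, hD] at h3
  have h4 := eq_sub_of_add_eq h3.symm
  rw [h4, dOmega_add]
  module

theorem dOmega_pow (a : A.carrier) (n : ℕ) :
    A.dOmega (a ^ n) = ((n : A.carrier) * a ^ (n - 1)) • A.dOmega a := by
  rw [← derivOmega_apply, Derivation.leibniz_pow, ← Nat.cast_smul_eq_nsmul A.carrier, smul_smul]
  rfl

theorem dOmega_p_mul (a : A.carrier) : A.dOmega ((p : A.carrier) * a) = (p : A.carrier) • A.dOmega a := by
  rw [← nsmul_eq_mul, ← derivOmega_apply, map_nsmul, Nat.cast_smul_eq_nsmul]; rfl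

/-- Unlike additivity, this requires no division: `θ_mul` expresses `θ (a b)` polynomially, and
expanding with the Leibniz rule suffices. -/
theorem deriv_θ_mul [Fact p.Prime] (a b : A.carrier) :
    (a * b) ^ (p - 1) • A.dOmega (a * b) + A.dOmega (h.θ (a * b)) =
      φ a • (b ^ (p - 1) • A.dOmega b + A.dOmega (h.θ b)) +
        φ b • (a ^ (p - 1) • A.dOmega a + A.dOmega (h.θ a)) := by
  obtain ⟨q, hq⟩ : ∃ q, p = q + 1 := ⟨p - 1, by
    have := (Fact.out : p.Prime).pos; omega⟩
  have hq' : p - 1 = q := by omega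
  rw [h.θ_mul, dOmega_add, dOmega_add, dOmega_p_mul, dOmega_mul _ (a ^ p), dOmega_mul _ (b ^ p),
    dOmega_mul _ a b, dOmega_mul _ (h.θ a), dOmega_pow, dOmega_pow, h.φ_eq a, h.φ_eq b, hq']
  have ha : a ^ p = a ^ q * a := by rw [hq, pow_succ]
  have hb : b ^ p = b ^ q * b := by rw [hq, pow_succ]
  rw [ha, hb, mul_pow]
  module

/-- The Frobenius of the log de Rham complex attached to a lift of Frobenius. -/
theorem exists_extF [Fact p.Prime] : ∃ F : A.Ext →+* A.Ext,
    (∀ a : A.carrier, F (algebraMap _ _ a) = algebraMap _ _ (φ a)) ∧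
    (∀ a, F (A.extDa a) =
      ExteriorAlgebra.ι A.carrier (a ^ (p - 1) • A.dOmega a + A.dOmega (h.θ a))) ∧
    ∀ m, F (A.extDlog m) = A.extDlog m := by
  -- The divided Frobenius of a scalar is again a scalar, so both differentials vanish.
  have hzero : ∀ w : W, algebraMap W A.carrier w ^ (p - 1) • A.dOmega (algebraMap W A.carrier w) +
      A.dOmega (h.θ (algebraMap W A.carrier w)) = 0 := by
    intro w
    obtain ⟨t, ht⟩ := h.exists_eq_algebraMap w
    rw [← h.θ_unique ht, dOmega_algebraMap, dOmega_algebraMap, smul_zero, add_zero]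
  have hp1 : p - 1 + 1 = p := Nat.sub_add_cancel (Fact.out : p.Prime).pos
  have hzero' := hzero 0
  rw [map_zero] at hzero'
  refine A.exists_ext_lift ((algebraMap A.carrier A.Ext).comp φ)
    { toFun := fun a =>
        ExteriorAlgebra.ι A.carrier (a ^ (p - 1) • A.dOmega a + A.dOmega (h.θ a))
      map_zero' := by rw [hzero', map_zero]
      map_add' := fun a b => by rw [h.deriv_θ_add, map_add] }
    A.extDlog (fun a b => Algebra.commutes (φ a) _) (fun a m => Algebra.commutes (φ a) _)
    (fun a b => ?_) (fun w => ?_) ?_ (fun m n => ?_) (fun m => ?_) (fun n => ?_) ?_ ?_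
  · change ExteriorAlgebra.ι A.carrier _ = algebraMap _ _ (φ a) * ExteriorAlgebra.ι A.carrier _ +
      algebraMap _ _ (φ b) * ExteriorAlgebra.ι A.carrier _
    rw [h.deriv_θ_mul, map_add, map_smul, map_smul, Algebra.smul_def, Algebra.smul_def]
  · change ExteriorAlgebra.ι A.carrier _ = 0
    rw [hzero, map_zero]
  · rw [extDlog, dlog_one, map_zero]
  · rw [extDlog, dlog_mul, map_add]
  · change ExteriorAlgebra.ι A.carrier _ = algebraMap _ _ (φ _) * _
    -- `φ (α m) = α(m)^p` means `θ (α m) = 0`, which leaves `α(m)^(p-1) dα(m) = α(m)^p dlog m`.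
    rw [h.φ_α, ← h.θ_unique (a := A.α m) (t := 0) (by rw [h.φ_α, mul_zero, add_zero]),
      dOmega_α, smul_smul, ← pow_succ, hp1, map_add, map_smul, Algebra.smul_def]
    rw [← map_zero (algebraMap W A.carrier), dOmega_algebraMap, map_zero, add_zero]
  · rw [extDlog, dlog_ι, map_zero]
  · rintro _ (⟨a, rfl⟩ | ⟨m, rfl⟩) <;> exact ExteriorAlgebra.ι_sq_zero _
  · rintro _ (⟨a, rfl⟩ | ⟨m, rfl⟩) _ (⟨b, rfl⟩ | ⟨n, rfl⟩) <;>
      exact ExteriorAlgebra.ι_add_mul_swap _ _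

variable [Fact p.Prime]

/-- The Frobenius of the log de Rham complex attached to a lift of Frobenius. -/
def extF : A.Ext →+* A.Ext := h.exists_extF.choose

theorem extF_algebraMap (a : A.carrier) : h.extF (algebraMap _ _ a) = algebraMap _ _ (φ a) :=
  h.exists_extF.choose_spec.1 a

theorem extF_extDa (a : A.carrier) : h.extF (A.extDa a) =
    ExteriorAlgebra.ι A.carrier (a ^ (p - 1) • A.dOmega a + A.dOmega (h.θ a)) :=
  h.exists_extF.choose_spec.2.1 a

theorem extF_extDlog (m : A.M) : h.extF (A.extDlog m) = A.extDlog m :=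
  h.exists_extF.choose_spec.2.2 m

theorem p_mul_extF_extDa (a : A.carrier) :
    (p : A.Ext) * h.extF (A.extDa a) = A.extDa (φ a) := by
  rw [extF_extDa, h.φ_eq, extDa, dOmega_add, dOmega_pow, dOmega_p_mul, ← smul_smul, ← smul_add,
    map_smul, Algebra.smul_def, map_natCast]

theorem extF_mem {n : ℕ} {x : A.Ext} (hx : x ∈ ⋀[A.carrier]^n A.Omega) :
    h.extF x ∈ ⋀[A.carrier]^n A.Omega := by
  induction hx using Submodule.pow_induction_on_left' with
  | algebraMap r =>
    rw [extF_algebraMap]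
    exact SetLike.algebraMap_mem_graded (fun i : ℕ => ⋀[A.carrier]^i A.Omega) _
  | add x y i hx hy hx' hy' => rw [map_add]; exact add_mem hx' hy'
  | mem_mul m hm i x hx ih =>
    obtain ⟨w, rfl⟩ := hm
    have hw : w ∈ Submodule.span A.carrier (Set.range A.dOmega ∪ Set.range A.dlog) := by
      rw [span_omega_eq_top]; trivial
    have hFw : h.extF (ExteriorAlgebra.ι A.carrier w) ∈ ⋀[A.carrier]^1 A.Omega := by
      induction hw using Submodule.span_induction with
      | mem w hw =>
        rcases hw with ⟨a, rfl⟩ | ⟨m, rfl⟩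
        · rw [extF_extDa]; exact A.ι_mem_exteriorPower_one _
        · rw [extF_extDlog]; exact A.ι_mem_exteriorPower_one _
      | zero => rw [map_zero, map_zero]; exact zero_mem _
      | add x y _ _ hx hy => rw [map_add, map_add]; exact add_mem hx hy
      | smul a x _ hx =>
        rw [map_smul, Algebra.smul_def, map_mul, extF_algebraMap, ← Algebra.smul_def]
        exact Submodule.smul_mem _ _ hx
    rw [map_mul]
    have := SetLike.mul_mem_graded hFw ih
    rwa [add_comm 1 i] at this

/-- `d a` occurs twice in `d (a^(p-1)) · d a`, and the other summand of `F (d a)` is exact. -/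
theorem extD_ι_extF (a : A.carrier) : A.extD (h.extF (A.extDa a)) = 0 := by
  rw [extF_extDa, map_add, map_add, extD_extDa, add_zero, map_smul, Algebra.smul_def,
    extD_algebraMap_mul, extD_extDa, mul_zero, add_zero, extDa, dOmega_pow, map_smul,
    smul_mul_assoc, ExteriorAlgebra.ι_sq_zero, smul_zero]

theorem extD_extF (x : A.Ext) : A.extD (h.extF x) = (p : A.Ext) * h.extF (A.extD x) := by
  have hpc : ∀ y z : A.Ext, (p : A.Ext) * (y * z) = y * (p * z) := fun y z => by
    rw [← mul_assoc, (Nat.cast_commute p y).eq, mul_assoc]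
  induction x using ext_induction with
  | one => rw [map_one, extD_one, map_zero, mul_zero]
  | add x y hx hy => rw [map_add, map_add, map_add, map_add, hx, hy, mul_add]
  | algebraMap_mul a x hx =>
    rw [map_mul, extF_algebraMap, extD_algebraMap_mul, extD_algebraMap_mul, hx, map_add, map_mul,
      map_mul, extF_algebraMap, mul_add, ← mul_assoc (p : A.Ext) _ (h.extF x),
      p_mul_extF_extDa, hpc]
  | da_mul a x hx =>
    rw [map_mul, extD_mul, extD_ι_extF, zero_mul, zero_add, hx, extD_da_mul, map_neg, map_mul,
      extF_extDa, CliffordAlgebra.involute_ι, mul_neg, hpc, neg_mul]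
  | dlog_mul m x hx =>
    rw [map_mul, extF_extDlog, extD_dlog_mul, hx, extD_dlog_mul, map_neg, map_mul,
      extF_extDlog, mul_neg, hpc]

/-- The log de Rham complex of a log algebra with a lift of Frobenius. -/
def logDeRham : LogDieudonneAlg p β where
  carrier := A.Ext
  gr i := (⋀[A.carrier]^i A.Omega).restrictScalars W
  graded := { (inferInstance : GradedAlgebra (fun i : ℕ => (⋀[A.carrier]^i A.Omega))) with }
  graded_comm _ _ _ ha _ hb := ExteriorAlgebra.mul_comm_of_mem ha hb
  sq_odd _ hi _ ha := ExteriorAlgebra.sq_eq_zero_of_mem hi ha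
  d :=
    { toFun := A.extD
      map_add' := map_add _
      map_smul' := fun w x => by
        rw [← algebraMap_smul A.carrier w x, Algebra.smul_def, extD_algebraMap_mul,
          extDa_algebraMap, zero_mul, zero_add, ← Algebra.smul_def, algebraMap_smul]
        rfl }
  d_mem _ _ ha := A.extD_mem ha
  d_mul i a ha b := by
    change A.extD _ = A.extD _ * _ + (-1) ^ i * (a * A.extD b)
    rw [extD_mul, ExteriorAlgebra.involute_of_mem ha, mul_assoc]
  d_d := A.extD_extD
  F := h.extF
  F_mem _ _ ha := h.extF_mem ha
  F_frob a ha := by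
    have ha' : a ∈ (1 : Submodule A.carrier A.Ext) := by simpa using ha
    obtain ⟨a, rfl⟩ := Submodule.mem_one.1 ha'
    refine ⟨algebraMap _ _ (h.θ a),
      SetLike.algebraMap_mem_graded (fun i : ℕ => ⋀[A.carrier]^i A.Omega) _, ?_⟩
    rw [extF_algebraMap, h.φ_eq, map_add, map_pow, map_mul, map_natCast]
  d_F := h.extD_extF
  L := A.M
  α := (algebraMap A.carrier A.Ext).toMonoidHom.comp A.α
  α_mem m := SetLike.algebraMap_mem_graded (fun i : ℕ => ⋀[A.carrier]^i A.Omega) _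
  ι := A.ι
  α_ι n := by
    change algebraMap A.carrier A.Ext (A.α (A.ι n)) = _
    rw [A.α_ι, ← IsScalarTower.algebraMap_apply]
  δ := A.extDlog
  δ_mem m := A.ι_mem_exteriorPower_one _
  δ_one := by rw [extDlog, dlog_one, map_zero]
  δ_mul m n := by rw [extDlog, dlog_mul, map_add]
  d_α m := by
    change A.extD (algebraMap A.carrier A.Ext (A.α m)) = _
    rw [extD_algebraMap, extDa_α]
    rfl
  δ_ι n := by rw [extDlog, dlog_ι, map_zero]
  d_δ m := A.extD_extDlog m
  FL := powMonoidHom p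
  δ_FL m := by
    have : ∀ n : ℕ, A.dlog (m ^ n) = n • A.dlog m := by
      intro n
      induction n with
      | zero => rw [pow_zero, dlog_one, zero_smul]
      | succ n ih => rw [pow_succ, dlog_mul, ih, succ_nsmul]
    rw [extF_extDlog, powMonoidHom_apply, extDlog, this, map_nsmul, nsmul_eq_mul]
  F_α m := by
    change h.extF (algebraMap A.carrier A.Ext (A.α m)) =
      algebraMap A.carrier A.Ext (A.α (m ^ p))
    rw [extF_algebraMap, h.φ_α, map_pow A.α]

end IsFrobeniusLift

end Frobenius

end LogAlg

/-! ### Stable ideals and the quotient by `p`-power torsion -/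

namespace LogDieudonneAlg

variable {p : ℕ} {W N : Type u} [CommRing W] [CommMonoid N] {β : N →* W}

section Quotient

variable (A : LogDieudonneAlg p β)

/-- A two-sided ideal that is stable under the structure maps of a log Dieudonné algebra. -/
structure IsStableIdeal (J : Ideal A.carrier) : Prop where
  d_mem : ∀ x ∈ J, A.d x ∈ J
  F_mem : ∀ x ∈ J, A.F x ∈ J
  pr_mem : ∀ i, ∀ x ∈ J, A.pr i x ∈ J

variable {A}

/-- The quotient of a log Dieudonné algebra by a stable ideal. -/
def quotient (J : Ideal A.carrier) [J.IsTwoSided] (hJ : A.IsStableIdeal J) :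
    LogDieudonneAlg p β where
  carrier := A.carrier ⧸ J
  gr i := (A.gr i).map (Ideal.Quotient.mkₐ W J).toLinearMap
  graded := Nonempty.some <| by
    let P : ℕ → (A.carrier ⧸ J) →+ (A.carrier ⧸ J) := fun i =>
      QuotientAddGroup.map _ _ (A.pr i) fun x hx => hJ.pr_mem i x hx
    have hP : ∀ i x, P i (Ideal.Quotient.mk J x) = Ideal.Quotient.mk J (A.pr i x) := fun _ _ => rfl
    refine nonempty_gradedAlgebra_of_proj _ ⟨1, SetLike.GradedOne.one_mem, rfl⟩ ?_ P ?_ ?_ ?_ ?_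
    · rintro i j _ ⟨x, hx, rfl⟩ _ ⟨y, hy, rfl⟩
      exact ⟨x * y, SetLike.mul_mem_graded hx hy, rfl⟩
    · intro i x
      obtain ⟨x, rfl⟩ := Ideal.Quotient.mk_surjective x
      exact ⟨A.pr i x, A.pr_mem i x, rfl⟩
    · rintro i _ ⟨x, hx, rfl⟩
      exact (hP i x).trans (by rw [pr_same hx]; rfl)
    · rintro i j hij _ ⟨x, hx, rfl⟩
      exact (hP i x).trans (by rw [pr_ne hx hij, map_zero])
    · intro x
      obtain ⟨x, rfl⟩ := Ideal.Quotient.mk_surjective x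
      obtain ⟨n, hn⟩ := exists_sum_pr x
      exact ⟨n, by simp only [hP]; rw [← map_sum, ← hn]⟩
  graded_comm := by
    rintro i j _ ⟨x, hx, rfl⟩ _ ⟨y, hy, rfl⟩
    exact (congrArg (Ideal.Quotient.mk J) (A.graded_comm i j x hx y hy)).trans (by simp)
  sq_odd := by
    rintro i hi _ ⟨x, hx, rfl⟩
    exact (congrArg (Ideal.Quotient.mk J) (A.sq_odd i hi x hx)).trans (map_zero _)
  d :=
    { QuotientAddGroup.map J.toAddSubgroup J.toAddSubgroup A.d.toAddMonoidHom
        fun x hx => hJ.d_mem x hx with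
      map_smul' := fun w x => by
        obtain ⟨x, rfl⟩ := Ideal.Quotient.mk_surjective x
        exact congrArg (Ideal.Quotient.mk J) (A.d.map_smul w x) }
  d_mem := by
    rintro i _ ⟨x, hx, rfl⟩
    exact ⟨A.d x, A.d_mem i x hx, rfl⟩
  d_mul := by
    rintro i _ ⟨x, hx, rfl⟩ y
    obtain ⟨y, rfl⟩ := Ideal.Quotient.mk_surjective y
    refine (congrArg (Ideal.Quotient.mk J) (A.d_mul i x hx y)).trans ?_
    rw [map_add, map_mul, map_mul, map_mul, map_pow, map_neg, map_one]
    rfl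
  d_d x := by
    obtain ⟨x, rfl⟩ := Ideal.Quotient.mk_surjective x
    exact (congrArg (Ideal.Quotient.mk J) (A.d_d x)).trans (map_zero _)
  F := Ideal.Quotient.lift J ((Ideal.Quotient.mk J).comp A.F) fun x hx =>
    Ideal.Quotient.eq_zero_iff_mem.2 (hJ.F_mem x hx)
  F_mem := by
    rintro i _ ⟨x, hx, rfl⟩
    exact ⟨A.F x, A.F_mem i x hx, rfl⟩
  F_frob := by
    rintro _ ⟨x, hx, rfl⟩
    obtain ⟨b, hb, h⟩ := A.F_frob x hx
    refine ⟨Ideal.Quotient.mk J b, ⟨b, hb, rfl⟩, ?_⟩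
    refine (congrArg (Ideal.Quotient.mk J) h).trans ?_
    rw [map_add, map_mul, map_natCast, map_pow]
    rfl
  d_F x := by
    obtain ⟨x, rfl⟩ := Ideal.Quotient.mk_surjective x
    refine (congrArg (Ideal.Quotient.mk J) (A.d_F x)).trans ?_
    rw [map_mul, map_natCast]
    rfl
  L := A.L
  α := (Ideal.Quotient.mk J).toMonoidHom.comp A.α
  α_mem m := ⟨A.α m, A.α_mem m, rfl⟩
  ι := A.ι
  α_ι n := congrArg (Ideal.Quotient.mk J) (A.α_ι n)
  δ m := Ideal.Quotient.mk J (A.δ m)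
  δ_mem m := ⟨A.δ m, A.δ_mem m, rfl⟩
  δ_one := by rw [A.δ_one, map_zero]
  δ_mul m n := by rw [A.δ_mul, map_add]
  d_α m := (congrArg (Ideal.Quotient.mk J) (A.d_α m)).trans (map_mul _ _ _)
  δ_ι n := by rw [A.δ_ι, map_zero]
  d_δ m := (congrArg (Ideal.Quotient.mk J) (A.d_δ m)).trans (map_zero _)
  FL := A.FL
  δ_FL m := by
    rw [A.δ_FL, map_mul, map_natCast]
    rfl
  F_α m := congrArg (Ideal.Quotient.mk J) (A.F_α m)

/-- The projection to the quotient by a stable ideal. -/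
def quotientHom (J : Ideal A.carrier) [J.IsTwoSided] (hJ : A.IsStableIdeal J) :
    A ⟶ quotient J hJ :=
  Hom.mk (Ideal.Quotient.mkₐ W J) (fun _ a ha => ⟨a, ha, rfl⟩) (fun _ => rfl) (fun _ => rfl)
    (MonoidHom.id A.L) (fun _ => rfl) (fun _ => rfl) (fun _ => rfl) (fun _ => rfl)

end Quotient

section Torsion

variable (A : LogDieudonneAlg p β)

/-- The ideal of `p`-power torsion elements. -/
def torsionIdeal : Ideal A.carrier where
  carrier := {x | ∃ n : ℕ, (p : A.carrier) ^ n * x = 0}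
  zero_mem' := ⟨0, by simp⟩
  add_mem' := by
    rintro x y ⟨n, hn⟩ ⟨m, hm⟩
    refine ⟨m + n, ?_⟩
    rw [mul_add]
    conv_lhs => rw [pow_add, mul_assoc, hn, mul_zero, ← pow_add, add_comm m n, pow_add, mul_assoc,
      hm, mul_zero, add_zero]
  smul_mem' := by
    rintro c x ⟨n, hn⟩
    refine ⟨n, ?_⟩
    rw [smul_eq_mul, ← mul_assoc, ((Nat.cast_commute p c).pow_left n).eq, mul_assoc, hn, mul_zero]

instance : A.torsionIdeal.IsTwoSided :=
  ⟨fun b => by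
    rintro ⟨n, hn⟩
    exact ⟨n, by rw [← mul_assoc, hn, zero_mul]⟩⟩

theorem isStableIdeal_torsionIdeal : A.IsStableIdeal A.torsionIdeal where
  d_mem := by
    rintro x ⟨n, hn⟩
    exact ⟨n, by rw [← d_p_pow_mul, hn, map_zero]⟩
  F_mem := by
    rintro x ⟨n, hn⟩
    exact ⟨n, by simpa using congrArg A.F hn⟩
  pr_mem := by
    rintro i x ⟨n, hn⟩
    exact ⟨n, by rw [← pr_p_pow_mul, hn, map_zero]⟩

/-- The quotient of a log Dieudonné algebra by its `p`-power torsion. -/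
def torsionFreeQuotient : LogDieudonneAlg p β :=
  quotient A.torsionIdeal A.isStableIdeal_torsionIdeal

/-- The projection to the quotient by the `p`-power torsion. -/
def toTorsionFreeQuotient : A ⟶ A.torsionFreeQuotient :=
  quotientHom A.torsionIdeal A.isStableIdeal_torsionIdeal

theorem isTorsionFreeQuotient_toTorsionFreeQuotient :
    IsTorsionFreeQuotient A.toTorsionFreeQuotient where
  surjective := Ideal.Quotient.mk_surjective
  ker _ := Ideal.Quotient.eq_zero_iff_mem
  bijective_ψ := Function.bijective_id

end Torsion

namespace IsTorsionFreeQuotient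

variable {A T : LogDieudonneAlg p β} {q : A ⟶ T} (h : IsTorsionFreeQuotient q)

theorem torsionFree (h : IsTorsionFreeQuotient q) (x : T.carrier) (hx : (p : T.carrier) * x = 0) :
    x = 0 := by
  obtain ⟨x, rfl⟩ := h.surjective x
  have : Hom.f q ((p : A.carrier) * x) = 0 := by rwa [map_mul, map_natCast]
  obtain ⟨n, hn⟩ := (h.ker _).1 this
  exact (h.ker _).2 ⟨n + 1, by rw [pow_succ, mul_assoc, hn]⟩

/-- Morphisms to a torsion free object factor through the torsion free quotient. -/
theorem exists_lift (h : IsTorsionFreeQuotient q) {B : LogDieudonneAlg p β}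
    (hB : B.IsSaturated) (g : A ⟶ B) : ∃ g' : T ⟶ B, q ≫ g' = g := by
  -- A saturated target has no `p`-torsion, so the map is constant on the fibres of `q`.
  have hker : ∀ x y, Hom.f q x = Hom.f q y → Hom.f g x = Hom.f g y := by
    intro x y hxy
    obtain ⟨n, hn⟩ := (h.ker (x - y)).1 (by rw [map_sub, hxy, sub_self])
    rw [← sub_eq_zero, ← map_sub]
    apply hB.cancel n
    simpa using congrArg (Hom.f g) hn
  choose s hs using h.surjective
  have hs' : ∀ x, Hom.f g (s (Hom.f q x)) = Hom.f g x := fun x => hker _ _ (hs _)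
  let e : A.L ≃* T.L := MulEquiv.ofBijective (Hom.ψ q) h.bijective_ψ
  have he : ∀ m, e m = Hom.ψ q m := fun _ => rfl
  let f : T.carrier →ₐ[W] B.carrier :=
    { toFun := fun x => Hom.f g (s x)
      map_one' := by rw [← map_one (Hom.f q), hs', map_one]
      map_mul' := fun x y => by
        obtain ⟨x, rfl⟩ := h.surjective x
        obtain ⟨y, rfl⟩ := h.surjective y
        rw [← map_mul, hs', hs', hs', map_mul]
      map_zero' := by rw [← map_zero (Hom.f q), hs', map_zero]
      map_add' := fun x y => by
        obtain ⟨x, rfl⟩ := h.surjective x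
        obtain ⟨y, rfl⟩ := h.surjective y
        rw [← map_add, hs', hs', hs', map_add]
      commutes' := fun w => by rw [← (Hom.f q).commutes w, hs', (Hom.f g).commutes] }
  have hf : ∀ x, f (Hom.f q x) = Hom.f g x := hs'
  let ψ : T.L →* B.L := (Hom.ψ g).comp e.symm.toMonoidHom
  have hψ : ∀ m, ψ (Hom.ψ q m) = Hom.ψ g m := fun m => by
    change Hom.ψ g (e.symm (e m)) = _
    rw [e.symm_apply_apply]
  refine ⟨Hom.mk f ?_ ?_ ?_ ψ ?_ ?_ ?_ ?_, Hom.ext (AlgHom.ext hf) (MonoidHom.ext hψ)⟩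
  · intro i x hx
    obtain ⟨x, rfl⟩ := h.surjective x
    rw [← pr_same hx, ← Hom.f_pr q, hf]
    exact Hom.f_mem g _ _ (A.pr_mem i x)
  · intro x
    obtain ⟨x, rfl⟩ := h.surjective x
    rw [← Hom.f_d q, hf, hf, Hom.f_d g]
  · intro x
    obtain ⟨x, rfl⟩ := h.surjective x
    rw [← Hom.f_F q, hf, hf, Hom.f_F g]
  · intro n
    rw [← Hom.ψ_ι q, hψ, Hom.ψ_ι g]
  · intro m
    obtain ⟨m, rfl⟩ := h.bijective_ψ.2 m
    rw [← Hom.f_α q, hf, hψ, Hom.f_α g]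
  · intro m
    obtain ⟨m, rfl⟩ := h.bijective_ψ.2 m
    rw [← Hom.ψ_FL q, hψ, hψ, Hom.ψ_FL g]
  · intro m
    obtain ⟨m, rfl⟩ := h.bijective_ψ.2 m
    rw [← Hom.f_δ q, hf, hψ, Hom.f_δ g]

theorem hom_ext (h : IsTorsionFreeQuotient q) {B : LogDieudonneAlg p β} {g g' : T ⟶ B}
    (hg : q ≫ g = q ≫ g') : g = g' := by
  refine Hom.ext (AlgHom.ext fun x => ?_) (MonoidHom.ext fun m => ?_)
  · obtain ⟨x, rfl⟩ := h.surjective x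
    exact DFunLike.congr_fun (congrArg Hom.f hg) x
  · obtain ⟨m, rfl⟩ := h.bijective_ψ.2 m
    exact DFunLike.congr_fun (congrArg Hom.ψ hg) m

end IsTorsionFreeQuotient

end LogDieudonneAlg

/-! ### The saturation as a ring of germs of sequences -/

namespace LogDieudonneAlg

open Filter

variable {p : ℕ} {W N : Type u} [CommRing W] [CommMonoid N] {β : N →* W}

section Involution

variable (A : LogDieudonneAlg p β)

/-- The grading involution `x ↦ (-1)^i x` on degree `i`. -/
def invol : A.carrier →+ A.carrier :=
  (DirectSum.toAddMonoid fun i => (AddMonoidHom.mulLeft ((-1 : A.carrier) ^ i)).comp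
    (A.gr i).subtype.toAddMonoidHom).comp (DirectSum.decomposeAddEquiv A.gr).toAddMonoidHom

variable {A}

theorem invol_of_mem {i : ℕ} {x : A.carrier} (hx : x ∈ A.gr i) : A.invol x = (-1) ^ i * x := by
  change DirectSum.toAddMonoid _ (DirectSum.decompose A.gr x) = _
  rw [DirectSum.decompose_of_mem _ hx, DirectSum.toAddMonoid_of]
  rfl

/-- The involution absorbs the sign, so Leibniz applies to the inhomogeneous terms of a sequence. -/
theorem d_mul_invol (x y : A.carrier) : A.d (x * y) = A.d x * y + A.invol x * A.d y := by
  induction x using homogeneous_induction with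
  | hom i x hx => rw [A.d_mul i x hx, invol_of_mem hx, mul_assoc]
  | add x x' hx hx' =>
    rw [add_mul, map_add, hx, hx', map_add, map_add, add_mul, add_mul]
    abel

theorem invol_F (x : A.carrier) : A.invol (A.F x) = A.F (A.invol x) := by
  induction x using homogeneous_induction with
  | hom i x hx => rw [invol_of_mem hx, invol_of_mem (A.F_mem i x hx)]; simp
  | add x x' hx hx' => rw [map_add, map_add, hx, hx', map_add, map_add]

theorem commute_of_mem_zero {a : A.carrier} (ha : a ∈ A.gr 0) (x : A.carrier) :
    a * x = x * a := by
  induction x using homogeneous_induction with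
  | hom i x hx => exact A.zero_comm ha hx
  | add x x' hx hx' => rw [mul_add, hx, hx', add_mul]

end Involution

variable (T : LogDieudonneAlg p β)

/-- Sequences `x`, `y` with `x n = F^n s` and `y n = F^n (d s)` for large `n`, where `s` is a
formal element on which `F` has been inverted and which has an integral differential. -/
structure IsSatPair (x y : ℕ → T.carrier) : Prop where
  left : ∀ᶠ n in atTop, x (n + 1) = T.F (x n)
  right : ∀ᶠ n in atTop, y (n + 1) = T.F (y n)
  d_eq : ∀ᶠ n in atTop, T.d (x n) = (p : T.carrier) ^ n * y n

variable {T}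

theorem cancel_p_pow (hT : ∀ x : T.carrier, (p : T.carrier) * x = 0 → x = 0) (n : ℕ)
    {x y : T.carrier} (h : (p : T.carrier) ^ n * x = (p : T.carrier) ^ n * y) : x = y := by
  induction n with
  | zero => simpa using h
  | succ n ih =>
    apply ih
    rw [pow_succ', mul_assoc, mul_assoc, ← sub_eq_zero, ← mul_sub] at h
    exact sub_eq_zero.1 (hT _ h)

theorem p_pow_comm (n : ℕ) (x y : T.carrier) :
    x * ((p : T.carrier) ^ n * y) = (p : T.carrier) ^ n * (x * y) := by
  rw [← mul_assoc, ((Nat.cast_commute p x).pow_left n).symm.eq, mul_assoc]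

namespace IsSatPair

variable {x y x' y' : ℕ → T.carrier}

theorem add (h : T.IsSatPair x y) (h' : T.IsSatPair x' y') : T.IsSatPair (x + x') (y + y') where
  left := by
    filter_upwards [h.left, h'.left] with n h1 h2
    simp [h1, h2]
  right := by
    filter_upwards [h.right, h'.right] with n h1 h2
    simp [h1, h2]
  d_eq := by
    filter_upwards [h.d_eq, h'.d_eq] with n h1 h2
    simp [h1, h2, mul_add]

theorem neg (h : T.IsSatPair x y) : T.IsSatPair (-x) (-y) where
  left := by
    filter_upwards [h.left] with n h1
    simp [h1]
  right := by
    filter_upwards [h.right] with n h1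
    simp [h1]
  d_eq := by
    filter_upwards [h.d_eq] with n h1
    simp [h1]

theorem mul (h : T.IsSatPair x y) (h' : T.IsSatPair x' y') :
    T.IsSatPair (x * x') (fun n => y n * x' n + T.invol (x n) * y' n) where
  left := by
    filter_upwards [h.left, h'.left] with n h1 h2
    simp [h1, h2]
  right := by
    filter_upwards [h.left, h'.left, h.right, h'.right] with n h1 h2 h3 h4
    simp [h1, h2, h3, h4, invol_F]
  d_eq := by
    filter_upwards [h.d_eq, h'.d_eq] with n h1 h2
    rw [Pi.mul_apply, d_mul_invol, h1, h2, p_pow_comm, mul_add, mul_assoc]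

theorem map_F (h : T.IsSatPair x y) :
    T.IsSatPair (fun n => T.F (x n)) (fun n => p * T.F (y n)) where
  left := by
    filter_upwards [h.left] with n h1
    rw [h1]
  right := by
    filter_upwards [h.right] with n h1
    simp [h1]
  d_eq := by
    filter_upwards [h.d_eq] with n h1
    rw [T.d_F, h1, map_mul, map_pow, map_natCast, p_pow_comm]

theorem map_pr (i : ℕ) (h : T.IsSatPair x y) :
    T.IsSatPair (fun n => T.pr i (x n)) (fun n => T.pr (i + 1) (y n)) where
  left := by
    filter_upwards [h.left] with n h1
    rw [h1, pr_F]
  right := by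
    filter_upwards [h.right] with n h1
    rw [h1, pr_F]
  d_eq := by
    filter_upwards [h.d_eq] with n h1
    rw [← pr_d, h1, pr_p_pow_mul]

/-- The formal element is `F^(-n) t`. Subtraction is truncated, which only affects the irrelevant
indices `m < n`. -/
theorem of_d_eq {n : ℕ} {t z : T.carrier} (h : T.d t = (p : T.carrier) ^ n * z) :
    T.IsSatPair (fun m => (T.F ^ (m - n)) t) (fun m => (T.F ^ (m - n)) z) where
  left := by
    filter_upwards [eventually_ge_atTop n] with m hm
    rw [Nat.sub_add_comm hm, Fpow_succ]
  right := by
    filter_upwards [eventually_ge_atTop n] with m hm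
    rw [Nat.sub_add_comm hm, Fpow_succ]
  d_eq := by
    filter_upwards [eventually_ge_atTop n] with m hm
    rw [d_Fpow, h, map_mul, map_pow, map_natCast, ← mul_assoc, ← pow_add, Nat.sub_add_cancel hm]

theorem of_Fpow (t : T.carrier) :
    T.IsSatPair (fun m => (T.F ^ m) t) (fun m => (T.F ^ m) (T.d t)) :=
  of_d_eq (n := 0) (by simp)

/-- `d² = 0` makes the differential of a formal element a formal element with differential zero;
this defines `d` on the saturation. -/
theorem closed (hT : ∀ x : T.carrier, (p : T.carrier) * x = 0 → x = 0) (h : T.IsSatPair x y) :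
    T.IsSatPair y 0 where
  left := h.right
  right := by simp
  d_eq := by
    filter_upwards [h.d_eq] with n h1
    apply cancel_p_pow hT n
    rw [← d_p_pow_mul, ← h1, T.d_d]
    simp

/-- `p^n y n = d (x n)` determines `y n`, so `d` depends on the germ of `x` alone. -/
theorem right_eventuallyEq (hT : ∀ x : T.carrier, (p : T.carrier) * x = 0 → x = 0)
    (h : T.IsSatPair x y) (h' : T.IsSatPair x' y') (hx : x =ᶠ[atTop] x') : y =ᶠ[atTop] y' := by
  filter_upwards [h.d_eq, h'.d_eq, hx] with n h1 h2 h3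
  apply cancel_p_pow hT n
  rw [← h1, ← h2, h3]

theorem eventually_Fpow (h : T.IsSatPair x y) :
    ∃ n₀, ∀ n ≥ n₀, ∀ m, x (n + m) = (T.F ^ m) (x n) := by
  obtain ⟨n₀, hn₀⟩ := eventually_atTop.1 h.left
  refine ⟨n₀, fun n hn m => ?_⟩
  induction m with
  | zero => rfl
  | succ m ih => rw [← add_assoc, hn₀ _ (by omega), ih, Fpow_succ]

end IsSatPair

variable (T) in
/-- The underlying ring of the saturation of a `p`-torsion free log Dieudonné algebra. -/
def satSubring : Subring (Germ (atTop : Filter ℕ) T.carrier) where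
  carrier := {g | ∃ x y, T.IsSatPair x y ∧ (x : Germ (atTop : Filter ℕ) T.carrier) = g}
  mul_mem' := by
    rintro _ _ ⟨x, y, h, rfl⟩ ⟨x', y', h', rfl⟩
    exact ⟨_, _, h.mul h', rfl⟩
  one_mem' := ⟨_, _, IsSatPair.of_Fpow 1, Germ.coe_eq.2 (Eventually.of_forall fun m => map_one (T.F ^ m))⟩
  add_mem' := by
    rintro _ _ ⟨x, y, h, rfl⟩ ⟨x', y', h', rfl⟩
    exact ⟨_, _, h.add h', rfl⟩
  zero_mem' := ⟨_, _, IsSatPair.of_Fpow 0, Germ.coe_eq.2 (Eventually.of_forall fun m => map_zero (T.F ^ m))⟩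
  neg_mem' := by
    rintro _ ⟨x, y, h, rfl⟩
    exact ⟨_, _, h.neg, rfl⟩

/-- The element of the saturation given by a pair of sequences. -/
def IsSatPair.elt {x y : ℕ → T.carrier} (h : T.IsSatPair x y) : T.satSubring := ⟨x, x, y, h, rfl⟩

theorem satSubring_ind {P : T.satSubring → Prop} (s : T.satSubring)
    (h : ∀ x y, ∀ hxy : T.IsSatPair x y, P hxy.elt) : P s := by
  obtain ⟨_, x, y, hxy, rfl⟩ := s
  exact h x y hxy

theorem IsSatPair.elt_eq_elt {x y x' y' : ℕ → T.carrier} {h : T.IsSatPair x y}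
    {h' : T.IsSatPair x' y'} : h.elt = h'.elt ↔ x =ᶠ[atTop] x' := by
  exact Subtype.ext_iff.trans Germ.coe_eq

/-- The map from a log Dieudonné algebra to its saturation. -/
def toSat : T.carrier →+* T.satSubring where
  toFun t := (IsSatPair.of_Fpow t).elt
  map_one' := Subtype.ext (Germ.coe_eq.2 (Eventually.of_forall fun m => map_one (T.F ^ m)))
  map_mul' a b := Subtype.ext (Germ.coe_eq.2 (Eventually.of_forall fun m => map_mul (T.F ^ m) a b))
  map_zero' := Subtype.ext (Germ.coe_eq.2 (Eventually.of_forall fun m => map_zero (T.F ^ m)))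
  map_add' a b := Subtype.ext (Germ.coe_eq.2 (Eventually.of_forall fun m => map_add (T.F ^ m) a b))

theorem toSat_apply (t : T.carrier) : toSat t = (IsSatPair.of_Fpow t).elt := rfl

instance : Algebra W T.satSubring :=
  RingHom.toAlgebra' (toSat.comp (algebraMap W T.carrier)) fun w s => by
    induction s using satSubring_ind with
    | h x y hxy =>
      refine Subtype.ext (Germ.coe_eq.2 (Eventually.of_forall fun m => ?_))
      exact commute_of_mem_zero (Fpow_mem m 0 (SetLike.algebraMap_mem_graded T.gr w)) (x m)

theorem smul_sat (w : W) (s : T.satSubring) : w • s = toSat (algebraMap W T.carrier w) * s := rfl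

variable (T) in
/-- The grading of the saturation. -/
def satGr (i : ℕ) : Submodule W T.satSubring where
  carrier := {s | s.1.LiftPred (· ∈ T.gr i)}
  add_mem' {a b} ha hb := by
    induction a using satSubring_ind with
    | h x y hxy =>
      induction b using satSubring_ind with
      | h x' y' hxy' =>
        have ha' : ∀ᶠ n in atTop, x n ∈ T.gr i := ha
        have hb' : ∀ᶠ n in atTop, x' n ∈ T.gr i := hb
        change ∀ᶠ n in atTop, x n + x' n ∈ T.gr i
        filter_upwards [ha', hb'] with n h1 h2
        exact add_mem h1 h2
  zero_mem' := Eventually.of_forall fun n => zero_mem _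
  smul_mem' w a ha := by
    rw [smul_sat]
    induction a using satSubring_ind with
    | h x y hxy =>
      have ha' : ∀ᶠ n in atTop, x n ∈ T.gr i := ha
      change ∀ᶠ n in atTop, (T.F ^ n) (algebraMap W T.carrier w) * x n ∈ T.gr i
      filter_upwards [ha'] with n h1
      simpa using SetLike.mul_mem_graded
        (Fpow_mem n 0 (SetLike.algebraMap_mem_graded T.gr w)) h1

theorem elt_mem_satGr {i : ℕ} {x y : ℕ → T.carrier} {h : T.IsSatPair x y} :
    h.elt ∈ T.satGr i ↔ ∀ᶠ n in atTop, x n ∈ T.gr i := Iff.rfl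

theorem toSat_mem {i : ℕ} {t : T.carrier} (ht : t ∈ T.gr i) : toSat t ∈ T.satGr i :=
  Eventually.of_forall fun n => Fpow_mem n i ht

/-- The projections to the graded pieces of the saturation. -/
def satPr (i : ℕ) : T.satSubring →+ T.satSubring where
  toFun s := ⟨s.1.map (T.pr i), by
    obtain ⟨_, x, y, hxy, rfl⟩ := s
    exact ⟨_, _, hxy.map_pr i, rfl⟩⟩
  map_zero' := Subtype.ext (Germ.coe_eq.2 (Eventually.of_forall fun _ => map_zero (T.pr i)))
  map_add' a b := by
    induction a using satSubring_ind with
    | h x y hxy =>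
      induction b using satSubring_ind with
      | h x' y' hxy' =>
        exact Subtype.ext (Germ.coe_eq.2 (Eventually.of_forall fun m => map_add (T.pr i) (x m) (x' m)))

theorem satPr_elt (i : ℕ) {x y : ℕ → T.carrier} (h : T.IsSatPair x y) :
    satPr i h.elt = (h.map_pr i).elt := rfl

theorem IsSatPair.elt_eq_zero {x y : ℕ → T.carrier} {h : T.IsSatPair x y} :
    h.elt = 0 ↔ ∀ᶠ n in atTop, x n = 0 := by
  rw [← map_zero toSat, toSat_apply, elt_eq_elt]
  simp [EventuallyEq]

theorem IsSatPair.sum_elt {n : ℕ} {x y : ℕ → ℕ → T.carrier} (h : ∀ i, T.IsSatPair (x i) (y i)) :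
    ((∑ i ∈ Finset.range n, (h i).elt : T.satSubring) : Germ (atTop : Filter ℕ) T.carrier) =
      ((fun m => ∑ i ∈ Finset.range n, x i m : ℕ → T.carrier) :
        Germ (atTop : Filter ℕ) T.carrier) := by
  induction n with
  | zero => rfl
  | succ n ih =>
    rw [Finset.sum_range_succ, Subring.coe_add, ih]
    simp only [Finset.sum_range_succ]
    rfl

instance : Nonempty (GradedAlgebra T.satGr) := by
  refine nonempty_gradedAlgebra_of_proj _ ?_ ?_ satPr ?_ ?_ ?_ ?_
  · rw [← map_one toSat]; exact toSat_mem SetLike.GradedOne.one_mem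
  · intro i j s hs t ht
    induction s using satSubring_ind with
    | h x y hxy =>
      induction t using satSubring_ind with
      | h x' y' hxy' =>
        have hs' : ∀ᶠ n in atTop, x n ∈ T.gr i := hs
        have ht' : ∀ᶠ n in atTop, x' n ∈ T.gr j := ht
        change ∀ᶠ n in atTop, x n * x' n ∈ T.gr (i + j)
        filter_upwards [hs', ht'] with n h1 h2
        exact SetLike.mul_mem_graded h1 h2
  · intro i s
    induction s using satSubring_ind with
    | h x y hxy =>
      rw [satPr_elt]
      exact Eventually.of_forall fun n => T.pr_mem _ _
  · intro i s hs
    induction s using satSubring_ind with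
    | h x y hxy =>
      rw [satPr_elt, IsSatPair.elt_eq_elt]
      filter_upwards [elt_mem_satGr.1 hs] with n h1
      exact pr_same h1
  · intro i j hij s hs
    induction s using satSubring_ind with
    | h x y hxy =>
      rw [satPr_elt, IsSatPair.elt_eq_zero]
      filter_upwards [elt_mem_satGr.1 hs] with n h1
      exact pr_ne h1 hij
  · intro s
    induction s using satSubring_ind with
    | h x y hxy =>
      -- From `n₀` on the sequence consists of the `F`-iterates of `x n₀`. As `F` preserves degrees,
      -- a degree bound for `x n₀` serves for all later terms.
      obtain ⟨n₀, hn₀⟩ := hxy.eventually_Fpow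
      obtain ⟨k, hk⟩ := exists_sum_pr (x n₀)
      refine ⟨k, Subtype.ext ?_⟩
      simp only [satPr_elt]
      rw [IsSatPair.sum_elt]
      refine Germ.coe_eq.2 ?_
      filter_upwards [eventually_ge_atTop n₀] with n hn
      obtain ⟨m, rfl⟩ := Nat.exists_eq_add_of_le hn
      rw [hn₀ n₀ le_rfl]
      conv_lhs => rw [hk, map_sum]
      refine Finset.sum_congr rfl fun i _ => ?_
      induction m with
      | zero => rfl
      | succ m ih => rw [Fpow_succ, ih (by omega), Fpow_succ, pr_F]

instance : GradedAlgebra T.satGr := Nonempty.some inferInstance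

/-- The Frobenius of the saturation. -/
def satF : T.satSubring →+* T.satSubring where
  toFun s := ⟨s.1.map T.F, by
    obtain ⟨_, x, y, hxy, rfl⟩ := s
    exact ⟨_, _, hxy.map_F, rfl⟩⟩
  map_one' := Subtype.ext (Germ.coe_eq.2 (Eventually.of_forall fun _ => map_one T.F))
  map_mul' a b := by
    induction a using satSubring_ind with
    | h x y hxy =>
      induction b using satSubring_ind with
      | h x' y' hxy' =>
        exact Subtype.ext (Germ.coe_eq.2 (Eventually.of_forall fun m => map_mul T.F (x m) (x' m)))
  map_zero' := Subtype.ext (Germ.coe_eq.2 (Eventually.of_forall fun _ => map_zero T.F))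
  map_add' a b := by
    induction a using satSubring_ind with
    | h x y hxy =>
      induction b using satSubring_ind with
      | h x' y' hxy' =>
        exact Subtype.ext (Germ.coe_eq.2 (Eventually.of_forall fun m => map_add T.F (x m) (x' m)))

theorem satF_elt {x y : ℕ → T.carrier} (h : T.IsSatPair x y) : satF h.elt = h.map_F.elt := rfl

theorem satF_toSat (t : T.carrier) : satF (toSat t) = toSat (T.F t) :=
  Subtype.ext (Germ.coe_eq.2 (Eventually.of_forall fun m => by
    change T.F ((T.F ^ m) t) = _
    rw [← Fpow_succ, Fpow_succ']))

/-- On germs `F` is the shift: `F (x n) = x (n + 1)` for large `n`. -/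
theorem satF_injective : Function.Injective (satF (T := T)) := by
  rw [injective_iff_map_eq_zero]
  intro s hs
  induction s using satSubring_ind with
  | h x y hxy =>
    rw [satF_elt, IsSatPair.elt_eq_zero] at hs
    rw [IsSatPair.elt_eq_zero]
    have : ∀ᶠ n in atTop, x (n + 1) = 0 := by
      filter_upwards [hxy.left, hs] with n h1 h2
      rw [h1, h2]
    obtain ⟨n₀, hn₀⟩ := eventually_atTop.1 this
    exact eventually_atTop.2 ⟨n₀ + 1, fun n hn => by
      obtain ⟨m, rfl⟩ := Nat.exists_eq_add_of_le' (show 1 ≤ n by omega)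
      exact hn₀ m (by omega)⟩

section TorsionFree

variable (hT : ∀ x : T.carrier, (p : T.carrier) * x = 0 → x = 0)

/-- The differential of the saturation. -/
def satD : T.satSubring →ₗ[W] T.satSubring where
  toFun s := (s.2.choose_spec.choose_spec.1.closed hT).elt
  map_add' a b := by
    rw [← sub_eq_zero]
    have h1 := a.2.choose_spec.choose_spec
    have h2 := b.2.choose_spec.choose_spec
    have h3 := (a + b).2.choose_spec.choose_spec
    rw [sub_eq_zero]
    refine IsSatPair.elt_eq_elt (h' := (h1.1.closed hT).add (h2.1.closed hT)).2
      (h3.1.right_eventuallyEq hT (h1.1.add h2.1) ?_)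
    rw [← Germ.coe_eq, h3.2, Germ.coe_add, h1.2, h2.2]
    rfl
  map_smul' w a := by
    have h1 := a.2.choose_spec.choose_spec
    have h3 := (w • a).2.choose_spec.choose_spec
    have h4 := (IsSatPair.of_Fpow (algebraMap W T.carrier w))
    have h5 := h3.1.right_eventuallyEq hT (h4.mul h1.1) (by
      rw [← Germ.coe_eq, h3.2, Germ.coe_mul, h1.2]; rfl)
    refine IsSatPair.elt_eq_elt (h' := h4.mul (h1.1.closed hT)).2 ?_
    filter_upwards [h5] with n hn
    rw [hn, T.d_algebraMap, map_zero, zero_mul, zero_add,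
      invol_of_mem (Fpow_mem n 0 (SetLike.algebraMap_mem_graded T.gr w)), pow_zero, one_mul]
    rfl

theorem satD_elt {x y : ℕ → T.carrier} (h : T.IsSatPair x y) :
    satD hT h.elt = (h.closed hT).elt := by
  have h1 := h.elt.2.choose_spec.choose_spec
  exact IsSatPair.elt_eq_elt (h := h1.1.closed hT).2
    (h1.1.right_eventuallyEq hT h (Germ.coe_eq.1 h1.2))

theorem satD_toSat (t : T.carrier) : satD hT (toSat t) = toSat (T.d t) := by
  rw [toSat_apply, satD_elt, toSat_apply, IsSatPair.elt_eq_elt]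

/-- The saturation of a `p`-torsion free log Dieudonné algebra. -/
def saturation : LogDieudonneAlg p β where
  carrier := T.satSubring
  gr := T.satGr
  graded_comm i j a ha b hb := by
    induction a using satSubring_ind with
    | h x y hxy =>
      induction b using satSubring_ind with
      | h x' y' hxy' =>
        refine Subtype.ext (Germ.coe_eq.2 ?_)
        filter_upwards [elt_mem_satGr.1 ha, elt_mem_satGr.1 hb] with n h1 h2
        exact T.graded_comm i j _ h1 _ h2
  sq_odd i hi a ha := by
    induction a using satSubring_ind with
    | h x y hxy =>
      refine Subtype.ext (Germ.coe_eq.2 ?_)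
      filter_upwards [elt_mem_satGr.1 ha] with n h1
      exact T.sq_odd i hi _ h1
  d := satD hT
  d_mem i a ha := by
    induction a using satSubring_ind with
    | h x y hxy =>
      rw [satD_elt, elt_mem_satGr]
      filter_upwards [elt_mem_satGr.1 ha, hxy.d_eq] with n h1 h2
      -- `p^n y n = d (x n)` has degree `i + 1`, and `p` is a nonzerodivisor.
      have : T.pr (i + 1) (y n) = y n := by
        apply cancel_p_pow hT n
        rw [← pr_p_pow_mul, ← h2, pr_same (T.d_mem i _ h1)]
      rw [← this]
      exact T.pr_mem _ _
  d_mul i a ha b := by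
    induction a using satSubring_ind with
    | h x y hxy =>
      induction b using satSubring_ind with
      | h x' y' hxy' =>
        change satD hT (hxy.mul hxy').elt = _
        rw [satD_elt, satD_elt, satD_elt]
        refine Subtype.ext (Germ.coe_eq.2 ?_)
        filter_upwards [elt_mem_satGr.1 ha] with n h1
        rw [invol_of_mem h1, mul_assoc]
        rfl
  d_d a := by
    induction a using satSubring_ind with
    | h x y hxy =>
      rw [satD_elt, satD_elt, IsSatPair.elt_eq_zero]
      exact Eventually.of_forall fun _ => rfl
  F := satF
  F_mem i a ha := by
    induction a using satSubring_ind with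
    | h x y hxy =>
      rw [satF_elt, elt_mem_satGr]
      filter_upwards [elt_mem_satGr.1 ha] with n h1
      exact T.F_mem _ _ h1
  F_frob a ha := by
    induction a using satSubring_ind with
    | h x y hxy =>
      have hx0 := elt_mem_satGr.1 ha
      -- Only the terms with large index are known to have degree zero, so the choice of `b` is
      -- guarded by that condition.
      have hex : ∀ n, ∃ b ∈ T.gr 0, x n ∈ T.gr 0 → T.F (x n) = x n ^ p + (p : T.carrier) * b := by
        intro n
        by_cases hn : x n ∈ T.gr 0
        · obtain ⟨b, hb, h⟩ := T.F_frob _ hn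
          exact ⟨b, hb, fun _ => h⟩
        · exact ⟨0, zero_mem _, fun h => absurd h hn⟩
      choose b hb hFb using hex
      -- `b n = (F (x n) - x n ^ p) / p`. Since `d (F x) = p F (d x)` and `d (x^p) = p x^(p-1) d x`,
      -- cancelling one `p` gives `d (b n) = p^n (F (y n) - x n ^ (p-1) y n)`.
      have hpair : T.IsSatPair b (fun n => T.F (y n) - x n ^ (p - 1) * y n) := by
        refine ⟨?_, ?_, ?_⟩
        · filter_upwards [hx0, hxy.left] with n h1 h2
          have h1' : x (n + 1) ∈ T.gr 0 := by rw [h2]; exact T.F_mem _ _ h1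
          apply cancel_p_pow hT 1
          rw [pow_one, ← F_p_mul, eq_sub_iff_add_eq'.2 (hFb n h1).symm,
            eq_sub_iff_add_eq'.2 (hFb (n + 1) h1').symm, h2, map_sub, map_pow]
        · filter_upwards [hxy.left, hxy.right] with n h1 h2
          simp [h1, h2]
        · filter_upwards [hx0, hxy.d_eq] with n h1 h2
          apply cancel_p_pow hT 1
          rw [pow_one, ← d_p_mul, eq_sub_iff_add_eq'.2 (hFb n h1).symm, map_sub, T.d_F,
            d_pow_zero h1, h2, map_mul, map_pow, map_natCast, mul_assoc,
            p_pow_comm n (x n ^ (p - 1)), ← mul_sub, ← mul_sub]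
      refine ⟨hpair.elt, Eventually.of_forall hb, Subtype.ext (Germ.coe_eq.2 ?_)⟩
      filter_upwards [hx0] with n h1
      exact hFb n h1
  d_F a := by
    induction a using satSubring_ind with
    | h x y hxy =>
      rw [satF_elt, satD_elt, satD_elt, satF_elt]
      exact Subtype.ext rfl
  L := T.L
  α := (toSat (T := T)).toMonoidHom.comp T.α
  α_mem m := toSat_mem (T.α_mem m)
  ι := T.ι
  α_ι n := congrArg toSat (T.α_ι n)
  δ m := toSat (T.δ m)
  δ_mem m := toSat_mem (T.δ_mem m)
  δ_one := by rw [T.δ_one, map_zero]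
  δ_mul m n := by rw [T.δ_mul, map_add]
  d_α m := (satD_toSat hT _).trans (by rw [T.d_α, map_mul]; rfl)
  δ_ι n := by rw [T.δ_ι, map_zero]
  d_δ m := by rw [satD_toSat, T.d_δ, map_zero]
  FL := T.FL
  δ_FL m := by rw [T.δ_FL, map_mul, map_natCast, satF_toSat]
  F_α m := (satF_toSat _).trans (congrArg toSat (T.F_α m))

/-- The morphism from a `p`-torsion free log Dieudonné algebra to its saturation. -/
def toSaturation : T ⟶ saturation hT :=
  Hom.mk { toSat with commutes' := fun _ => rfl } (fun _ _ ha => toSat_mem ha)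
    (fun t => (satD_toSat hT t).symm) (fun t => (satF_toSat t).symm) (MonoidHom.id T.L)
    (fun _ => rfl) (fun _ => rfl) (fun _ => rfl) (fun _ => rfl)

end TorsionFree

end LogDieudonneAlg

/-! ### Universal property of the saturation and its description by iterates of `η_p` -/

namespace LogDieudonneAlg

open Filter

variable {p : ℕ} {W N : Type u} [CommRing W] [CommMonoid N] {β : N →* W}

/-- An intrinsic characterization of the saturation of a `p`-torsion free object. -/
structure IsSaturationMap {T S : LogDieudonneAlg p β} (j : T ⟶ S) : Prop where
  source_torsionFree : ∀ x : T.carrier, (p : T.carrier) * x = 0 → x = 0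
  torsionFree : ∀ x : S.carrier, (p : S.carrier) * x = 0 → x = 0
  F_injective : Function.Injective S.F
  exists_Fpow_eq : ∀ s, ∃ n t z, T.d t = (p : T.carrier) ^ n * z ∧ (S.F ^ n) s = Hom.f j t
  exists_of_d_eq : ∀ n t z, T.d t = (p : T.carrier) ^ n * z → ∃ s, (S.F ^ n) s = Hom.f j t
  ker : ∀ t, Hom.f j t = 0 → ∃ n, (T.F ^ n) t = 0
  bijective_ψ : Function.Bijective (Hom.ψ j)

theorem satF_pow_elt {T : LogDieudonneAlg p β} {x y : ℕ → T.carrier} (h : T.IsSatPair x y) (n : ℕ) :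
    ((satF ^ n) h.elt).1 =
      ((fun m => (T.F ^ n) (x m) : ℕ → T.carrier) : Germ (atTop : Filter ℕ) T.carrier) := by
  induction n with
  | zero => rfl
  | succ n ih =>
    rw [pow_succ']
    change Germ.map T.F ((satF ^ n) h.elt).1 = _
    rw [ih]
    exact Germ.coe_eq.2 (Eventually.of_forall fun m => (Fpow_succ n (x m)).symm)

theorem isSaturationMap_toSaturation {T : LogDieudonneAlg p β}
    (hT : ∀ x : T.carrier, (p : T.carrier) * x = 0 → x = 0) :
    IsSaturationMap (toSaturation hT) where
  source_torsionFree := hT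
  torsionFree s hs := by
    induction s using satSubring_ind with
    | h x y hxy =>
      have hs' : ((fun m => (p : T.carrier) * x m : ℕ → T.carrier) :
        Germ (atTop : Filter ℕ) T.carrier) = (fun _ => 0 : ℕ → T.carrier) := congrArg Subtype.val hs
      refine IsSatPair.elt_eq_zero.2 ?_
      filter_upwards [Germ.coe_eq.1 hs'] with n hn
      exact hT _ hn
  F_injective := satF_injective
  exists_Fpow_eq s := by
    induction s using satSubring_ind with
    | h x y hxy =>
      obtain ⟨n₀, hn₀⟩ := hxy.eventually_Fpow
      obtain ⟨n, hn, hn'⟩ := (hxy.d_eq.and (eventually_ge_atTop n₀)).exists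
      refine ⟨n, x n, y n, hn, Subtype.ext ?_⟩
      refine (satF_pow_elt hxy n).trans (Germ.coe_eq.2 ?_)
      filter_upwards [eventually_ge_atTop n₀] with m hm
      rw [← hn₀ m hm, add_comm, hn₀ n hn']
  exists_of_d_eq n t z h := by
    refine ⟨(IsSatPair.of_d_eq h).elt, Subtype.ext ?_⟩
    refine (satF_pow_elt _ n).trans (Germ.coe_eq.2 ?_)
    filter_upwards [eventually_ge_atTop n] with m hm
    rw [← Fpow_add, Nat.add_sub_cancel' hm]
  ker t ht := by
    obtain ⟨n, hn⟩ := (IsSatPair.elt_eq_zero (h := IsSatPair.of_Fpow t).1 ht).exists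
    exact ⟨n, hn⟩
  bijective_ψ := Function.bijective_id

theorem Hom.f_p_pow_mul {A B : LogDieudonneAlg p β} (g : Hom A B) (n : ℕ) (x : A.carrier) :
    g.f ((p : A.carrier) ^ n * x) = (p : B.carrier) ^ n * g.f x := by
  rw [map_mul, map_pow, map_natCast]

theorem Fpow_p_pow_mul {A : LogDieudonneAlg p β} (m n : ℕ) (x : A.carrier) :
    (A.F ^ m) ((p : A.carrier) ^ n * x) = (p : A.carrier) ^ n * (A.F ^ m) x := by
  rw [map_mul, map_pow, map_natCast]

theorem pr_Fpow {A : LogDieudonneAlg p β} (i n : ℕ) (x : A.carrier) :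
    A.pr i ((A.F ^ n) x) = (A.F ^ n) (A.pr i x) := by
  induction n with
  | zero => rfl
  | succ n ih => rw [Fpow_succ, pr_F, ih, Fpow_succ]

theorem Fpow_comm {A : LogDieudonneAlg p β} (m n : ℕ) (x : A.carrier) :
    (A.F ^ m) ((A.F ^ n) x) = (A.F ^ n) ((A.F ^ m) x) := by
  rw [← Fpow_add, add_comm, Fpow_add]

/-- Cancelling `p^i` from `φ_F = p^i F` reduces bijectivity onto `η_p` to two statements about `F`
that do not mention degrees. -/
theorem isSaturated_of_exists_F_eq {S : LogDieudonneAlg p β}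
    (torsionFree : ∀ x : S.carrier, (p : S.carrier) * x = 0 → x = 0)
    (F_injective : Function.Injective S.F)
    (exists_F_eq : ∀ y z : S.carrier, S.d y = p * z → ∃ s, S.F s = y) : S.IsSaturated where
  torsionFree := torsionFree
  bijOn i := by
    refine ⟨fun x hx => ⟨⟨_, S.F_mem i x hx, rfl⟩, _, S.F_mem _ _ (S.d_mem i x hx), ?_⟩,
      fun x _ y _ hxy => ?_, ?_⟩
    · rw [phiF, d_p_pow_mul, S.d_F, ← mul_assoc, pow_succ]
    · exact F_injective (cancel_p_pow torsionFree i hxy)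
    · rintro _ ⟨⟨y, hy, rfl⟩, z, -, hz⟩
      obtain ⟨s, rfl⟩ := exists_F_eq y z (by
        apply cancel_p_pow torsionFree i
        rw [← d_p_pow_mul, hz, pow_succ, mul_assoc])
      refine ⟨S.pr i s, S.pr_mem _ _, ?_⟩
      rw [phiF, ← pr_F, pr_same hy]

namespace IsSaturationMap

variable {T S : LogDieudonneAlg p β} {j : T ⟶ S} (h : IsSaturationMap j)

theorem Fpow_injective (h : IsSaturationMap j) (n : ℕ) : Function.Injective (S.F ^ n) := by
  induction n with
  | zero => exact fun _ _ h => h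
  | succ n ih =>
    intro x y hxy
    rw [Fpow_succ, Fpow_succ] at hxy
    exact ih (h.F_injective hxy)

theorem exists_Fpow_eq_Fpow (h : IsSaturationMap j) {t t' : T.carrier}
    (htt' : Hom.f j t = Hom.f j t') : ∃ l, (T.F ^ l) t = (T.F ^ l) t' := by
  obtain ⟨l, hl⟩ := h.ker (t - t') (by rw [map_sub, htt', sub_self])
  exact ⟨l, sub_eq_zero.1 (by rw [← map_sub, hl])⟩

/-- Descend to `T`: `F^n y = j t` with `d t = p^n w`, and `F^m z = j u`. After a further power
`F^l`, equality under `j` becomes equality in `T`, and `F^(l+m) w` is divisible by `p`. Thus `d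
(F^(l+m) t)` is divisible by `p^(l+m+n+1)`, one more power than needed for `y` itself, so `F^(l+m)
t` comes from `F^(l+m+n+1) s`. -/
theorem exists_F_eq (h : IsSaturationMap j) {y z : S.carrier} (hy : S.d y = p * z) :
    ∃ s, S.F s = y := by
  obtain ⟨n, t, w, hw, hn⟩ := h.exists_Fpow_eq y
  obtain ⟨m, u, -, -, hm⟩ := h.exists_Fpow_eq z
  have h1 : Hom.f j w = p * (S.F ^ n) z := by
    apply cancel_p_pow h.torsionFree n
    rw [← Hom.f_p_pow_mul, ← hw, Hom.f_d, ← hn, d_Fpow, hy, map_mul, map_natCast]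
  obtain ⟨l, hl⟩ := h.exists_Fpow_eq_Fpow (t := (T.F ^ m) w) (t' := p * (T.F ^ n) u) (by
    rw [Hom.f_Fpow, h1, map_mul, map_natCast, map_mul, map_natCast, Hom.f_Fpow, ← hm, Fpow_comm])
  obtain ⟨s, hs⟩ := h.exists_of_d_eq (l + m + n + 1) ((T.F ^ (l + m)) t)
    ((T.F ^ l) ((T.F ^ n) u)) (by
      rw [d_Fpow, hw, Fpow_p_pow_mul, ← mul_assoc, ← pow_add, Fpow_add, hl, map_mul, map_natCast,
        ← mul_assoc, ← pow_succ])
  refine ⟨s, h.Fpow_injective (l + m + n) ?_⟩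
  rw [← Fpow_succ', hs, Hom.f_Fpow, ← hn, ← Fpow_add]

theorem isSaturated (h : IsSaturationMap j) : S.IsSaturated :=
  isSaturated_of_exists_F_eq h.torsionFree h.F_injective fun _ _ => h.exists_F_eq

/-- Morphisms to a saturated object extend to the saturation. -/
theorem exists_lift (h : IsSaturationMap j) {B : LogDieudonneAlg p β} (hB : B.IsSaturated)
    (g : T ⟶ B) : ∃ g' : S ⟶ B, j ≫ g' = g := by
  -- `R s b` says that some power of `F` carries `s` and `b` to the images of one element of `T`.
  -- Such `b` exists by `exists_Fpow_eq` in `B` and is unique since `F` is injective there; each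
  -- property of the lift is then proved by exhibiting an instance of `R`.
  let R : S.carrier → B.carrier → Prop := fun s b =>
    ∃ n t, (S.F ^ n) s = Hom.f j t ∧ (B.F ^ n) b = Hom.f g t
  have hex : ∀ s, ∃ b, R s b := by
    intro s
    obtain ⟨n, t, z, hz, hn⟩ := h.exists_Fpow_eq s
    obtain ⟨b, hb⟩ := hB.exists_Fpow_eq n (x := Hom.f g t) (z := Hom.f g z) (by
      rw [← Hom.f_d, hz, Hom.f_p_pow_mul])
    exact ⟨b, n, t, hn, hb⟩
  have hcommon : ∀ {s s' b b'}, R s b → R s' b' → ∃ n t t', (S.F ^ n) s = Hom.f j t ∧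
      (B.F ^ n) b = Hom.f g t ∧ (S.F ^ n) s' = Hom.f j t' ∧ (B.F ^ n) b' = Hom.f g t' := by
    rintro s s' b b' ⟨n, t, h1, h2⟩ ⟨m, t', h3, h4⟩
    refine ⟨n + m, (T.F ^ m) t, (T.F ^ n) t', ?_, ?_, ?_, ?_⟩
    · rw [Hom.f_Fpow, ← h1, ← Fpow_add, add_comm]
    · rw [Hom.f_Fpow, ← h2, ← Fpow_add, add_comm]
    · rw [Hom.f_Fpow, ← h3, ← Fpow_add]
    · rw [Hom.f_Fpow, ← h4, ← Fpow_add]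
  have huniq : ∀ {s b b'}, R s b → R s b' → b = b' := by
    intro s b b' hb hb'
    obtain ⟨n, t, t', h1, h2, h3, h4⟩ := hcommon hb hb'
    obtain ⟨l, hl⟩ := h.exists_Fpow_eq_Fpow (h1.symm.trans h3)
    apply hB.Fpow_injective (l + n)
    rw [Fpow_add, Fpow_add, h2, h4, ← Hom.f_Fpow, ← Hom.f_Fpow, hl]
  choose f hf using hex
  have hfj : ∀ t, f (Hom.f j t) = Hom.f g t := fun t => huniq (hf _) ⟨0, t, rfl, rfl⟩
  let f' : S.carrier →ₐ[W] B.carrier :=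
    { toFun := f
      map_one' := by rw [← map_one (Hom.f j), hfj, map_one]
      map_zero' := by rw [← map_zero (Hom.f j), hfj, map_zero]
      map_mul' := fun s s' => huniq (hf _) (by
        obtain ⟨n, t, t', h1, h2, h3, h4⟩ := hcommon (hf s) (hf s')
        exact ⟨n, t * t', by rw [map_mul, map_mul, h1, h3], by rw [map_mul, map_mul, h2, h4]⟩)
      map_add' := fun s s' => huniq (hf _) (by
        obtain ⟨n, t, t', h1, h2, h3, h4⟩ := hcommon (hf s) (hf s')
        exact ⟨n, t + t', by rw [map_add, map_add, h1, h3], by rw [map_add, map_add, h2, h4]⟩)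
      commutes' := fun w => by rw [← (Hom.f j).commutes w, hfj, (Hom.f g).commutes] }
  have hfj' : ∀ t, f' (Hom.f j t) = Hom.f g t := hfj
  let e : T.L ≃* S.L := MulEquiv.ofBijective (Hom.ψ j) h.bijective_ψ
  let ψ : S.L →* B.L := (Hom.ψ g).comp e.symm.toMonoidHom
  have hψ : ∀ m, ψ (Hom.ψ j m) = Hom.ψ g m := fun m => by
    change Hom.ψ g (e.symm (e m)) = _
    rw [e.symm_apply_apply]
  refine ⟨Hom.mk f' ?_ ?_ ?_ ψ ?_ ?_ ?_ ?_, Hom.ext (AlgHom.ext hfj) (MonoidHom.ext hψ)⟩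
  · intro i s hs
    have : f s = B.pr i (f s) := by
      apply huniq (hf s)
      obtain ⟨n, t, h1, h2⟩ := hf s
      refine ⟨n, T.pr i t, ?_, ?_⟩
      · rw [Hom.f_pr, ← h1, pr_Fpow, pr_same hs]
      · rw [Hom.f_pr, ← h2, pr_Fpow]
    change f s ∈ _
    rw [this]
    exact B.pr_mem _ _
  · intro s
    refine huniq (hf _) ?_
    obtain ⟨n, t, h1, h2⟩ := hf s
    obtain ⟨m, u, h3, h4⟩ := hf (S.d s)
    have h5 : (B.F ^ m) (B.d (f s)) = Hom.f g u := by
      -- Both sides compute `p^n F^n F^m (d s)`. A further power `F^l` lifts the identity to `T`,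
      -- whence it passes to `B`, where `p^n` and `F` cancel.
      have h6 : Hom.f j ((T.F ^ m) (T.d t)) = Hom.f j ((p : T.carrier) ^ n * (T.F ^ n) u) := by
        rw [Hom.f_Fpow, Hom.f_d, ← h1, d_Fpow, Fpow_p_pow_mul, Fpow_comm, h3, Hom.f_p_pow_mul,
          Hom.f_Fpow]
      obtain ⟨l, hl⟩ := h.exists_Fpow_eq_Fpow h6
      apply hB.Fpow_injective (l + n)
      apply hB.cancel n
      have h7 := congrArg (Hom.f g) hl
      rw [Hom.f_Fpow, Hom.f_Fpow, Hom.f_d, ← h2, d_Fpow, Fpow_p_pow_mul, Fpow_p_pow_mul,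
        Fpow_p_pow_mul, Hom.f_p_pow_mul, Hom.f_Fpow, Hom.f_Fpow, Fpow_comm m n, ← Fpow_add,
        ← Fpow_add] at h7
      rw [← Fpow_add, h7, Fpow_add]
    exact ⟨m, u, h3, h5⟩
  · intro s
    refine huniq (hf _) ?_
    obtain ⟨n, t, h1, h2⟩ := hf s
    refine ⟨n, T.F t, ?_, ?_⟩
    · rw [Hom.f_F, ← h1, ← Fpow_succ', Fpow_succ]
    · change (B.F ^ n) (B.F (f s)) = _
      rw [Hom.f_F, ← h2, ← Fpow_succ', Fpow_succ]
  · intro n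
    rw [← Hom.ψ_ι j, hψ, Hom.ψ_ι g]
  · intro m
    obtain ⟨m, rfl⟩ := h.bijective_ψ.2 m
    rw [← Hom.f_α j, hfj', hψ, Hom.f_α g]
  · intro m
    obtain ⟨m, rfl⟩ := h.bijective_ψ.2 m
    rw [← Hom.ψ_FL j, hψ, hψ, Hom.ψ_FL g]
  · intro m
    obtain ⟨m, rfl⟩ := h.bijective_ψ.2 m
    rw [← Hom.f_δ j, hfj', hψ, Hom.f_δ g]

theorem hom_ext (h : IsSaturationMap j) {B : LogDieudonneAlg p β} (hB : B.IsSaturated)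
    {g g' : S ⟶ B} (hg : j ≫ g = j ≫ g') : g = g' := by
  refine Hom.ext (AlgHom.ext fun s => ?_) (MonoidHom.ext fun m => ?_)
  · obtain ⟨n, t, z, -, hn⟩ := h.exists_Fpow_eq s
    apply hB.Fpow_injective n
    rw [← Hom.f_Fpow, ← Hom.f_Fpow, hn]
    exact DFunLike.congr_fun (congrArg Hom.f hg) t
  · obtain ⟨m, rfl⟩ := h.bijective_ψ.2 m
    exact DFunLike.congr_fun (congrArg Hom.ψ hg) m

end IsSaturationMap

section EtaColimit

variable {T S : LogDieudonneAlg p β}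

/-- Cancelling powers of `p` collapses the nested divisibility conditions to one on `y` and one on
`d y`. In the converse the quotient `z` must lie in `η_p^n` too; it is closed, so its own condition
holds with witness `0`. -/
theorem mem_etaIter (hT : ∀ x : T.carrier, (p : T.carrier) * x = 0 → x = 0) {n i : ℕ}
    {x : T.carrier} : x ∈ T.etaIter n i ↔ ∃ y ∈ T.gr i, x = (p : T.carrier) ^ (n * i) * y ∧
      ∃ z ∈ T.gr (i + 1), T.d y = (p : T.carrier) ^ n * z := by
  induction n generalizing i x with
  | zero =>
    constructor
    · intro hx
      exact ⟨x, hx, by simp, T.d x, T.d_mem i x hx, by simp⟩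
    · rintro ⟨y, hy, rfl, -⟩
      rw [zero_mul, pow_zero, one_mul]
      exact hy
  | succ n ih =>
    have hsucc : T.etaIter (n + 1) = T.etaP (T.etaIter n) := Function.iterate_succ_apply' _ _ _
    rw [hsucc]
    constructor
    · rintro ⟨⟨x', hx', rfl⟩, z, hz, hdz⟩
      obtain ⟨y, hy, rfl, -⟩ := ih.1 hx'
      obtain ⟨z, hz', rfl, -⟩ := ih.1 hz
      refine ⟨y, hy, by rw [← mul_assoc, ← pow_add]; congr 2; ring, z, hz', ?_⟩
      apply cancel_p_pow hT (n * i + i)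
      rw [d_p_pow_mul, d_p_pow_mul, ← mul_assoc, ← pow_add, ← mul_assoc, ← pow_add] at hdz
      rw [add_comm (n * i), hdz, ← mul_assoc, ← pow_add]
      congr 2; ring
    · rintro ⟨y, hy, rfl, z, hz, hdz⟩
      refine ⟨⟨(p : T.carrier) ^ (n * i) * y, ih.2 ⟨y, hy, rfl, (p : T.carrier) * z,
        p_mul_mem hz, by rw [hdz, pow_succ, mul_assoc]⟩, ?_⟩,
        (p : T.carrier) ^ (n * (i + 1)) * z, ih.2 ⟨z, hz, rfl, 0, zero_mem _, ?_⟩, ?_⟩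
      · rw [← mul_assoc, ← pow_add]; congr 2; ring
      · apply cancel_p_pow hT (n + 1)
        rw [← d_p_pow_mul, ← hdz, T.d_d]; simp
      · rw [d_p_pow_mul, hdz, ← mul_assoc, ← pow_add, ← mul_assoc, ← pow_add]
        congr 2; ring

theorem phiF_iterate (i m : ℕ) (x : T.carrier) :
    (T.phiF i)^[m] x = (p : T.carrier) ^ (i * m) * (T.F ^ m) x := by
  induction m with
  | zero => simp
  | succ m ih =>
    rw [Function.iterate_succ_apply', ih, phiF, map_mul, map_pow, map_natCast, ← mul_assoc,
      ← pow_add, Fpow_succ, Nat.mul_succ, add_comm]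

open Classical in
/-- The structure maps of the colimit of the iterates of `η_p`. -/
def etaColimitMap (j : T ⟶ S) (n : ℕ) (x : T.carrier) : S.carrier :=
  -- For `n = 0` the map is `j` on all elements, inhomogeneous ones included. For `n > 0` only
  -- homogeneous `x` matter, and the value is `s` with `p^(n i) F^n s = j x`; elsewhere it is set to
  -- `0`.
  if n = 0 then Hom.f j x
  else if h : ∃ s i, x ∈ T.gr i ∧ (p : S.carrier) ^ (n * i) * (S.F ^ n) s = Hom.f j x then h.choose
  else 0

namespace IsSaturationMap

variable {j : T ⟶ S}

theorem etaColimitMap_eq (h : IsSaturationMap j) {n i : ℕ} {x : T.carrier} {s : S.carrier}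
    (hx : x ∈ T.gr i) (hs : (p : S.carrier) ^ (n * i) * (S.F ^ n) s = Hom.f j x) :
    etaColimitMap j n x = s := by
  by_cases hn : n = 0
  · subst hn
    rw [etaColimitMap, if_pos rfl, ← hs]
    simp
  · have hex : ∃ s i, x ∈ T.gr i ∧ (p : S.carrier) ^ (n * i) * (S.F ^ n) s = Hom.f j x :=
      ⟨s, i, hx, hs⟩
    rw [etaColimitMap, if_neg hn, dif_pos hex]
    obtain ⟨i', hx', hs'⟩ := hex.choose_spec
    generalize hex.choose = s' at hs' ⊢
    apply h.Fpow_injective n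
    -- The degree `i` is ambiguous only for `x = 0`, and then every candidate vanishes.
    by_cases hx0 : x = 0
    · have hj : Hom.f j x = 0 := by rw [hx0, map_zero]
      rw [hj, ← mul_zero ((p : S.carrier) ^ (n * i))] at hs
      rw [hj, ← mul_zero ((p : S.carrier) ^ (n * i'))] at hs'
      rw [cancel_p_pow h.torsionFree _ hs, cancel_p_pow h.torsionFree _ hs']
    · obtain rfl := DirectSum.degree_eq_of_mem_mem T.gr hx hx' hx0
      exact cancel_p_pow h.torsionFree _ (hs'.trans hs.symm)

theorem etaColimitMap_spec (h : IsSaturationMap j) {n i : ℕ} {x : T.carrier}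
    (hx : x ∈ T.etaIter n i) : x ∈ T.gr i ∧ etaColimitMap j n x ∈ S.gr i ∧
      (p : S.carrier) ^ (n * i) * (S.F ^ n) (etaColimitMap j n x) = Hom.f j x := by
  obtain ⟨y, hy, rfl, z, hz, hd⟩ := (mem_etaIter h.source_torsionFree).1 hx
  obtain ⟨s, hs⟩ := h.exists_of_d_eq n y z hd
  have hs' : (p : S.carrier) ^ (n * i) * (S.F ^ n) (S.pr i s) =
      Hom.f j ((p : T.carrier) ^ (n * i) * y) := by
    rw [Hom.f_p_pow_mul, ← pr_Fpow, hs, ← Hom.f_pr, pr_same hy]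
  have hmem := p_pow_mul_mem (n * i) hy
  refine ⟨hmem, ?_⟩
  rw [h.etaColimitMap_eq hmem hs']
  exact ⟨S.pr_mem _ _, hs'⟩

theorem isEtaColimit (h : IsSaturationMap j) : IsEtaColimit j (etaColimitMap j) where
  c_zero x := if_pos rfl
  c_mem n i x hx := (h.etaColimitMap_spec hx).2.1
  c_one n := h.etaColimitMap_eq (i := 0) SetLike.GradedOne.one_mem (by simp)
  c_add n i x hx y hy := by
    obtain ⟨hx, -, hx'⟩ := h.etaColimitMap_spec hx
    obtain ⟨hy, -, hy'⟩ := h.etaColimitMap_spec hy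
    exact h.etaColimitMap_eq (add_mem hx hy) (by rw [map_add, mul_add, hx', hy', map_add])
  c_mul n i i' x hx y hy := by
    obtain ⟨hx, -, hx'⟩ := h.etaColimitMap_spec hx
    obtain ⟨hy, -, hy'⟩ := h.etaColimitMap_spec hy
    refine h.etaColimitMap_eq (SetLike.mul_mem_graded hx hy) ?_
    rw [map_mul, map_mul, ← hx', ← hy', mul_add, pow_add, mul_assoc, mul_assoc,
      p_pow_comm (n * i') ((S.F ^ n) _)]
  c_d n i x hx := by
    obtain ⟨hx, -, hx'⟩ := h.etaColimitMap_spec hx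
    refine h.etaColimitMap_eq (T.d_mem i x hx) ?_
    rw [Hom.f_d, ← hx', d_p_pow_mul, d_Fpow, mul_add, mul_one, pow_add, mul_assoc]
  c_F n i x hx := by
    obtain ⟨hx, -, hx'⟩ := h.etaColimitMap_spec hx
    refine h.etaColimitMap_eq (T.F_mem i x hx) ?_
    rw [Hom.f_F, ← hx', map_mul, map_pow, map_natCast, ← Fpow_succ, Fpow_succ']
  c_phiF n i x hx := by
    obtain ⟨hx, -, hx'⟩ := h.etaColimitMap_spec hx
    refine h.etaColimitMap_eq (p_pow_mul_mem i (T.F_mem i x hx)) ?_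
    rw [phiF, Hom.f_p_pow_mul, Hom.f_F, ← hx', map_mul, map_pow, map_natCast, ← Fpow_succ, ← mul_assoc,
      ← pow_add]
    congr 2; ring
  surj i s hs := by
    obtain ⟨n, t, z, hz, hn⟩ := h.exists_Fpow_eq s
    refine ⟨n, (p : T.carrier) ^ (n * i) * T.pr i t, (mem_etaIter h.source_torsionFree).2
      ⟨_, T.pr_mem _ _, rfl, T.pr (i + 1) z, T.pr_mem _ _, ?_⟩,
      h.etaColimitMap_eq (p_pow_mul_mem _ (T.pr_mem _ _)) ?_⟩
    · rw [← pr_d, hz, pr_p_pow_mul]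
    · rw [Hom.f_p_pow_mul, Hom.f_pr, ← hn, pr_Fpow, pr_same hs]
  inj n i x hx y hy hxy := by
    obtain ⟨hx, -, hx'⟩ := h.etaColimitMap_spec hx
    obtain ⟨hy, -, hy'⟩ := h.etaColimitMap_spec hy
    obtain ⟨l, hl⟩ := h.exists_Fpow_eq_Fpow (t := x) (t' := y) (by rw [← hx', ← hy', hxy])
    exact ⟨l, by rw [phiF_iterate, phiF_iterate, hl]⟩
  bijective_ψ := h.bijective_ψ

end IsSaturationMap

end EtaColimit

end LogDieudonneAlg

/-! ### Construction of the `V`-completion by sequences of bounded degree -/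

namespace LogDieudonneAlg

variable {p : ℕ} {W N : Type u} [CommRing W] [CommMonoid N] {β : N →* W}

section Below

variable (A : LogDieudonneAlg p β)

/-- Truncation to degrees `< n`. -/
def trunc (n : ℕ) : A.carrier →+ A.carrier := ∑ i ∈ Finset.range n, A.pr i

/-- The elements of degree `< n`. -/
def below (n : ℕ) : AddSubgroup A.carrier where
  carrier := {x | ∀ i, n ≤ i → A.pr i x = 0}
  zero_mem' i _ := map_zero _
  add_mem' {x y} hx hy i hi := by rw [map_add, hx i hi, hy i hi, add_zero]
  neg_mem' {x} hx i hi := by rw [map_neg, hx i hi, neg_zero]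

variable {A}

theorem trunc_apply (n : ℕ) (x : A.carrier) :
    A.trunc n x = ∑ i ∈ Finset.range n, A.pr i x := by
  simp [trunc]

theorem mem_below_of_mem {i n : ℕ} (hi : i < n) {x : A.carrier} (hx : x ∈ A.gr i) :
    x ∈ A.below n :=
  fun _ hj => pr_ne hx (by omega)

theorem below_le {m n : ℕ} (hmn : m ≤ n) : A.below m ≤ A.below n :=
  fun _ hx i hi => hx i (hmn.trans hi)

theorem trunc_mem_below (n : ℕ) (x : A.carrier) : A.trunc n x ∈ A.below n := by
  rw [trunc_apply]
  exact sum_mem fun i hi => mem_below_of_mem (Finset.mem_range.1 hi) (A.pr_mem i x)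

theorem trunc_of_mem_below {n : ℕ} {x : A.carrier} (hx : x ∈ A.below n) : A.trunc n x = x := by
  apply ext_pr
  intro i
  by_cases hi : i < n
  · rw [trunc_apply, map_sum, Finset.sum_eq_single i, pr_same (A.pr_mem i x)]
    · exact fun j _ hj => pr_ne (A.pr_mem j x) hj
    · exact fun h => absurd (Finset.mem_range.2 hi) h
  · rw [hx i (by omega), A.trunc_mem_below n x i (by omega)]

theorem exists_mem_below (x : A.carrier) : ∃ n, x ∈ A.below n := by
  obtain ⟨n, hn⟩ := exists_sum_pr x
  exact ⟨n, by rw [hn, ← trunc_apply]; exact trunc_mem_below n x⟩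

theorem F_mem_below {n : ℕ} {x : A.carrier} (hx : x ∈ A.below n) : A.F x ∈ A.below n :=
  fun i hi => by rw [pr_F, hx i hi, map_zero]

theorem d_mem_below {n : ℕ} {x : A.carrier} (hx : x ∈ A.below n) : A.d x ∈ A.below (n + 1) := by
  intro i hi
  obtain ⟨i, rfl⟩ := Nat.exists_eq_add_of_le' (show 1 ≤ i by omega)
  rw [pr_d, hx i (by omega), map_zero]

theorem pr_mem_below {n : ℕ} (i : ℕ) {x : A.carrier} (hx : x ∈ A.below n) :
    A.pr i x ∈ A.below n := by
  by_cases hi : i < n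
  · exact mem_below_of_mem hi (A.pr_mem i x)
  · rw [hx i (by omega)]; exact zero_mem _

theorem mul_mem_below {m n : ℕ} {x y : A.carrier} (hx : x ∈ A.below m) (hy : y ∈ A.below n) :
    x * y ∈ A.below (m + n) := by
  rw [← trunc_of_mem_below hx, ← trunc_of_mem_below hy, trunc_apply, trunc_apply,
    Finset.sum_mul_sum]
  refine sum_mem fun i hi => sum_mem fun j hj => ?_
  rw [Finset.mem_range] at hi hj
  exact mem_below_of_mem (by omega) (SetLike.mul_mem_graded (A.pr_mem i x) (A.pr_mem j y))

theorem trunc_F (n : ℕ) (x : A.carrier) : A.trunc n (A.F x) = A.F (A.trunc n x) := by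
  simp only [trunc_apply, map_sum, pr_F]

theorem trunc_succ_d (n : ℕ) (x : A.carrier) : A.trunc (n + 1) (A.d x) = A.d (A.trunc n x) := by
  simp only [trunc_apply, map_sum, Finset.sum_range_succ', pr_d, pr_zero_d, add_zero]

theorem IsSaturated.trunc_Vpow (h : A.IsSaturated) (n r : ℕ) (x : A.carrier) :
    A.trunc n ((h.V ^ r) x) = (h.V ^ r) (A.trunc n x) := by
  simp only [trunc_apply, map_sum, h.pr_Vpow]

theorem IsSaturated.trunc_mem_Fil (h : A.IsSaturated) (n : ℕ) {r : ℕ} {x : A.carrier}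
    (hx : x ∈ h.Fil r) : A.trunc n x ∈ h.Fil r := by
  rw [trunc_apply]
  exact sum_mem fun i _ => h.pr_mem_Fil i hx

theorem IsSaturated.Vpow_mem_below (h : A.IsSaturated) {n : ℕ} (r : ℕ) {x : A.carrier}
    (hx : x ∈ A.below n) : (h.V ^ r) x ∈ A.below n :=
  fun i hi => by rw [h.pr_Vpow, hx i hi, map_zero]

theorem Hom.f_mem_below {B : LogDieudonneAlg p β} (g : Hom A B) {n : ℕ} {x : A.carrier}
    (hx : x ∈ A.below n) : g.f x ∈ B.below n :=
  fun i hi => by rw [← g.f_pr, hx i hi, map_zero]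

end Below

namespace IsSaturated

variable {A : LogDieudonneAlg p β} (h : A.IsSaturated)

/-- The two-sided ideal `Fil^r`. -/
def filIdeal (r : ℕ) : Ideal A.carrier :=
  { h.Fil r with smul_mem' := fun c _ hx => h.mul_mem_Fil c hx }

instance (r : ℕ) : (h.filIdeal r).IsTwoSided := ⟨fun b hx => h.mem_Fil_mul b hx⟩

/-- The ring `W_r(A)`. -/
abbrev Quo (r : ℕ) : Type u := A.carrier ⧸ h.filIdeal r

/-- The projection to `W_r(A)`. -/
abbrev quoMk (r : ℕ) : A.carrier →+* h.Quo r := Ideal.Quotient.mk (h.filIdeal r)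

theorem quoMk_eq {r : ℕ} {x y : A.carrier} : h.quoMk r x = h.quoMk r y ↔ x - y ∈ h.Fil r :=
  Ideal.Quotient.eq

/-- A sequence of bounded degree, compatible modulo the filtration. -/
structure IsCauchy (a : ℕ → A.carrier) : Prop where
  sub_mem : ∀ r, a (r + 1) - a r ∈ h.Fil r
  bounded : ∃ n, ∀ r, a r ∈ A.below n

namespace IsCauchy

variable {h} {a b : ℕ → A.carrier}

theorem const (h : A.IsSaturated) (x : A.carrier) : h.IsCauchy fun _ => x where
  sub_mem r := by rw [sub_self]; exact zero_mem _
  bounded := by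
    obtain ⟨n, hn⟩ := exists_mem_below x
    exact ⟨n, fun _ => hn⟩

theorem add (ha : h.IsCauchy a) (hb : h.IsCauchy b) : h.IsCauchy (a + b) where
  sub_mem r := by
    rw [Pi.add_apply, Pi.add_apply, add_sub_add_comm]
    exact add_mem (ha.sub_mem r) (hb.sub_mem r)
  bounded := by
    obtain ⟨n, hn⟩ := ha.bounded
    obtain ⟨m, hm⟩ := hb.bounded
    exact ⟨max n m, fun r =>
      add_mem (below_le (le_max_left _ _) (hn r)) (below_le (le_max_right _ _) (hm r))⟩

theorem mul (ha : h.IsCauchy a) (hb : h.IsCauchy b) : h.IsCauchy (a * b) where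
  sub_mem r := by
    have : (a * b) (r + 1) - (a * b) r =
        a (r + 1) * (b (r + 1) - b r) + (a (r + 1) - a r) * b r := by
      simp only [Pi.mul_apply]; noncomm_ring
    rw [this]
    exact add_mem (h.mul_mem_Fil _ (hb.sub_mem r)) (h.mem_Fil_mul _ (ha.sub_mem r))
  bounded := by
    obtain ⟨n, hn⟩ := ha.bounded
    obtain ⟨m, hm⟩ := hb.bounded
    exact ⟨n + m, fun r => mul_mem_below (hn r) (hm r)⟩

theorem pow (ha : h.IsCauchy a) (n : ℕ) : h.IsCauchy (fun r => a r ^ n) := by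
  induction n with
  | zero => simpa only [pow_zero] using const h 1
  | succ n ih =>
    simp only [pow_succ]
    exact ih.mul ha

theorem map_d (ha : h.IsCauchy a) : h.IsCauchy (fun r => A.d (a r)) where
  sub_mem r := by rw [← map_sub]; exact h.d_mem_Fil (ha.sub_mem r)
  bounded := by
    obtain ⟨n, hn⟩ := ha.bounded
    exact ⟨n + 1, fun r => d_mem_below (hn r)⟩

/-- `F` maps `Fil^(r+1)` only to `Fil^r`, hence the shift of index. -/
theorem map_F (ha : h.IsCauchy a) : h.IsCauchy (fun r => A.F (a (r + 1))) where
  sub_mem r := by rw [← map_sub]; exact h.F_mem_Fil (ha.sub_mem (r + 1))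
  bounded := by
    obtain ⟨n, hn⟩ := ha.bounded
    exact ⟨n, fun r => F_mem_below (hn _)⟩

theorem map_pr (i : ℕ) (ha : h.IsCauchy a) : h.IsCauchy (fun r => A.pr i (a r)) where
  sub_mem r := by rw [← map_sub]; exact h.pr_mem_Fil i (ha.sub_mem r)
  bounded := by
    obtain ⟨n, hn⟩ := ha.bounded
    exact ⟨n, fun r => pr_mem_below i (hn r)⟩

theorem map_Vpow (k : ℕ) (ha : h.IsCauchy a) : h.IsCauchy (fun r => (h.V ^ k) (a r)) where
  sub_mem r := by
    rw [← map_sub]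
    induction k with
    | zero => exact ha.sub_mem r
    | succ k ih =>
      rw [h.Vpow_succ]
      exact h.Fil_succ_le r (h.V_mem_Fil ih)
  bounded := by
    obtain ⟨n, hn⟩ := ha.bounded
    exact ⟨n, fun r => h.Vpow_mem_below k (hn r)⟩

theorem sub_mem_Fil (ha : h.IsCauchy a) (r k : ℕ) : a (r + k) - a r ∈ h.Fil r := by
  induction k with
  | zero => rw [add_zero, sub_self]; exact zero_mem _
  | succ k ih =>
    have := add_mem (h.Fil_le (Nat.le_add_right r k) (ha.sub_mem (r + k))) ih
    rwa [sub_add_sub_cancel] at this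

end IsCauchy

/-- The underlying algebra of the `V`-completion. -/
def complSubalgebra : Subalgebra W (∀ r, h.Quo r) where
  carrier := {x | ∃ a, h.IsCauchy a ∧ (fun r => h.quoMk r (a r)) = x}
  mul_mem' := by
    rintro _ _ ⟨a, ha, rfl⟩ ⟨b, hb, rfl⟩
    exact ⟨_, ha.mul hb, rfl⟩
  add_mem' := by
    rintro _ _ ⟨a, ha, rfl⟩ ⟨b, hb, rfl⟩
    exact ⟨_, ha.add hb, rfl⟩
  algebraMap_mem' w := ⟨_, IsCauchy.const h (algebraMap W A.carrier w), rfl⟩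

/-- The element of the completion given by a compatible sequence. -/
def IsCauchy.elt {h : A.IsSaturated} {a : ℕ → A.carrier} (ha : h.IsCauchy a) : h.complSubalgebra :=
  ⟨fun r => h.quoMk r (a r), a, ha, rfl⟩

variable {h}

theorem compl_ind {P : h.complSubalgebra → Prop} (x : h.complSubalgebra)
    (elt : ∀ a, ∀ ha : h.IsCauchy a, P ha.elt) : P x := by
  obtain ⟨_, a, ha, rfl⟩ := x
  exact elt a ha

theorem IsCauchy.elt_eq_elt {a b : ℕ → A.carrier} {ha : h.IsCauchy a} {hb : h.IsCauchy b} :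
    ha.elt = hb.elt ↔ ∀ r, a r - b r ∈ h.Fil r := by
  refine Subtype.ext_iff.trans (funext_iff.trans ?_)
  exact forall_congr' fun r => h.quoMk_eq

theorem IsCauchy.elt_eq_zero {a : ℕ → A.carrier} {ha : h.IsCauchy a} :
    ha.elt = 0 ↔ ∀ r, a r ∈ h.Fil r := by
  refine Subtype.ext_iff.trans (funext_iff.trans ?_)
  exact forall_congr' fun r => Ideal.Quotient.eq_zero_iff_mem

variable (h)

/-- The constant sequences. -/
def toCompl : A.carrier →ₐ[W] h.complSubalgebra where
  toFun x := (IsCauchy.const h x).elt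
  map_one' := rfl
  map_mul' _ _ := rfl
  map_zero' := rfl
  map_add' _ _ := rfl
  commutes' _ := rfl

/-- The grading of the completion. -/
def complGr (i : ℕ) : Submodule W h.complSubalgebra where
  carrier := {x | ∃ a, ∃ ha : h.IsCauchy a, (∀ r, a r ∈ A.gr i) ∧ ha.elt = x}
  add_mem' := by
    rintro _ _ ⟨a, ha, hai, rfl⟩ ⟨b, hb, hbi, rfl⟩
    exact ⟨_, ha.add hb, fun r => add_mem (hai r) (hbi r), rfl⟩
  zero_mem' := ⟨_, IsCauchy.const h 0, fun _ => zero_mem _, rfl⟩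
  smul_mem' := by
    rintro w _ ⟨a, ha, hai, rfl⟩
    refine ⟨_, (IsCauchy.const h (algebraMap W A.carrier w)).mul ha, fun r => ?_, ?_⟩
    · rw [Pi.mul_apply, ← Algebra.smul_def]
      exact Submodule.smul_mem _ _ (hai r)
    · rw [Algebra.smul_def]; rfl

/-- The projections of the completion. -/
def complPr (i : ℕ) : h.complSubalgebra →+ h.complSubalgebra where
  toFun x := ⟨fun r => QuotientAddGroup.map (h.filIdeal r).toAddSubgroup
      (h.filIdeal r).toAddSubgroup (A.pr i) (fun _ hx => h.pr_mem_Fil i hx) (x.1 r), by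
    obtain ⟨_, a, ha, rfl⟩ := x
    exact ⟨_, ha.map_pr i, rfl⟩⟩
  map_zero' := Subtype.ext (funext fun r => map_zero _)
  map_add' x y := Subtype.ext (funext fun r => map_add _ _ _)

instance : Nonempty (GradedAlgebra h.complGr) := by
  refine nonempty_gradedAlgebra_of_proj _
    ⟨_, IsCauchy.const h 1, fun _ => SetLike.GradedOne.one_mem, rfl⟩ ?_ h.complPr ?_ ?_ ?_ ?_
  · rintro i j _ ⟨a, ha, hai, rfl⟩ _ ⟨b, hb, hbj, rfl⟩
    exact ⟨_, ha.mul hb, fun r => SetLike.mul_mem_graded (hai r) (hbj r), rfl⟩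
  · intro i x
    induction x using compl_ind with
    | elt a ha => exact ⟨_, ha.map_pr i, fun r => A.pr_mem _ _, rfl⟩
  · rintro i _ ⟨a, ha, hai, rfl⟩
    exact Subtype.ext (funext fun r => congrArg (h.quoMk r) (pr_same (hai r)))
  · rintro i j hij _ ⟨a, ha, hai, rfl⟩
    exact Subtype.ext (funext fun r => congrArg (h.quoMk r) (pr_ne (hai r) hij))
  · intro x
    induction x using compl_ind with
    | elt a ha =>
      obtain ⟨n, hn⟩ := ha.bounded
      refine ⟨n, Subtype.ext (funext fun r => ?_)⟩
      rw [AddSubmonoidClass.coe_finsetSum, Finset.sum_apply]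
      change h.quoMk r (a r) = ∑ i ∈ Finset.range n, h.quoMk r (A.pr i (a r))
      rw [← map_sum, ← trunc_apply, trunc_of_mem_below (hn r)]

instance : GradedAlgebra h.complGr := Nonempty.some inferInstance

/-- The differential of the completion. -/
def complD : h.complSubalgebra →ₗ[W] h.complSubalgebra where
  toFun x := ⟨fun r => QuotientAddGroup.map (h.filIdeal r).toAddSubgroup
      (h.filIdeal r).toAddSubgroup A.d.toAddMonoidHom (fun _ hx => h.d_mem_Fil hx) (x.1 r), by
    obtain ⟨_, a, ha, rfl⟩ := x
    exact ⟨_, ha.map_d, rfl⟩⟩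
  map_add' x y := Subtype.ext (funext fun r => map_add _ _ _)
  map_smul' w x := by
    induction x using compl_ind with
    | elt a ha =>
      exact Subtype.ext (funext fun r => congrArg (h.quoMk r) (A.d.map_smul w (a r)))

/-- The Frobenius of the completion. -/
def complF : h.complSubalgebra →+* h.complSubalgebra where
  toFun x := ⟨fun r => Ideal.Quotient.lift (h.filIdeal (r + 1)) ((h.quoMk r).comp A.F)
      (fun _ hx => Ideal.Quotient.eq_zero_iff_mem.2 (h.F_mem_Fil hx)) (x.1 (r + 1)), by
    obtain ⟨_, a, ha, rfl⟩ := x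
    exact ⟨_, ha.map_F, rfl⟩⟩
  map_one' := Subtype.ext (funext fun r => map_one _)
  map_mul' x y := Subtype.ext (funext fun r => map_mul _ _ _)
  map_zero' := Subtype.ext (funext fun r => map_zero _)
  map_add' x y := Subtype.ext (funext fun r => map_add _ _ _)

theorem complF_elt {a : ℕ → A.carrier} (ha : h.IsCauchy a) :
    h.complF ha.elt = ha.map_F.elt := rfl

/-- The quotients `b r = (F (a r) - a r ^ p) / p` are chosen termwise. Comparing consecutive ones
costs one step of the filtration for `F` and one for division by `p`, so `b` is read at index `r +
2`. -/
theorem complF_frob (a : h.complSubalgebra) (ha : a ∈ h.complGr 0) :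
    ∃ b ∈ h.complGr 0, h.complF a = a ^ p + (p : h.complSubalgebra) * b := by
  obtain ⟨a, ha, ha0, rfl⟩ := ha
  choose b hb hab using fun r => A.F_frob _ (ha0 r)
  have hp : h.IsCauchy fun r => a r ^ p := ha.pow p
  have hp' : hp.elt = ha.elt ^ p := Subtype.ext (funext fun r => map_pow (h.quoMk r) (a r) p)
  have hbc : h.IsCauchy fun r => b (r + 2) := by
    refine ⟨fun r => ?_, 1, fun r => mem_below_of_mem one_pos (hb _)⟩
    apply h.mem_Fil_of_p_mul_mem
    rw [mul_sub, eq_sub_iff_add_eq'.2 (hab (r + 2)).symm,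
      eq_sub_iff_add_eq'.2 (hab (r + 1 + 2)).symm, sub_sub_sub_comm]
    refine sub_mem ?_ ?_
    · rw [← map_sub]
      exact h.F_mem_Fil (ha.sub_mem (r + 2))
    · exact h.Fil_le (by omega) (hp.sub_mem (r + 2))
  refine ⟨hbc.elt, ⟨_, hbc, fun r => hb _, rfl⟩, ?_⟩
  rw [← hp', complF_elt]
  refine Subtype.ext (funext fun r => ?_)
  change h.quoMk r (A.F (a (r + 1))) = h.quoMk r (a r ^ p) + (p : h.Quo r) * h.quoMk r (b (r + 2))
  rw [← map_natCast (h.quoMk r), ← map_mul, ← map_add, quoMk_eq]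
  have h1 : A.F (a (r + 1 + 1)) - A.F (a (r + 1)) ∈ h.Fil r := by
    rw [← map_sub]
    exact h.F_mem_Fil (ha.sub_mem (r + 1))
  have h2 : a (r + 2) ^ p - a r ^ p ∈ h.Fil r := hp.sub_mem_Fil r 2
  have h3 := sub_mem h2 h1
  have h4 := hab (r + 2)
  rw [show r + 1 + 1 = r + 2 from rfl, h4] at h3
  convert h3 using 1
  abel

/-- The `V`-completion of a saturated log Dieudonné algebra. -/
def completion : LogDieudonneAlg p β where
  carrier := h.complSubalgebra
  gr := h.complGr
  graded_comm := by
    rintro i j _ ⟨a, ha, hai, rfl⟩ _ ⟨b, hb, hbj, rfl⟩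
    refine Subtype.ext (funext fun r => ?_)
    exact (congrArg (h.quoMk r) (A.graded_comm i j _ (hai r) _ (hbj r))).trans (by simp; rfl)
  sq_odd := by
    rintro i hi _ ⟨a, ha, hai, rfl⟩
    exact Subtype.ext (funext fun r => congrArg (h.quoMk r) (A.sq_odd i hi _ (hai r)))
  d := h.complD
  d_mem := by
    rintro i _ ⟨a, ha, hai, rfl⟩
    exact ⟨_, ha.map_d, fun r => A.d_mem i _ (hai r), rfl⟩
  d_mul := by
    rintro i _ ⟨a, ha, hai, rfl⟩ b
    induction b using compl_ind with
    | elt b hb =>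
      refine Subtype.ext (funext fun r => ?_)
      exact (congrArg (h.quoMk r) (A.d_mul i _ (hai r) (b r))).trans (by simp; rfl)
  d_d a := by
    induction a using compl_ind with
    | elt a ha => exact Subtype.ext (funext fun r => congrArg (h.quoMk r) (A.d_d (a r)))
  F := h.complF
  F_mem := by
    rintro i _ ⟨a, ha, hai, rfl⟩
    exact ⟨_, ha.map_F, fun r => A.F_mem i _ (hai _), rfl⟩
  F_frob := h.complF_frob
  d_F a := by
    induction a using compl_ind with
    | elt a ha =>
      refine Subtype.ext (funext fun r => ?_)
      exact (congrArg (h.quoMk r) (A.d_F (a (r + 1)))).trans (by simp; rfl)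
  L := A.L
  α := (h.toCompl : A.carrier →* h.complSubalgebra).comp A.α
  α_mem m := ⟨_, IsCauchy.const h (A.α m), fun _ => A.α_mem m, rfl⟩
  ι := A.ι
  α_ι n := (congrArg h.toCompl (A.α_ι n)).trans (h.toCompl.commutes _)
  δ m := h.toCompl (A.δ m)
  δ_mem m := ⟨_, IsCauchy.const h (A.δ m), fun _ => A.δ_mem m, rfl⟩
  δ_one := by rw [A.δ_one, map_zero]
  δ_mul m n := by rw [A.δ_mul, map_add]
  d_α m := (congrArg h.toCompl (A.d_α m)).trans (map_mul _ _ _)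
  δ_ι n := by rw [A.δ_ι, map_zero]
  d_δ m := (congrArg h.toCompl (A.d_δ m)).trans (map_zero _)
  FL := A.FL
  δ_FL m := (congrArg h.toCompl (A.δ_FL m)).trans (by rw [map_mul, map_natCast]; rfl)
  F_α m := congrArg h.toCompl (A.F_α m)

/-- The morphism from a saturated log Dieudonné algebra to its `V`-completion. -/
def toCompletion : A ⟶ h.completion :=
  Hom.mk h.toCompl (fun _ a ha => ⟨_, IsCauchy.const h a, fun _ => ha, rfl⟩)
    (fun _ => rfl) (fun _ => rfl) (MonoidHom.id A.L)
    (fun _ => rfl) (fun _ => rfl) (fun _ => rfl) (fun _ => rfl)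

end IsSaturated

end LogDieudonneAlg

/-! ### Strictness and universal property of the `V`-completion -/

namespace LogDieudonneAlg

variable {p : ℕ} {W N : Type u} [CommRing W] [CommMonoid N] {β : N →* W}

namespace IsSaturated

variable {A : LogDieudonneAlg p β} (h : A.IsSaturated)

variable {h} in
/-- The limit in the completion of a compatible sequence. -/
def IsCauchy.lim {a : ℕ → A.carrier} (ha : h.IsCauchy a) : h.completion.carrier := ha.elt

variable {h} in
theorem completion_ind {P : h.completion.carrier → Prop} (x : h.completion.carrier)
    (lim : ∀ a, ∀ ha : h.IsCauchy a, P ha.lim) : P x :=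
  compl_ind x lim

namespace IsCauchy

variable {h} {a b : ℕ → A.carrier}

theorem sub (ha : h.IsCauchy a) (hb : h.IsCauchy b) : h.IsCauchy (a - b) where
  sub_mem r := by
    rw [Pi.sub_apply, Pi.sub_apply, sub_sub_sub_comm]
    exact _root_.sub_mem (ha.sub_mem r) (hb.sub_mem r)
  bounded := by
    obtain ⟨n, hn⟩ := ha.bounded
    obtain ⟨m, hm⟩ := hb.bounded
    exact ⟨max n m, fun r =>
      _root_.sub_mem (below_le (le_max_left _ _) (hn r)) (below_le (le_max_right _ _) (hm r))⟩

theorem lim_eq_lim {ha : h.IsCauchy a} {hb : h.IsCauchy b} :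
    ha.lim = hb.lim ↔ ∀ r, a r - b r ∈ h.Fil r := elt_eq_elt

theorem lim_eq_zero {ha : h.IsCauchy a} : ha.lim = 0 ↔ ∀ r, a r ∈ h.Fil r := elt_eq_zero

theorem lim_add (ha : h.IsCauchy a) (hb : h.IsCauchy b) : (ha.add hb).lim = ha.lim + hb.lim := rfl

theorem lim_sub (ha : h.IsCauchy a) (hb : h.IsCauchy b) : (ha.sub hb).lim = ha.lim - hb.lim := by
  rw [eq_sub_iff_add_eq, ← lim_add]
  refine lim_eq_lim.2 fun r => ?_
  rw [Pi.add_apply, Pi.sub_apply, sub_add_cancel, sub_self]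
  exact zero_mem _

theorem lim_const (x : A.carrier) : (const h x).lim = Hom.f h.toCompletion x := rfl

theorem natCast_mul_lim (ha : h.IsCauchy a) :
    (p : h.completion.carrier) * ha.lim = ((const h (p : A.carrier)).mul ha).lim := by
  rw [← map_natCast (Hom.f h.toCompletion) p]; rfl

end IsCauchy

/-- Cancellation of `p`, injectivity of `F` and existence of `F`-preimages hold in `A` modulo the
filtration with bounded loss, which disappears in the limit. -/
theorem isSaturated_completion : h.completion.IsSaturated := by
  refine isSaturated_of_exists_F_eq (fun x => ?_) ?_ fun y z => ?_
  · induction x using completion_ind with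
    | lim a ha =>
      intro hx
      have hx' := ha.natCast_mul_lim.symm.trans hx
      replace hx' := IsCauchy.lim_eq_zero.1 hx'
      refine IsCauchy.lim_eq_zero.2 fun r => ?_
      have := sub_mem (h.mem_Fil_of_p_mul_mem (hx' (r + 1))) (ha.sub_mem r)
      rwa [sub_sub_cancel] at this
  · refine (injective_iff_map_eq_zero h.completion.F).2 fun x => ?_
    induction x using completion_ind with
    | lim a ha =>
      intro hx
      have hx' : ha.map_F.lim = 0 := hx
      replace hx' := IsCauchy.lim_eq_zero.1 hx'
      refine IsCauchy.lim_eq_zero.2 fun r => ?_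
      have := sub_mem (h.mem_Fil_of_F_mem (hx' r)) (ha.sub_mem r)
      rwa [sub_sub_cancel] at this
  · induction y using completion_ind with | lim a ha
    induction z using completion_ind with | lim b hb
    intro hyz
    have hyz' : ha.map_d.lim = ((IsCauchy.const h (p : A.carrier)).mul hb).lim :=
      hyz.trans hb.natCast_mul_lim
    replace hyz' := IsCauchy.lim_eq_lim.1 hyz'
    obtain ⟨n, hn⟩ := ha.bounded
    -- Approximate preimages of `a (r + 1)` under `F`, truncated to keep their degrees bounded. They
    -- form a compatible sequence because `F (z (r+1) - z r)` lies in the filtration and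
    -- `mem_Fil_of_F_mem` applies.
    have hz : ∀ r, ∃ z ∈ A.below n, a (r + 1) - A.F z ∈ h.Fil (r + 1) := fun r => by
      obtain ⟨z, hz⟩ := h.exists_sub_F_mem_Fil (hyz' (r + 1))
      refine ⟨A.trunc n z, trunc_mem_below n z, ?_⟩
      rw [← trunc_F, ← trunc_of_mem_below (hn (r + 1)), ← map_sub]
      exact h.trunc_mem_Fil n hz
    choose z hzn hz using hz
    have hzc : h.IsCauchy z := by
      refine ⟨fun r => h.mem_Fil_of_F_mem (h.Fil_succ_le r ?_), n, hzn⟩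
      have := sub_mem (add_mem (hz r) (ha.sub_mem (r + 1))) (h.Fil_succ_le _ (hz (r + 1)))
      rw [map_sub]
      convert this using 1
      abel
    refine ⟨hzc.lim, (IsCauchy.lim_eq_lim (ha := hzc.map_F) (hb := ha)).2 fun r => ?_⟩
    have := sub_mem (ha.sub_mem_Fil r 2) (h.Fil_le (by omega) (hz (r + 1)))
    convert this using 1
    abel

/-- `V` is characterised by `F V = p`. The termwise `V` satisfies this up to the shift in `F`, which
changes a compatible sequence only within the filtration. -/
theorem V_lim {a : ℕ → A.carrier} (ha : h.IsCauchy a) (k : ℕ) :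
    (h.isSaturated_completion.V ^ k) ha.lim = (ha.map_Vpow k).lim := by
  induction k with
  | zero => rfl
  | succ k ih =>
    rw [h.isSaturated_completion.Vpow_succ, ih]
    symm
    apply h.isSaturated_completion.eq_V_of_F_eq
    refine Eq.trans (b := (ha.map_Vpow (k + 1)).map_F.lim) rfl
      (Eq.trans ?_ (ha.map_Vpow k).natCast_mul_lim.symm)
    refine IsCauchy.lim_eq_lim.2 fun r => ?_
    rw [h.Vpow_succ, h.F_V, Pi.mul_apply, ← mul_sub]
    exact h.mul_mem_Fil _ ((ha.map_Vpow k).sub_mem r)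

/-- Truncating a representation of `x` leaves `x` unchanged. Since `d` raises degrees, the cut-off
for `a` is one above that for `b`. -/
theorem exists_of_mem_Fil_of_mem_below {r n : ℕ} {x : A.carrier} (hx : x ∈ h.Fil r)
    (hn : x ∈ A.below n) : ∃ a ∈ A.below (n + 1), ∃ b ∈ A.below (n + 1),
      x = (h.V ^ r) a + A.d ((h.V ^ r) b) := by
  obtain ⟨a, b, rfl⟩ := h.mem_Fil.1 hx
  refine ⟨A.trunc (n + 1) a, trunc_mem_below _ _, A.trunc n b,
    below_le n.le_succ (trunc_mem_below _ _), ?_⟩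
  rw [← h.trunc_Vpow, ← h.trunc_Vpow, ← trunc_succ_d, ← map_add,
    trunc_of_mem_below (below_le n.le_succ hn)]

theorem isCauchy_sum {n : ℕ} (x : A.carrier) (hx : x ∈ A.below n) (u : ℕ → A.carrier)
    (hu : ∀ m, u m ∈ A.below n) :
    h.IsCauchy fun m => x + ∑ i ∈ Finset.range m, (h.V ^ i) (u i) where
  sub_mem m := by
    rw [Finset.sum_range_succ, add_sub_add_left_eq_sub, add_sub_cancel_left]
    exact h.Vpow_mem_Fil m _
  bounded := ⟨n, fun m => add_mem hx (sum_mem fun i _ => h.Vpow_mem_below i (hu i))⟩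

/-- For the converse, write `a s = V^s x + d V^s y` and the later differences `a (s+m+1) - a (s+m)`
as `V^(s+m) u_m + d V^(s+m) v_m`. The series `x + Σ V^i u_i` and `y + Σ V^i v_i` converge, and
applying `V^s` and `d V^s` to them makes the differences telescope to the limit of `a`. -/
theorem lim_mem_Fil_iff {a : ℕ → A.carrier} {ha : h.IsCauchy a} {s : ℕ} :
    ha.lim ∈ h.isSaturated_completion.Fil s ↔ a s ∈ h.Fil s := by
  constructor
  · intro hs
    obtain ⟨x, y, hxy⟩ := h.isSaturated_completion.mem_Fil.1 hs
    induction x using completion_ind with | lim u hu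
    induction y using completion_ind with | lim v hv
    rw [V_lim, V_lim] at hxy
    have hxy' : ha.lim = ((hu.map_Vpow s).add (hv.map_Vpow s).map_d).lim := hxy
    have := add_mem (IsCauchy.lim_eq_lim.1 hxy' s)
      (add_mem (h.Vpow_mem_Fil s (u s)) (h.d_Vpow_mem_Fil s (v s)))
    rwa [Pi.add_apply, sub_add_cancel] at this
  · intro hs
    obtain ⟨n, hn⟩ := ha.bounded
    obtain ⟨x, hx, y, hy, hxy⟩ := h.exists_of_mem_Fil_of_mem_below hs (hn s)
    choose u hu v hv huv using fun m =>
      h.exists_of_mem_Fil_of_mem_below (ha.sub_mem (s + m)) (sub_mem (hn (s + m + 1)) (hn (s + m)))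
    have hU := h.isCauchy_sum x hx u hu
    have hV := h.isCauchy_sum y hy v hv
    refine h.isSaturated_completion.mem_Fil.2 ⟨hU.lim, hV.lim, ?_⟩
    rw [V_lim, V_lim]
    refine Eq.trans ?_ (Eq.refl ((hU.map_Vpow s).add (hV.map_Vpow s).map_d).lim)
    refine IsCauchy.lim_eq_lim.2 fun r => ?_
    have key : ∀ m, (h.V ^ s) (x + ∑ i ∈ Finset.range m, (h.V ^ i) (u i)) +
        A.d ((h.V ^ s) (y + ∑ i ∈ Finset.range m, (h.V ^ i) (v i))) = a (s + m) := by
      intro m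
      induction m with
      | zero => simpa using hxy.symm
      | succ m ih =>
        have h1 : ∀ z, (h.V ^ s) ((h.V ^ m) z) = (h.V ^ (s + m)) z := fun z => by
          rw [pow_add]; rfl
        have h2 := huv m
        rw [← ih, sub_eq_iff_eq_add] at h2
        rw [← add_assoc s, h2, Finset.sum_range_succ, Finset.sum_range_succ]
        simp only [map_add, h1]
        abel
    rw [Pi.add_apply, key, ← neg_mem_iff, neg_sub, add_comm s r]
    exact ha.sub_mem_Fil r s

/-- By `lim_mem_Fil_iff` completing does not change the quotients `W_r`, so a compatible sequence of
limits converges to its diagonal. -/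
theorem isStrict_completion : h.completion.IsStrict := by
  refine ⟨h.isSaturated_completion, fun i => ⟨fun x hx => ⟨fun r => ⟨x, hx, rfl⟩, fun r => rfl⟩,
    fun x _ y _ hxy => ?_, ?_⟩⟩
  · rw [← sub_eq_zero]
    have : ∀ r, x - y ∈ h.isSaturated_completion.Fil r := fun r => by
      rw [← neg_mem_iff, neg_sub, sub_eq_neg_add]
      exact QuotientAddGroup.eq.1 (congrFun hxy r)
    generalize x - y = z at this
    induction z using completion_ind with
    | lim a ha => exact IsCauchy.lim_eq_zero.2 fun r => h.lim_mem_Fil_iff.1 (this r)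
  · rintro s ⟨hs, hres⟩
    choose c hc hsc using hs
    choose a ha hai hac using hc
    replace hac : ∀ r, (ha r).lim = c r := hac
    have hca : ∀ r, a (r + 1) r - a r r ∈ h.Fil r := fun r => by
      refine h.lim_mem_Fil_iff (ha := (ha (r + 1)).sub (ha r)).1 ?_
      rw [(ha (r + 1)).lim_sub (ha r), hac, hac, sub_eq_neg_add]
      apply QuotientAddGroup.eq.1
      have := hres r
      rw [hsc, hsc] at this
      exact this.symm
    have hb : h.IsCauchy fun r => a r r := by
      refine ⟨fun r => ?_, i + 1, fun r => mem_below_of_mem i.lt_succ_self (hai r r)⟩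
      have := add_mem ((ha (r + 1)).sub_mem r) (hca r)
      rwa [sub_add_sub_cancel] at this
    refine ⟨hb.lim, ⟨_, hb, fun r => hai r r, rfl⟩, funext fun r => ?_⟩
    rw [hsc]
    refine QuotientAddGroup.eq.2 ?_
    rw [← hac, ← sub_eq_neg_add, ← IsCauchy.lim_sub, lim_mem_Fil_iff, Pi.sub_apply, sub_self]
    exact zero_mem _

/-- The identification of the completion with the limit of the `W_r(A)`. -/
def complToWr : h.completion.carrier →+ ∀ r, h.Wr r where
  toFun x r := (show h.complSubalgebra from x).1 r
  map_zero' := rfl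
  map_add' _ _ := rfl

theorem isVCompletionVia_toCompletion : IsVCompletionVia h h.toCompletion h.complToWr where
  bijOn i := by
    refine ⟨?_, fun x _ y _ hxy => Subtype.ext hxy, ?_⟩
    · rintro _ ⟨a, ha, hai, rfl⟩
      refine ⟨fun r => ⟨a r, hai r, rfl⟩, fun r => ?_⟩
      exact h.quoMk_eq.2 (ha.sub_mem r)
    · rintro s ⟨hs, hres⟩
      choose a hai hsa using hs
      have ha : h.IsCauchy a := by
        refine ⟨fun r => ?_, i + 1, fun r => mem_below_of_mem i.lt_succ_self (hai r)⟩
        have := hres r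
        rw [hsa, hsa] at this
        exact h.quoMk_eq.1 this
      exact ⟨ha.lim, ⟨a, ha, hai, rfl⟩, funext fun r => (hsa r).symm⟩
  π_ρ x := rfl
  π_mul r x y a b hx hy := by
    change (show h.complSubalgebra from x).1 r = h.quoMk r a at hx
    change (show h.complSubalgebra from y).1 r = h.quoMk r b at hy
    change (show h.complSubalgebra from x).1 r * (show h.complSubalgebra from y).1 r =
      h.quoMk r (a * b)
    rw [hx, hy, map_mul]
  π_d r x b hx := by
    induction x using completion_ind with
    | lim a ha =>
      have := h.d_mem_Fil (h.quoMk_eq.1 hx)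
      rw [map_sub] at this
      exact h.quoMk_eq.2 this
  π_F r x b hx := by
    induction x using completion_ind with
    | lim a ha =>
      have := h.F_mem_Fil (h.quoMk_eq.1 hx)
      rw [map_sub] at this
      exact h.quoMk_eq.2 this
  bijective_ψ := Function.bijective_id

theorem isVCompletion_toCompletion : IsVCompletion h.toCompletion :=
  ⟨h, _, h.isVCompletionVia_toCompletion⟩

theorem lim_sub_mem_Fil {a : ℕ → A.carrier} (ha : h.IsCauchy a) (r : ℕ) :
    ha.lim - Hom.f h.toCompletion (a r) ∈ h.isSaturated_completion.Fil r := by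
  rw [← IsCauchy.lim_const, ← IsCauchy.lim_sub, lim_mem_Fil_iff, Pi.sub_apply, sub_self]
  exact zero_mem _

theorem completion_hom_ext {B : LogDieudonneAlg p β} (hB : B.IsStrict)
    {g g' : h.completion ⟶ B} (hg : h.toCompletion ≫ g = h.toCompletion ≫ g') : g = g' := by
  have hf : ∀ x, Hom.f g (Hom.f h.toCompletion x) = Hom.f g' (Hom.f h.toCompletion x) := fun x =>
    congrArg (fun q => Hom.f q x) hg
  refine Hom.ext (AlgHom.ext fun x => ?_) (congrArg (fun q : A ⟶ B => Hom.ψ q) hg :)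
  induction x using completion_ind with
  | lim a ha =>
    refine hB.eq_of_sub_mem fun r => ?_
    have h1 := Hom.f_mem_Fil g h.isSaturated_completion hB.isSaturated (h.lim_sub_mem_Fil ha r)
    have h2 := Hom.f_mem_Fil g' h.isSaturated_completion hB.isSaturated (h.lim_sub_mem_Fil ha r)
    have h3 := sub_mem h1 h2
    rw [map_sub, map_sub, hf, sub_sub_sub_cancel_right] at h3
    exact h3

/-- The image of the limit of `a` is the limit in `B` of `g (a r)`. Since `B` is separated, that
limit is unique, and each required identity is checked modulo every `Fil^r`. -/
theorem completion_exists_lift {B : LogDieudonneAlg p β} (hB : B.IsStrict) (g : A ⟶ B) :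
    ∃ g' : h.completion ⟶ B, h.toCompletion ≫ g' = g := by
  have hFil : ∀ {r x}, x ∈ h.Fil r → Hom.f g x ∈ hB.isSaturated.Fil r :=
    fun hx => Hom.f_mem_Fil g h hB.isSaturated hx
  have hex : ∀ x : h.completion.carrier, ∃ b, ∃ a, ∃ ha : h.IsCauchy a, ha.lim = x ∧
      ∀ r, b - Hom.f g (a r) ∈ hB.isSaturated.Fil r := by
    intro x
    induction x using completion_ind with
    | lim a ha =>
      obtain ⟨n, hn⟩ := ha.bounded
      obtain ⟨b, hb⟩ := hB.exists_limit (x := fun r => Hom.f g (a r)) (n := n)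
        (fun r => by
          rw [← trunc_apply, trunc_of_mem_below (Hom.f_mem_below g (hn r))])
        (fun r => by rw [← map_sub]; exact hFil (ha.sub_mem r))
      exact ⟨b, a, ha, rfl, hb⟩
  choose f hf using hex
  have hf' : ∀ a, ∀ ha : h.IsCauchy a, ∀ r, f ha.lim - Hom.f g (a r) ∈ hB.isSaturated.Fil r := by
    intro a ha r
    obtain ⟨a', ha', haa', hr⟩ := hf ha.lim
    have := add_mem (hr r) (hFil (IsCauchy.lim_eq_lim.1 haa' r))
    rwa [map_sub, sub_add_sub_cancel] at this
  have huniq : ∀ a, ∀ ha : h.IsCauchy a, ∀ b, (∀ r, b - Hom.f g (a r) ∈ hB.isSaturated.Fil r) →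
      f ha.lim = b := fun a ha b hb => hB.eq_of_sub_mem fun r => by
    have := sub_mem (hf' a ha r) (hb r)
    rwa [sub_sub_sub_cancel_right] at this
  have hconst : ∀ x, f (Hom.f h.toCompletion x) = Hom.f g x := fun x =>
    huniq _ (IsCauchy.const h x) _ fun r => by rw [sub_self]; exact zero_mem _
  have hadd : ∀ x y, f (x + y) = f x + f y := by
    intro x y
    induction x using completion_ind with | lim a ha
    induction y using completion_ind with | lim b hb
    refine huniq _ (ha.add hb) _ fun r => ?_
    rw [Pi.add_apply, map_add, add_sub_add_comm]
    exact add_mem (hf' a ha r) (hf' b hb r)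
  have hmul : ∀ x y, f (x * y) = f x * f y := by
    intro x y
    induction x using completion_ind with | lim a ha
    induction y using completion_ind with | lim b hb
    refine huniq _ (ha.mul hb) _ fun r => ?_
    rw [Pi.mul_apply, map_mul]
    have := add_mem (hB.isSaturated.mul_mem_Fil (f ha.lim) (hf' b hb r))
      (hB.isSaturated.mem_Fil_mul (Hom.f g (b r)) (hf' a ha r))
    rw [mul_sub, sub_mul, sub_add_sub_cancel] at this
    exact this
  have hd : ∀ x, f (h.completion.d x) = B.d (f x) := by
    intro x
    induction x using completion_ind with | lim a ha
    refine huniq _ ha.map_d _ fun r => ?_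
    rw [Hom.f_d g, ← map_sub]
    exact hB.isSaturated.d_mem_Fil (hf' a ha r)
  have hF : ∀ x, f (h.completion.F x) = B.F (f x) := by
    intro x
    induction x using completion_ind with | lim a ha
    refine huniq _ ha.map_F _ fun r => ?_
    rw [Hom.f_F g, ← map_sub]
    exact hB.isSaturated.F_mem_Fil (hf' a ha (r + 1))
  have hmem : ∀ i, ∀ x ∈ h.completion.gr i, f x ∈ B.gr i := by
    rintro i _ ⟨a, ha, hai, rfl⟩
    change f ha.lim ∈ _
    have : f ha.lim = B.pr i (f ha.lim) := by
      refine huniq a ha _ fun r => ?_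
      rw [← pr_same (Hom.f_mem g i _ (hai r)), ← map_sub]
      exact hB.isSaturated.pr_mem_Fil i (hf' a ha r)
    rw [this]
    exact B.pr_mem i _
  let f' : h.completion.carrier →ₐ[W] B.carrier :=
    { toFun := f
      map_one' := (hconst 1).trans (map_one _)
      map_mul' := hmul
      map_zero' := (hconst 0).trans (map_zero _)
      map_add' := hadd
      commutes' := fun w => (hconst (algebraMap W A.carrier w)).trans ((Hom.f g).commutes w) }
  refine ⟨Hom.mk (A := h.completion) f' hmem hd hF (Hom.ψ (A := A) g) (Hom.ψ_ι (A := A) g)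
    (fun m => (hconst _).trans (Hom.f_α g m)) (Hom.ψ_FL (A := A) g)
    (fun m => (hconst _).trans (Hom.f_δ g m)), ?_⟩
  exact Hom.ext (A := A) (AlgHom.ext hconst) rfl

end IsSaturated

end LogDieudonneAlg

/-! ### Witt vectors of rings in which `p = 0` -/

namespace WittVector

variable {p : ℕ} [hp : Fact p.Prime] {R S : Type*} [CommRing R] [CommRing S]

/-- The Witt vector Frobenius is given by integral polynomials in the coefficients, so it is natural
for arbitrary rings. -/
theorem map_frobenius_eq (f : R →+* S) (x : WittVector p R) :
    map f (frobenius x) = frobenius (map f x) := by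
  ext n
  rw [map_coeff, coeff_frobenius, coeff_frobenius]
  exact MvPolynomial.comp_aeval_apply x.coeff f.toIntAlgHom (frobeniusPoly p n)

theorem exists_eq_teichmuller_add_verschiebung (x : WittVector p R) :
    ∃ y, x = teichmuller p (x.coeff 0) + verschiebung y := by
  have h0 : ∀ i < 0 + 1, (x - teichmuller p (x.coeff 0)).coeff i = 0 := by
    intro i hi
    obtain rfl : i = 0 := by omega
    change (constantCoeff : WittVector p R →+* R) (x - teichmuller p (x.coeff 0)) = 0
    rw [map_sub]
    change x.coeff 0 - (teichmuller p (x.coeff 0)).coeff 0 = 0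
    rw [teichmuller_coeff_zero, sub_self]
  refine ⟨(x - teichmuller p (x.coeff 0)).shift 1, ?_⟩
  have := verschiebung_shift _ 0 h0
  rw [Nat.succ_eq_add_one, zero_add] at this
  rw [this]
  have h1 : (x - teichmuller p (x.coeff 0)).shift 0 = x - teichmuller p (x.coeff 0) := by
    ext n
    rw [shift_coeff, zero_add]
  rw [h1, add_sub_cancel]

theorem eq_zero_of_forall_exists_iterate_verschiebung {x : WittVector p R}
    (hx : ∀ n, ∃ y, x = (verschiebung : WittVector p R → WittVector p R)^[n] y) : x = 0 := by
  ext n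
  obtain ⟨y, rfl⟩ := hx (n + 1)
  rw [iterate_verschiebung_coeff_eq_zero _ (Nat.lt_succ_self n), zero_coeff]

theorem subsingleton_of_subsingleton {p : ℕ} {R : Type*} [Subsingleton R] :
    Subsingleton (WittVector p R) :=
  ⟨fun _ _ => WittVector.ext fun _ => Subsingleton.elim _ _⟩

theorem charP_of_natCast_eq_zero [Nontrivial R] (h0 : (p : R) = 0) : CharP R p :=
  (CharP.charP_iff_prime_eq_zero hp.out).2 h0

/-- In characteristic `p` the Frobenius raises each coefficient to the `p`-th power. The zero ring
is treated apart because `CharP R p` fails there. -/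
theorem frobenius_injective_of_isReduced [IsReduced R] (h0 : (p : R) = 0) :
    Function.Injective (frobenius : WittVector p R →+* WittVector p R) := by
  rcases subsingleton_or_nontrivial R with h | h
  · have := subsingleton_of_subsingleton (p := p) (R := R)
    exact Function.injective_of_subsingleton _
  · have := charP_of_natCast_eq_zero h0
    refine (injective_iff_map_eq_zero _).2 fun x hx => ?_
    ext n
    have := congrArg (fun y => y.coeff n) hx
    simp only [coeff_frobenius_charP, zero_coeff] at this
    rw [zero_coeff]
    exact eq_zero_of_pow_eq_zero this

theorem verschiebung_frobenius_of_natCast_eq_zero (h0 : (p : R) = 0) (x : WittVector p R) :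
    verschiebung (frobenius x) = x * p := by
  rcases subsingleton_or_nontrivial R with h | h
  · have := subsingleton_of_subsingleton (p := p) (R := R)
    exact Subsingleton.elim _ _
  · have := charP_of_natCast_eq_zero h0
    exact verschiebung_frobenius x

theorem frobenius_teichmuller (h0 : (p : R) = 0) (a : R) :
    frobenius (teichmuller p a) = teichmuller p a ^ p := by
  rcases subsingleton_or_nontrivial R with h | h
  · have := subsingleton_of_subsingleton (p := p) (R := R)
    exact Subsingleton.elim _ _
  · have := charP_of_natCast_eq_zero h0
    rw [frobenius_eq_map_frobenius, map_teichmuller, ← map_pow]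
    rfl

theorem torsionFree_of_isReduced [IsReduced R] (h0 : (p : R) = 0) (x : WittVector p R)
    (hx : (p : WittVector p R) * x = 0) : x = 0 := by
  rw [mul_comm, ← verschiebung_frobenius_of_natCast_eq_zero h0] at hx
  apply frobenius_injective_of_isReduced h0
  apply verschiebung_injective p R
  rw [hx, map_zero, map_zero]

/-- Write `x = [a] + V y`. Then `F [a] = [a]^p`, `F V y = p y`, and `(V y)^2 = p V (y²)`; as `p ≥
2`, also `(V y)^p` is divisible by `p`, as are the mixed binomial terms. -/
theorem exists_frobenius_eq (h0 : (p : R) = 0) (x : WittVector p R) :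
    ∃ t, frobenius x = x ^ p + (p : WittVector p R) * t := by
  obtain ⟨y, hy⟩ := exists_eq_teichmuller_add_verschiebung x
  generalize x.coeff 0 = a at hy
  subst hy
  obtain ⟨r, hr⟩ := exists_add_pow_prime_eq hp.out (teichmuller p a) (verschiebung y)
  have hsq : verschiebung y ^ 2 = p * verschiebung (y * y) := by
    rw [sq, ← verschiebung_mul_frobenius, frobenius_verschiebung, ← mul_assoc,
      mul_comm (y * y), ← nsmul_eq_mul, map_nsmul, nsmul_eq_mul]
  have hpow : verschiebung y ^ p = p * (verschiebung (y * y) * verschiebung y ^ (p - 2)) := by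
    rw [← mul_assoc, ← hsq, ← pow_add, Nat.add_sub_cancel' hp.out.two_le]
  refine ⟨y - verschiebung (y * y) * verschiebung y ^ (p - 2) -
    teichmuller p a * verschiebung y * r, ?_⟩
  rw [map_add, frobenius_teichmuller h0, frobenius_verschiebung, hr, hpow]
  ring

end WittVector

/-! ### Dwork's lemma and the section `D → W(D)` -/

namespace WittVector

variable {p : ℕ} [hp : Fact p.Prime] {D : Type*} [CommRing D]

theorem ghostComponent_eq_sum (n : ℕ) (x : WittVector p D) :
    ghostComponent n x = ∑ i ∈ Finset.range (n + 1), (p : D) ^ i * x.coeff i ^ p ^ (n - i) := by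
  rw [ghostComponent_apply, aeval_wittPolynomial]

theorem ghost_ext (torsionFree : ∀ x : D, (p : D) * x = 0 → x = 0) {x y : WittVector p D}
    (h : ∀ n, ghostComponent n x = ghostComponent n y) : x = y := by
  have cancel : ∀ n : ℕ, ∀ z : D, (p : D) ^ n * z = 0 → z = 0 := by
    intro n
    induction n with
    | zero => intro z hz; simpa using hz
    | succ n ih =>
      intro z hz
      rw [pow_succ', mul_assoc] at hz
      exact ih z (torsionFree _ hz)
  ext n
  induction n using Nat.strong_induction_on with
  | h n ih =>
    have hn := h n
    rw [ghostComponent_eq_sum, ghostComponent_eq_sum, Finset.sum_range_succ,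
      Finset.sum_range_succ, Finset.sum_congr rfl (fun i hi => by
        rw [ih i (Finset.mem_range.1 hi)]), add_right_inj, Nat.sub_self, pow_zero, pow_one,
      pow_one] at hn
    exact sub_eq_zero.1 (cancel n _ (by rw [mul_sub, hn, sub_self]))

/-- Coefficients of the Witt vector with prescribed ghost components. -/
def ghostLiftCoeff (p : ℕ) (a : ℕ → D) (n : ℕ) : D :=
  -- The recursion is defined for any `a`; that the equation is solvable for `a n = φ^n b` is only
  -- established inductively afterwards.
  Classical.epsilon fun t => a n =
    (∑ i : Fin n, (p : D) ^ (i : ℕ) * ghostLiftCoeff p a i ^ p ^ (n - i)) + (p : D) ^ n * t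
termination_by n
decreasing_by exact i.2

/-- Dwork's congruence: from `φ(c) ≡ c^p` modulo `p` follows `φ(c)^(p^j) ≡ c^(p^(j+1))` modulo
`p^(j+1)`. So `φ` of the `n`-th ghost component equals, modulo `p^(n+1)`, the part of the next one
formed by the known coefficients, and the next coefficient can be solved for. -/
theorem exists_ghostComponent_eq_iterate (φ : D →+* D)
    (hφ : ∀ x, ∃ y, φ x = x ^ p + (p : D) * y) (b : D) :
    ∃ x : WittVector p D, ∀ n, ghostComponent n x = φ^[n] b := by
  let c := ghostLiftCoeff p (fun n => φ^[n] b)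
  refine ⟨mk p c, fun n => ?_⟩
  have hex : ∀ n, (∃ t, φ^[n] b = (∑ i : Fin n, (p : D) ^ (i : ℕ) * c i ^ p ^ (n - i)) +
      (p : D) ^ n * t) → ghostComponent n (mk p c) = φ^[n] b := by
    intro n hn
    have := Classical.epsilon_spec hn
    rw [ghostComponent_eq_sum, Finset.sum_range_succ, Nat.sub_self, pow_zero, pow_one,
      ← Fin.sum_univ_eq_sum_range (fun i => (p : D) ^ i * (mk p c).coeff i ^ p ^ (n - i))]
    refine Eq.trans ?_ this.symm
    congr 2
    change ghostLiftCoeff p (fun n => φ^[n] b) n = _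
    rw [ghostLiftCoeff]
  induction n with
  | zero => exact hex 0 ⟨b, by simp⟩
  | succ n ih =>
    apply hex
    have key : (p : D) ^ (n + 1) ∣ φ^[n + 1] b -
        ∑ i ∈ Finset.range (n + 1), (p : D) ^ i * c i ^ p ^ (n + 1 - i) := by
      rw [Function.iterate_succ_apply', ← ih, ghostComponent_eq_sum, map_sum,
        ← Finset.sum_sub_distrib]
      refine Finset.dvd_sum fun i hi => ?_
      have hi' : i ≤ n := Nat.lt_succ_iff.1 (Finset.mem_range.1 hi)
      rw [map_mul, map_pow, map_natCast, map_pow, ← mul_sub,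
        show n + 1 = i + (n - i + 1) by omega, pow_add]
      refine mul_dvd_mul_left _ ?_
      rw [show i + (n - i + 1) - i = (n - i) + 1 by omega, pow_succ' p, pow_mul]
      apply dvd_sub_pow_of_dvd_sub
      obtain ⟨y, hy⟩ := hφ (c i)
      exact ⟨y, by rw [coeff_mk, hy, add_sub_cancel_left]⟩
    obtain ⟨t, ht⟩ := key
    refine ⟨t, ?_⟩
    rw [← ht, Fin.sum_univ_eq_sum_range (fun i => (p : D) ^ i * c i ^ p ^ (n + 1 - i)),
      add_sub_cancel]

/-- The section `D → W(D)` of a torsion free ring with a lift of Frobenius. -/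
def frobeniusSection (torsionFree : ∀ x : D, (p : D) * x = 0 → x = 0) (φ : D →+* D)
    (hφ : ∀ x, ∃ y, φ x = x ^ p + (p : D) * y) : D →+* WittVector p D :=
  have key : ∀ b n, ghostComponent n (exists_ghostComponent_eq_iterate φ hφ b).choose = φ^[n] b :=
    fun b => (exists_ghostComponent_eq_iterate φ hφ b).choose_spec
  { toFun b := (exists_ghostComponent_eq_iterate φ hφ b).choose
    map_one' := ghost_ext torsionFree fun n => by rw [key, iterate_map_one, map_one]
    map_mul' x y := ghost_ext torsionFree fun n => by
      rw [key, iterate_map_mul, map_mul, key, key]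
    map_zero' := ghost_ext torsionFree fun n => by rw [key, iterate_map_zero, map_zero]
    map_add' x y := ghost_ext torsionFree fun n => by
      rw [key, iterate_map_add, map_add, key, key] }

theorem ghostComponent_frobeniusSection (torsionFree : ∀ x : D, (p : D) * x = 0 → x = 0)
    (φ : D →+* D) (hφ : ∀ x, ∃ y, φ x = x ^ p + (p : D) * y) (b : D) (n : ℕ) :
    ghostComponent n (frobeniusSection torsionFree φ hφ b) = φ^[n] b :=
  (exists_ghostComponent_eq_iterate φ hφ b).choose_spec n

end WittVector

/-! ### `V`-complete rings are Witt vector rings -/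

/-- A commutative `p`-torsion free ring `D` with a lift of Frobenius `φ` and a Verschiebung `V`,
complete for the `V`-adic filtration, with `D / I` reduced for `I = V D`. -/
structure IsVComplete (p : ℕ) {D : Type*} [CommRing D] (φ : D →+* D) (V : D →+ D) (I : Ideal D) :
    Prop where
  torsionFree : ∀ x : D, (p : D) * x = 0 → x = 0
  exists_frob : ∀ x, ∃ y, φ x = x ^ p + (p : D) * y
  φ_injective : Function.Injective φ
  φ_V : ∀ x, φ (V x) = (p : D) * x
  mem_iff : ∀ x, x ∈ I ↔ ∃ y, x = V y
  mem_of_φ_mem : ∀ x, φ x ∈ I → x ∈ I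
  separated : ∀ x, (∀ r, ∃ y, x = V^[r] y) → x = 0
  complete : ∀ x : ℕ → D, ∃ y, ∀ r, ∃ c, y = ∑ i ∈ Finset.range r, V^[i] (x i) + V^[r] c

namespace IsVComplete

variable {p : ℕ} {D : Type*} [CommRing D] {φ : D →+* D} {V : D →+ D} {I : Ideal D}

theorem V_φ (h : IsVComplete p φ V I) (x : D) : V (φ x) = p * x :=
  h.φ_injective (by rw [h.φ_V, map_mul, map_natCast])

theorem natCast_mul_mem (h : IsVComplete p φ V I) (x : D) : (p : D) * x ∈ I :=
  (h.mem_iff _).2 ⟨φ x, (h.V_φ x).symm⟩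

theorem natCast_eq_zero (h : IsVComplete p φ V I) : (p : D ⧸ I) = 0 := by
  rw [← map_natCast (Ideal.Quotient.mk I), Ideal.Quotient.eq_zero_iff_mem]
  simpa using h.natCast_mul_mem 1

theorem iterate_V_mul (h : IsVComplete p φ V I) (n : ℕ) (x y : D) :
    V^[n] x * y = V^[n] (x * φ^[n] y) := by
  induction n generalizing y with
  | zero => rfl
  | succ n ih =>
    rw [Function.iterate_succ_apply', Function.iterate_succ_apply', Function.iterate_succ_apply,
      ← ih]
    apply h.φ_injective
    rw [map_mul, h.φ_V, h.φ_V, mul_assoc]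

theorem p_mul_iterate_V (h : IsVComplete p φ V I) (n : ℕ) (x : D) :
    (p : D) * V^[n] x = V^[n + 1] (φ x) := by
  rw [Function.iterate_succ_apply, h.V_φ, ← nsmul_eq_mul, ← nsmul_eq_mul, iterate_map_nsmul]

section Prime

variable [hp : Fact p.Prime]

/-- If `x^p ∈ I` then `φ x = x^p + p y ∈ I`, because `p = V φ`, and hence `x ∈ I`. -/
theorem isReduced (h : IsVComplete p φ V I) : IsReduced (D ⧸ I) := by
  refine (isReduced_iff_pow_one_lt p hp.out.one_lt).2 fun x hx => ?_
  obtain ⟨x, rfl⟩ := Ideal.Quotient.mk_surjective x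
  rw [← map_pow, Ideal.Quotient.eq_zero_iff_mem] at hx
  rw [Ideal.Quotient.eq_zero_iff_mem]
  apply h.mem_of_φ_mem
  obtain ⟨y, hy⟩ := h.exists_frob x
  rw [hy]
  exact add_mem hx (h.natCast_mul_mem y)

/-- The canonical map `D → W(D / V D)`. -/
def toWitt (h : IsVComplete p φ V I) : D →+* WittVector p (D ⧸ I) :=
  (WittVector.map (Ideal.Quotient.mk I)).comp
    (WittVector.frobeniusSection h.torsionFree φ h.exists_frob)

theorem toWitt_coeff_zero (h : IsVComplete p φ V I) (b : D) :
    (h.toWitt b).coeff 0 = Ideal.Quotient.mk I b := by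
  have := WittVector.ghostComponent_frobeniusSection h.torsionFree φ h.exists_frob b 0
  rw [WittVector.ghostComponent_eq_sum] at this
  simp only [zero_add, Finset.range_one, Finset.sum_singleton, pow_zero, one_mul, Nat.sub_zero,
    pow_one, Function.iterate_zero_apply] at this
  change Ideal.Quotient.mk I _ = _
  rw [this]

/-- On ghost components both sides of the corresponding identity for the section are the shift of
the sequence `φ^n b`. -/
theorem toWitt_φ (h : IsVComplete p φ V I) (b : D) :
    h.toWitt (φ b) = WittVector.frobenius (h.toWitt b) := by
  rw [toWitt, RingHom.comp_apply, RingHom.comp_apply, ← WittVector.map_frobenius_eq]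
  congr 1
  refine WittVector.ghost_ext h.torsionFree fun n => ?_
  rw [WittVector.ghostComponent_frobenius, WittVector.ghostComponent_frobeniusSection,
    WittVector.ghostComponent_frobeniusSection, Function.iterate_succ_apply]

/-- `F V = p` holds on both sides, and `F` is injective on `W(D/I)` because `D/I` is reduced. -/
theorem toWitt_V (h : IsVComplete p φ V I) (b : D) :
    h.toWitt (V b) = WittVector.verschiebung (h.toWitt b) := by
  have := h.isReduced
  apply WittVector.frobenius_injective_of_isReduced h.natCast_eq_zero
  rw [← h.toWitt_φ, h.φ_V, map_mul, map_natCast, WittVector.frobenius_verschiebung, mul_comm]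

theorem toWitt_iterate_V (h : IsVComplete p φ V I) (n : ℕ) (b : D) :
    h.toWitt (V^[n] b) =
      (WittVector.verschiebung : WittVector p (D ⧸ I) → WittVector p (D ⧸ I))^[n] (h.toWitt b) := by
  induction n with
  | zero => rfl
  | succ n ih => rw [Function.iterate_succ_apply', h.toWitt_V, ih, Function.iterate_succ_apply']

/-- The ghost components `φ^n b = b^(p^n)` are those of the Teichmüller lift of `b`. -/
theorem toWitt_of_φ_eq_pow (h : IsVComplete p φ V I) {b : D} (hb : φ b = b ^ p) :
    h.toWitt b = WittVector.teichmuller p (Ideal.Quotient.mk I b) := by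
  rw [toWitt, RingHom.comp_apply, ← WittVector.map_teichmuller]
  congr 1
  refine WittVector.ghost_ext h.torsionFree fun n => ?_
  rw [WittVector.ghostComponent_frobeniusSection, WittVector.ghostComponent_teichmuller]
  induction n with
  | zero => simp
  | succ n ih => rw [Function.iterate_succ_apply', ih, map_pow, hb, ← pow_mul, ← pow_succ']

/-- An element of the kernel is `V c` with `c` again in the kernel; iterating, it lies in every `V^r
D`. -/
theorem toWitt_injective (h : IsVComplete p φ V I) : Function.Injective h.toWitt := by
  have step : ∀ b, h.toWitt b = 0 → ∃ c, b = V c ∧ h.toWitt c = 0 := by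
    intro b hb
    have h0 := h.toWitt_coeff_zero b
    rw [hb, WittVector.zero_coeff] at h0
    obtain ⟨c, rfl⟩ := (h.mem_iff b).1 (Ideal.Quotient.eq_zero_iff_mem.1 h0.symm)
    refine ⟨c, rfl, WittVector.verschiebung_injective p _ ?_⟩
    rw [← h.toWitt_V, hb, map_zero]
  refine (injective_iff_map_eq_zero _).2 fun b hb => h.separated b fun r => ?_
  suffices ∃ y, b = V^[r] y ∧ h.toWitt y = 0 from this.imp fun _ h => h.1
  induction r with
  | zero => exact ⟨b, rfl, hb⟩
  | succ r ih =>
    obtain ⟨y, hy, hy'⟩ := ih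
    obtain ⟨c, rfl, hc⟩ := step y hy'
    exact ⟨c, by rw [hy, Function.iterate_succ_apply], hc⟩

theorem toWitt_surjective (h : IsVComplete p φ V I) : Function.Surjective h.toWitt := by
  have step : ∀ x : WittVector p (D ⧸ I), ∃ c y, x = h.toWitt c + WittVector.verschiebung y := by
    intro x
    obtain ⟨c, hc⟩ := Ideal.Quotient.mk_surjective (x.coeff 0)
    obtain ⟨y, hy⟩ := WittVector.exists_eq_teichmuller_add_verschiebung (x - h.toWitt c)
    refine ⟨c, y, ?_⟩
    have h0 : (x - h.toWitt c).coeff 0 = 0 := by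
      change (WittVector.constantCoeff : WittVector p (D ⧸ I) →+* D ⧸ I) (x - h.toWitt c) = 0
      rw [map_sub]
      change x.coeff 0 - (h.toWitt c).coeff 0 = 0
      rw [toWitt_coeff_zero, hc, sub_self]
    rw [h0, WittVector.teichmuller_zero, zero_add] at hy
    rw [← hy, add_sub_cancel]
  intro x
  choose c y hcy using step
  -- `z n` is the remainder after `n` steps of the `V`-adic expansion of `x` with digits `c (z i)`;
  -- completeness of `D` sums the corresponding series.
  let z : ℕ → WittVector p (D ⧸ I) := fun n => y^[n] x
  have hz : ∀ r, x = ∑ i ∈ Finset.range r,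
      (WittVector.verschiebung : WittVector p (D ⧸ I) → WittVector p (D ⧸ I))^[i] (h.toWitt (c (z i))) +
      (WittVector.verschiebung : WittVector p (D ⧸ I) → WittVector p (D ⧸ I))^[r] (z r) := by
    intro r
    induction r with
    | zero => simp [z]
    | succ r ih =>
      rw [Finset.sum_range_succ, add_assoc, Function.iterate_succ_apply, ← iterate_map_add,
        show z (r + 1) = y (z r) from Function.iterate_succ_apply' _ _ _, ← hcy]
      exact ih
  obtain ⟨b, hb⟩ := h.complete fun n => c (z n)
  refine ⟨b, sub_eq_zero.1 (WittVector.eq_zero_of_forall_exists_iterate_verschiebung fun r => ?_)⟩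
  obtain ⟨e, he⟩ := hb r
  refine ⟨h.toWitt e - z r, ?_⟩
  rw [iterate_map_sub]
  nth_rewrite 1 [hz r]
  rw [he, map_add, map_sum]
  simp only [h.toWitt_iterate_V]
  abel

/-- `D` is the ring of Witt vectors of `D / V D`. -/
def wittEquiv (h : IsVComplete p φ V I) : D ≃+* WittVector p (D ⧸ I) :=
  RingEquiv.ofBijective h.toWitt ⟨h.toWitt_injective, h.toWitt_surjective⟩

theorem eq_of_φ_eq_pow (h : IsVComplete p φ V I) {b c : D} (hb : φ b = b ^ p) (hc : φ c = c ^ p)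
    (hbc : Ideal.Quotient.mk I b = Ideal.Quotient.mk I c) : b = c :=
  h.toWitt_injective (by rw [h.toWitt_of_φ_eq_pow hb, h.toWitt_of_φ_eq_pow hc, hbc])

/-- Ring homomorphisms to `D / V D` lift to the Witt vectors. -/
theorem exists_lift (h : IsVComplete p φ V I) {R : Type*} [CommRing R] (g : R →+* D ⧸ I) :
    ∃ f : WittVector p R →+* D, (∀ x, f (WittVector.frobenius x) = φ (f x)) ∧
      ∀ x, Ideal.Quotient.mk I (f x) = g (x.coeff 0) := by
  have happ : ∀ x, h.toWitt (h.wittEquiv.symm x) = x := h.wittEquiv.apply_symm_apply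
  refine ⟨h.wittEquiv.symm.toRingHom.comp (WittVector.map g), fun x => ?_, fun x => ?_⟩
  · apply h.toWitt_injective
    rw [h.toWitt_φ]
    change h.toWitt (h.wittEquiv.symm _) = WittVector.frobenius (h.toWitt (h.wittEquiv.symm _))
    rw [happ, happ, WittVector.map_frobenius_eq]
  · rw [← h.toWitt_coeff_zero]
    change (h.toWitt (h.wittEquiv.symm _)).coeff 0 = _
    rw [happ, WittVector.map_coeff]

/-- Equivariance forces compatibility with `V` and sends Teichmüller elements to solutions of `φ b =
b^p`, which are determined modulo `I`. Writing `x = [a] + V y` thus reduces `f x - f' x` to `V (f y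
- f' y)`, repeatedly. -/
theorem lift_unique (h : IsVComplete p φ V I) {R : Type*} [CommRing R] (h0 : (p : R) = 0)
    {f f' : WittVector p R →+* D} (hf : ∀ x, f (WittVector.frobenius x) = φ (f x))
    (hf' : ∀ x, f' (WittVector.frobenius x) = φ (f' x))
    (hff' : ∀ x, Ideal.Quotient.mk I (f x) = Ideal.Quotient.mk I (f' x)) : f = f' := by
  have hV : ∀ {q : WittVector p R →+* D}, (∀ x, q (WittVector.frobenius x) = φ (q x)) →
      ∀ x, q (WittVector.verschiebung x) = V (q x) := fun hq x => h.φ_injective (by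
    rw [← hq, WittVector.frobenius_verschiebung, h.φ_V, map_mul, map_natCast, mul_comm])
  have hT : ∀ {q : WittVector p R →+* D}, (∀ x, q (WittVector.frobenius x) = φ (q x)) →
      ∀ a, φ (q (WittVector.teichmuller p a)) = q (WittVector.teichmuller p a) ^ p := fun hq a => by
    rw [← hq, WittVector.frobenius_teichmuller h0, map_pow]
  ext x
  refine sub_eq_zero.1 (h.separated _ fun r => ?_)
  induction r generalizing x with
  | zero => exact ⟨_, rfl⟩
  | succ r ih =>
    obtain ⟨y, hy⟩ := WittVector.exists_eq_teichmuller_add_verschiebung x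
    obtain ⟨z, hz⟩ := ih y
    refine ⟨z, ?_⟩
    rw [hy, map_add, map_add, hV hf, hV hf',
      h.eq_of_φ_eq_pow (hT hf (x.coeff 0)) (hT hf' (x.coeff 0)) (hff' _),
      add_sub_add_left_eq_sub, ← map_sub, hz, Function.iterate_succ_apply']

/-- Taking `p`-th powers improves a congruence by one step: mixed terms carry a factor `p V^(n+1) c
= V^(n+2) (φ c)`, and `(V^(n+1) c)^2 = V^(n+1) (p^(n+1) c²)` also lies in the image of `V^(n+2)`. -/
theorem exists_pow_sub_pow_eq (h : IsVComplete p φ V I) (n : ℕ) {x y c : D}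
    (hxy : x - y = V^[n + 1] c) : ∃ c', x ^ p - y ^ p = V^[n + 2] c' := by
  obtain ⟨r, hr⟩ := exists_add_pow_prime_eq hp.out y (V^[n + 1] c)
  rw [← hxy, add_sub_cancel, hxy] at hr
  have hsq : V^[n + 1] c * V^[n + 1] c = V^[n + 2] (φ ((p : D) ^ n * (c * c))) := by
    have : ∀ m, φ^[m] (V^[m] c) = (p : D) ^ m * c := by
      intro m
      induction m with
      | zero => simp
      | succ m ih =>
        rw [Function.iterate_succ_apply, Function.iterate_succ_apply', h.φ_V, iterate_map_mul, ih,
          pow_succ', mul_assoc]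
        congr 1
        exact (map_natCast (φ ^ m) p : _)
    rw [← h.p_mul_iterate_V, h.iterate_V_mul, this, ← nsmul_eq_mul, ← iterate_map_nsmul,
      nsmul_eq_mul, pow_succ']
    congr 1
    ring
  refine ⟨φ ((p : D) ^ n * (c * c)) * φ^[n + 2] ((V^[n + 1] c) ^ (p - 2)) +
    φ c * φ^[n + 2] (y * r), ?_⟩
  rw [iterate_map_add, ← h.iterate_V_mul, ← h.iterate_V_mul, ← hsq, ← h.p_mul_iterate_V, hr,
    ← sq, ← pow_add, Nat.add_sub_cancel' hp.out.two_le]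
  ring

/-- Over a perfect field, ring homomorphisms `W(k) → D` are determined modulo `V`. -/
theorem hom_ext_of_perfect (h : IsVComplete p φ V I) {k : Type*} [Field k] [CharP k p]
    [PerfectRing k p] {f f' : WittVector p k →+* D}
    (hff' : ∀ x, Ideal.Quotient.mk I (f x) = Ideal.Quotient.mk I (f' x)) : f = f' := by
  have key : ∀ r x, ∃ c, f x - f' x = V^[r + 1] c := by
    intro r
    induction r with
    | zero => exact fun x => (h.mem_iff _).1 (Ideal.Quotient.eq.1 (hff' x))
    | succ r ih =>
      intro x
      -- By perfectness `x = [a]^p + p y`. Both the `p`-th power and the factor `p` improve the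
      -- agreement of `f` and `f'` by one step.
      obtain ⟨a, ha⟩ := surjective_frobenius k p (x.coeff 0)
      have hx : x - WittVector.teichmuller p a ^ p ∈ Ideal.span {(p : WittVector p k)} := by
        rw [WittVector.mem_span_p_iff_coeff_zero_eq_zero]
        change (WittVector.constantCoeff : WittVector p k →+* k)
          (x - WittVector.teichmuller p a ^ p) = 0
        rw [map_sub, map_pow]
        change x.coeff 0 - (WittVector.teichmuller p a).coeff 0 ^ p = 0
        rw [WittVector.teichmuller_coeff_zero, ← ha, frobenius_def, sub_self]
      obtain ⟨y, hy⟩ := Ideal.mem_span_singleton.1 hx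
      obtain ⟨c, hc⟩ := ih (WittVector.teichmuller p a)
      obtain ⟨c', hc'⟩ := h.exists_pow_sub_pow_eq r hc
      obtain ⟨e, he⟩ := ih y
      refine ⟨c' + φ e, ?_⟩
      rw [sub_eq_iff_eq_add.1 hy, iterate_map_add, ← hc', ← h.p_mul_iterate_V, ← he]
      simp only [map_add, map_mul, map_natCast, map_pow]
      ring
  ext x
  refine sub_eq_zero.1 (h.separated _ fun r => ?_)
  rcases r with _ | r
  · exact ⟨_, rfl⟩
  · exact key r x

end Prime

end IsVComplete

/-! ### Degree zero of a strict object is `V`-complete -/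

namespace LogDieudonneAlg

variable {p : ℕ} {W N : Type u} [CommRing W] [CommMonoid N] {β : N →* W}

/-- The Frobenius on `A^0`. -/
def zeroF (A : LogDieudonneAlg p β) : A.gr 0 →+* A.gr 0 where
  toFun a := ⟨A.F a.1, A.F_mem 0 _ a.2⟩
  map_one' := Subtype.ext (map_one A.F)
  map_mul' a b := Subtype.ext (map_mul A.F a.1 b.1)
  map_zero' := Subtype.ext (map_zero A.F)
  map_add' a b := Subtype.ext (map_add A.F a.1 b.1)

variable {A : LogDieudonneAlg p β}

/-- The Verschiebung on `A^0`. -/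
def IsSaturated.zeroV (h : A.IsSaturated) : A.gr 0 →+ A.gr 0 where
  toFun a := ⟨h.V a.1, h.V_mem a.2⟩
  map_zero' := Subtype.ext (map_zero h.V)
  map_add' a b := Subtype.ext (map_add h.V a.1 b.1)

theorem IsSaturated.coe_zeroV_iterate (h : A.IsSaturated) (n : ℕ) (a : A.gr 0) :
    (h.zeroV^[n] a : A.carrier) = (h.V ^ n) a := by
  induction n with
  | zero => rfl
  | succ n ih => rw [Function.iterate_succ_apply', h.Vpow_succ, ← ih]; rfl

theorem IsStrict.isVComplete (hA : A.IsStrict) :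
    IsVComplete p A.zeroF hA.isSaturated.zeroV hA.isSaturated.VIdeal where
  torsionFree x hx := Subtype.ext (hA.isSaturated.torsionFree _ (congrArg Subtype.val hx))
  exists_frob x := by
    obtain ⟨b, hb, h⟩ := A.F_frob x.1 x.2
    exact ⟨⟨b, hb⟩, Subtype.ext h⟩
  φ_injective x y hxy := Subtype.ext (hA.isSaturated.F_injective (congrArg Subtype.val hxy))
  φ_V x := Subtype.ext (hA.isSaturated.F_V x.1)
  mem_iff x := exists_congr fun y =>
    (Subtype.ext_iff (a1 := x) (a2 := hA.isSaturated.zeroV y)).symm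
  mem_of_φ_mem := by
    rintro x ⟨z, hz⟩
    replace hz : A.F x.1 = hA.isSaturated.V z := hz
    -- From `F x = V z` follows `d z = F d V z = F d F x = p F F d x`, so `z = F w`. Then `F x = V F
    -- w = p w = F V w`, and `x = V w`.
    obtain ⟨w, hw⟩ := hA.isSaturated.exists_F_eq (x := z.1) (z := A.F (A.F (A.d x.1))) (by
      rw [← hA.isSaturated.F_d_V, ← hz, A.d_F, F_p_mul])
    have hw0 : A.F (A.pr 0 w) = z := by rw [← pr_F, hw, pr_same z.2]
    refine ⟨⟨A.pr 0 w, A.pr_mem 0 w⟩, hA.isSaturated.F_injective ?_⟩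
    rw [hz, hA.isSaturated.F_V, ← hw0, hA.isSaturated.V_F]
  separated x hx := Subtype.ext (hA.eq_zero fun r => by
    obtain ⟨y, rfl⟩ := hx r
    rw [hA.isSaturated.coe_zeroV_iterate]
    exact hA.isSaturated.Vpow_mem_Fil r _)
  complete x := by
    let s : ℕ → A.gr 0 := fun r => ∑ i ∈ Finset.range r, hA.isSaturated.zeroV^[i] (x i)
    obtain ⟨y, hy, hys⟩ := hA.exists_limit_of_mem (x := fun r => (s r : A.carrier)) (i := 0)
      (fun r => (s r).2) (fun r => by
        have : s (r + 1) - s r = hA.isSaturated.zeroV^[r] (x r) := by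
          simp only [s, Finset.sum_range_succ, add_sub_cancel_left]
        rw [← AddSubgroupClass.coe_sub, this, hA.isSaturated.coe_zeroV_iterate]
        exact hA.isSaturated.Vpow_mem_Fil r _)
    refine ⟨⟨y, hy⟩, fun r => ?_⟩
    obtain ⟨c, hc, hcy⟩ := hA.isSaturated.mem_Fil_of_mem_gr_zero (sub_mem hy (s r).2) (hys r)
    refine ⟨⟨c, hc⟩, Subtype.ext ?_⟩
    change y = ((s r + hA.isSaturated.zeroV^[r] ⟨c, hc⟩ : A.gr 0) : A.carrier)
    rw [Submodule.coe_add, hA.isSaturated.coe_zeroV_iterate, ← hcy, add_sub_cancel]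

end LogDieudonneAlg

/-! ### Morphisms out of the log de Rham complex -/

namespace LogAlg.IsFrobeniusLift

open LogDieudonneAlg

variable {p : ℕ} [Fact p.Prime] {W N : Type u} [CommRing W] [CommMonoid N] {β : N →* W} {A : LogAlg β}
  {φ : A.carrier →+* A.carrier} (h : A.IsFrobeniusLift p φ)

theorem exists_algebraMap_eq {x : A.Ext} (hx : x ∈ h.logDeRham.gr 0) :
    ∃ a, algebraMap A.carrier A.Ext a = x := by
  have hx' : x ∈ (1 : Submodule A.carrier A.Ext) := by
    have : x ∈ ⋀[A.carrier]^0 A.Omega := hx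
    simpa using this
  exact Submodule.mem_one.1 hx'

/-- Degree zero of the log de Rham complex. -/
def zeroIso : A ≅ h.logDeRham.zero where
  hom :=
    { f :=
        { toFun := fun a => ⟨algebraMap A.carrier A.Ext a,
            SetLike.algebraMap_mem_graded (fun i : ℕ => ⋀[A.carrier]^i A.Omega) a⟩
          map_one' := Subtype.ext (map_one (algebraMap A.carrier A.Ext))
          map_mul' := fun a b => Subtype.ext (map_mul (algebraMap A.carrier A.Ext) a b)
          map_zero' := Subtype.ext (map_zero (algebraMap A.carrier A.Ext))
          map_add' := fun a b => Subtype.ext (map_add (algebraMap A.carrier A.Ext) a b)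
          commutes' := fun w =>
            Subtype.ext (IsScalarTower.algebraMap_apply W A.carrier A.Ext w).symm }
      ψ := MonoidHom.id _
      f_α := fun _ => rfl
      ψ_ι := fun _ => rfl }
  inv :=
    { f :=
        { toFun := fun x => ExteriorAlgebra.algebraMapInv (h.logDeRham.zeroVal x)
          map_one' := map_one ExteriorAlgebra.algebraMapInv
          map_mul' := fun _ _ => map_mul ExteriorAlgebra.algebraMapInv _ _
          map_zero' := map_zero ExteriorAlgebra.algebraMapInv
          map_add' := fun _ _ => map_add ExteriorAlgebra.algebraMapInv _ _
          commutes' := fun w => by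
            change ExteriorAlgebra.algebraMapInv (algebraMap W A.Ext w) = _
            rw [IsScalarTower.algebraMap_apply W A.carrier A.Ext]
            exact ExteriorAlgebra.algebraMap_leftInverse A.Omega _ }
      ψ := MonoidHom.id _
      f_α := fun m => ExteriorAlgebra.algebraMap_leftInverse A.Omega (A.α m)
      ψ_ι := fun _ => rfl }
  hom_inv_id := LogAlg.Hom.ext
    (AlgHom.ext fun a => ExteriorAlgebra.algebraMap_leftInverse A.Omega a) rfl
  inv_hom_id := LogAlg.Hom.ext (AlgHom.ext fun x => by
    obtain ⟨x, hx⟩ := x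
    obtain ⟨a, rfl⟩ := h.exists_algebraMap_eq hx
    exact Subtype.ext (congrArg (algebraMap A.carrier A.Ext)
      (ExteriorAlgebra.algebraMap_leftInverse A.Omega a))) rfl

theorem isPCompatible_logDeRham : h.logDeRham.IsPCompatible := fun _ => rfl

theorem isLogDeRham : IsLogDeRham A φ h.logDeRham h.zeroIso :=
  ⟨RingEquiv.refl A.Ext,
    { e_algebraMap := fun _ => rfl
      e_mem := fun _ _ hx => hx
      e_d := fun a => (A.extD_algebraMap a).symm
      e_dlog := fun _ => rfl
      F_algebraMap := fun a => h.extF_algebraMap a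
      F_d := fun a t ht => by
        rw [h.θ_unique ht]
        exact h.extF_extDa a
      F_dlog := fun m => h.extF_extDlog m
      pCompatible := h.isPCompatible_logDeRham }⟩

/-- Compatibility with `d` and `δ` forces the values on the degree one generators. -/
theorem logDeRham_hom_ext {B : LogDieudonneAlg p β} {G G' : h.logDeRham ⟶ B}
    (hf : ∀ a : A.carrier, LogDieudonneAlg.Hom.f G (algebraMap A.carrier A.Ext a) =
      LogDieudonneAlg.Hom.f G' (algebraMap A.carrier A.Ext a))
    (hψ : LogDieudonneAlg.Hom.ψ G = LogDieudonneAlg.Hom.ψ G') : G = G' := by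
  refine LogDieudonneAlg.Hom.ext (AlgHom.ext fun x => RingHom.congr_fun (A.ext_hom_ext
    (f := (LogDieudonneAlg.Hom.f G).toRingHom)
    (g := (LogDieudonneAlg.Hom.f G').toRingHom) hf (fun a => ?_) fun m => ?_) x) hψ
  · have h1 := LogDieudonneAlg.Hom.f_d G (algebraMap A.carrier A.Ext a)
    have h2 := LogDieudonneAlg.Hom.f_d G' (algebraMap A.carrier A.Ext a)
    rw [← hf, ← h1] at h2
    rw [← A.extD_algebraMap]
    exact h2.symm
  · have h1 := LogDieudonneAlg.Hom.f_δ G m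
    have h2 := LogDieudonneAlg.Hom.f_δ G' m
    rw [← hψ, ← h1] at h2
    exact h2.symm

/-- `d ∘ g` and `δ ∘ ψ` form a log derivation into `B`, which extends to the exterior algebra; `hg`
and `p`-compatibility of `B` then give compatibility with `F`, since `p` cancels in `B`. -/
theorem exists_logDeRham_lift {B : LogDieudonneAlg p β}
    (hB : ∀ x : B.carrier, (p : B.carrier) * x = 0 → x = 0) (hBp : B.IsPCompatible)
    (g : A ⟶ B.zero)
    (hg : ∀ a, B.zeroVal (LogAlg.Hom.f g (φ a)) = B.F (B.zeroVal (LogAlg.Hom.f g a))) :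
    ∃ G : h.logDeRham ⟶ B, h.zeroIso.hom ≫ LogDieudonneAlg.Hom.zero G = g := by
  have cancel : ∀ {x y : B.carrier}, (p : B.carrier) * x = p * y → x = y := fun hxy =>
    sub_eq_zero.1 (hB _ (by rw [mul_sub, hxy, sub_self]))
  let g0 : A.carrier →+* B.carrier :=
    { toFun := fun a => B.zeroVal (LogAlg.Hom.f g a)
      map_one' := congrArg B.zeroVal (map_one (LogAlg.Hom.f g))
      map_mul' := fun a b => congrArg B.zeroVal (map_mul (LogAlg.Hom.f g) a b)
      map_zero' := congrArg B.zeroVal (map_zero (LogAlg.Hom.f g))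
      map_add' := fun a b => congrArg B.zeroVal (map_add (LogAlg.Hom.f g) a b) }
  let ψ0 : A.M →* B.L := LogAlg.Hom.ψ g
  have g0_mem : ∀ a, g0 a ∈ B.gr 0 := fun a => (show B.gr 0 from LogAlg.Hom.f g a).2
  have g0_α : ∀ m, g0 (A.α m) = B.α (ψ0 m) := fun m =>
    congrArg B.zeroVal (LogAlg.Hom.f_α g m)
  have g0_alg : ∀ w, g0 (algebraMap W A.carrier w) = algebraMap W B.carrier w := fun w =>
    congrArg B.zeroVal ((LogAlg.Hom.f g).commutes w)
  have odd_mem : ∀ x ∈ Set.range (fun a => B.d (g0 a)) ∪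
      Set.range (fun m => B.δ (ψ0 m)), x ∈ B.gr 1 := by
    rintro _ (⟨a, rfl⟩ | ⟨m, rfl⟩)
    · exact B.d_mem 0 _ (g0_mem a)
    · exact B.δ_mem _
  obtain ⟨f, hfg, hfD, hfδ⟩ := A.exists_ext_lift g0
    (B.d.toAddMonoidHom.comp (g0 : A.carrier →+ B.carrier)) (fun m => B.δ (ψ0 m))
    (fun a b => zero_comm (g0_mem a) (B.d_mem 0 _ (g0_mem b)))
    (fun a m => zero_comm (g0_mem a) (B.δ_mem _))
    (fun a b => by
      change B.d (g0 (a * b)) = g0 a * B.d (g0 b) + g0 b * B.d (g0 a)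
      rw [map_mul, d_zero_mul (g0_mem a), zero_comm (g0_mem b) (B.d_mem 0 _ (g0_mem a)), add_comm])
    (fun w => by
      change B.d (g0 _) = 0
      rw [g0_alg, d_algebraMap])
    (by rw [map_one, B.δ_one]) (fun m n => by rw [map_mul, B.δ_mul])
    (fun m => by
      change B.d (g0 _) = _
      rw [g0_α, B.d_α])
    (fun n => by
      exact (congrArg B.δ (LogAlg.Hom.ψ_ι g n)).trans (B.δ_ι n))
    (fun x hx => B.sq_odd 1 odd_one _ (odd_mem x hx))
    (fun x hx y hy => by
      rw [B.graded_comm 1 1 x (odd_mem x hx) y (odd_mem y hy)]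
      simp)
  replace hfD : ∀ a, f (A.extDa a) = B.d (g0 a) := hfD
  have hf_alg : ∀ w, f (algebraMap W A.Ext w) = algebraMap W B.carrier w := fun w => by
    rw [IsScalarTower.algebraMap_apply W A.carrier A.Ext, hfg, g0_alg]
  have hf_mem : ∀ i, ∀ x : A.Ext, x ∈ ⋀[A.carrier]^i A.Omega → f x ∈ B.gr i := by
    intro i x hx
    induction hx using Submodule.pow_induction_on_left' with
    | algebraMap r => rw [hfg]; exact g0_mem r
    | add x y i hx hy hx' hy' => rw [map_add]; exact add_mem hx' hy'
    | mem_mul m hm i x hx ih =>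
      obtain ⟨w, rfl⟩ := hm
      have hw : w ∈ Submodule.span A.carrier (Set.range A.dOmega ∪ Set.range A.dlog) := by
        rw [span_omega_eq_top]; trivial
      have hfw : f (ExteriorAlgebra.ι A.carrier w) ∈ B.gr 1 := by
        induction hw using Submodule.span_induction with
        | mem w hw =>
          rcases hw with ⟨a, rfl⟩ | ⟨m, rfl⟩
          · exact (hfD a).symm ▸ B.d_mem 0 _ (g0_mem a)
          · exact (hfδ m).symm ▸ B.δ_mem _
        | zero => rw [map_zero, map_zero]; exact zero_mem _
        | add x y _ _ hx hy => rw [map_add, map_add]; exact add_mem hx hy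
        | smul a x _ hx =>
          rw [map_smul, Algebra.smul_def, map_mul, hfg]
          have := SetLike.mul_mem_graded (g0_mem a) hx
          rwa [zero_add] at this
      rw [map_mul]
      have := SetLike.mul_mem_graded hfw ih
      rwa [add_comm 1 i] at this
  have hf_d : ∀ x, f (A.extD x) = B.d (f x) := by
    intro x
    induction x using ext_induction with
    | one => rw [extD_one, map_zero, map_one, d_one]
    | add x y hx hy => rw [map_add, map_add, map_add, map_add, hx, hy]
    | algebraMap_mul a x hx =>
      rw [extD_algebraMap_mul, map_add, map_mul, map_mul, map_mul, hfg, hfD, hx,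
        d_zero_mul (g0_mem a)]
    | da_mul a x hx =>
      rw [extD_da_mul, map_neg, map_mul, map_mul, hfD, hx, B.d_mul 1 _ (B.d_mem 0 _ (g0_mem a)),
        B.d_d]
      simp
    | dlog_mul m x hx =>
      rw [extD_dlog_mul, map_neg, map_mul, map_mul, hfδ, hx, B.d_mul 1 _ (B.δ_mem _), B.d_δ]
      simp
  have hf_F : f.comp h.extF = B.F.comp f := by
    refine A.ext_hom_ext (fun a => ?_) (fun a => ?_) fun m => ?_
    · rw [RingHom.comp_apply, RingHom.comp_apply, extF_algebraMap, hfg, hfg]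
      exact hg a
    · rw [RingHom.comp_apply, RingHom.comp_apply]
      -- In both complexes `p F d = d F`, so the claim times `p` is the derivative of the
      -- equivariance `hg`.
      apply cancel
      rw [hfD, ← B.d_F, ← map_natCast f p, ← map_mul, ← A.extD_algebraMap, ← h.extD_extF, hf_d,
        extF_algebraMap, hfg]
      exact congrArg B.d (hg a)
    · rw [RingHom.comp_apply, RingHom.comp_apply, extF_extDlog, hfδ]
      -- `p F (δ l) = δ (F_L l) = δ (l^p) = p δ l` by `p`-compatibility.
      apply cancel
      rw [← B.δ_FL, hBp]
      have : ∀ n : ℕ, ∀ l, B.δ (l ^ n) = n * B.δ l := by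
        intro n l
        induction n with
        | zero => rw [pow_zero, B.δ_one, Nat.cast_zero, zero_mul]
        | succ n ih => rw [pow_succ, B.δ_mul, ih, Nat.cast_succ, add_mul, one_mul]
      exact (this p _).symm
  refine ⟨LogDieudonneAlg.Hom.mk (A := h.logDeRham) { f with commutes' := hf_alg } hf_mem hf_d
    (fun x => RingHom.congr_fun hf_F x) ψ0 (LogAlg.Hom.ψ_ι g)
    (fun m => (hfg (A.α m)).trans (g0_α m)) (fun m => ?_) hfδ, ?_⟩
  · exact (map_pow ψ0 m p).trans (hBp _).symm
  · exact LogAlg.Hom.ext (AlgHom.ext fun a => Subtype.ext (hfg a)) rfl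

end LogAlg.IsFrobeniusLift

/-! ### The log de Rham complex of `W(R_red)` -/

namespace LogAlg

variable {k N : Type u} [Field k] [CommMonoid N] {β : N →* k}

/-- The projection `R → R_red`. -/
def redMk {K N : Type u} [CommRing K] [CommMonoid N] {β : N →* K} (R : LogAlg β) :
    R.carrier →+* R.red.carrier :=
  Ideal.Quotient.mk (nilradical R.carrier)

theorem natCast_red_eq_zero {p : ℕ} [CharP k p] (R : LogAlg β) : (p : R.red.carrier) = 0 := by
  rw [← map_natCast (algebraMap k R.red.carrier) p, CharP.cast_eq_zero, map_zero]

instance (R : LogAlg β) : IsReduced R.red.carrier :=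
  (Ideal.isRadical_iff_quotient_reduced _).1 (Ideal.radical_isRadical ⊥)

variable {p : ℕ} [Fact p.Prime] [CharP k p]

theorem isFrobeniusLift_witt (R : LogAlg β) : (R.red.witt p).IsFrobeniusLift p
    (WittVector.frobenius : WittVector p R.red.carrier →+* WittVector p R.red.carrier) where
  torsionFree := WittVector.torsionFree_of_isReduced R.natCast_red_eq_zero
  exists_eq := WittVector.exists_frobenius_eq R.natCast_red_eq_zero
  exists_eq_algebraMap w := by
    obtain ⟨t, ht⟩ := WittVector.exists_frobenius_eq (CharP.cast_eq_zero k p) w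
    refine ⟨t, ?_⟩
    change WittVector.frobenius (WittVector.map (algebraMap k R.red.carrier) w) =
      WittVector.map (algebraMap k R.red.carrier) w ^ p +
        (p : WittVector p R.red.carrier) * WittVector.map (algebraMap k R.red.carrier) t
    rw [← WittVector.map_frobenius_eq, ht, map_add, map_pow, map_mul, map_natCast]
  φ_α m := WittVector.frobenius_teichmuller R.natCast_red_eq_zero _

variable (p) in
/-- The log de Rham complex of `W(R_red)`. -/
def wittDeRham (R : LogAlg β) : LogDieudonneAlg p (teichLog p β) :=
  (R.isFrobeniusLift_witt (p := p)).logDeRham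

variable (p) in
/-- Degree zero of the log de Rham complex of `W(R_red)`. -/
def wittDeRhamZeroIso (R : LogAlg β) : R.red.witt p ≅ (R.wittDeRham p).zero :=
  (R.isFrobeniusLift_witt (p := p)).zeroIso

/-- The ring homomorphism `W(R_red) → B^0` attached to a morphism from the log de Rham complex. -/
def wittHom {R : LogAlg β} {B : LogDieudonneAlg p (teichLog p β)} (G : R.wittDeRham p ⟶ B) :
    WittVector p R.red.carrier →+* B.gr 0 :=
  (LogAlg.Hom.f ((R.wittDeRhamZeroIso p).hom ≫ LogDieudonneAlg.Hom.zero G)).toRingHom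

section

variable {R : LogAlg β} {B : LogDieudonneAlg p (teichLog p β)} (G : R.wittDeRham p ⟶ B)

theorem wittHom_frobenius (x : WittVector p R.red.carrier) :
    wittHom G (WittVector.frobenius x) = B.zeroF (wittHom G x) := by
  have h1 := (R.isFrobeniusLift_witt (p := p)).extF_algebraMap x
  have h2 := LogDieudonneAlg.Hom.f_F G (algebraMap (R.red.witt p).carrier (R.red.witt p).Ext x)
  exact Subtype.ext ((congrArg (LogDieudonneAlg.Hom.f G) h1.symm).trans h2)

theorem wittHom_verschiebung (hB : B.IsSaturated) (x : WittVector p R.red.carrier) :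
    wittHom G (WittVector.verschiebung x) = hB.zeroV (wittHom G x) := by
  refine Subtype.ext (hB.eq_V_of_F_eq ?_)
  have h1 := wittHom_frobenius G (WittVector.verschiebung x)
  rw [WittVector.frobenius_verschiebung, map_mul, map_natCast, mul_comm] at h1
  exact (congrArg Subtype.val h1).symm

theorem wittHom_teichmuller (m : R.M) :
    (wittHom G (WittVector.teichmuller p (R.red.α m)) : B.carrier) =
      B.α (LogDieudonneAlg.Hom.ψ G m) :=
  LogDieudonneAlg.Hom.f_α G m

theorem wittHom_algebraMap (w : WittVector p k) :
    wittHom G (WittVector.map (algebraMap k R.red.carrier) w) = algebraMap _ (B.gr 0) w :=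
  (LogAlg.Hom.f ((R.wittDeRhamZeroIso p).hom ≫ LogDieudonneAlg.Hom.zero G)).commutes w

end

end LogAlg

/-! ### Morphisms `E → B` correspond to morphisms `R → B^0/VB^0` -/

namespace StrictLogDieudonneAlg

variable {p : ℕ} [Fact p.Prime] {k N : Type u} [Field k] [CharP k p]
  [CommMonoid N] {β : N →* k}

section Descend

variable {R : LogAlg β} {B : StrictLogDieudonneAlg p β} (G : R.wittDeRham p ⟶ B.obj)

/-- The map `W(R) → W(R_red) → B^0 → B^0 / V B^0`. -/
def wittToModV : WittVector p R.carrier →+* B.obj.gr 0 ⧸ B.isSaturated.VIdeal :=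
  (Ideal.Quotient.mk B.isSaturated.VIdeal).comp
    ((LogAlg.wittHom G).comp (WittVector.map R.redMk))

/-- A Witt vector with vanishing constant coefficient is some `V y`, and the map to `B^0` commutes
with `V`. -/
theorem ker_constantCoeff_le :
    RingHom.ker (WittVector.constantCoeff : WittVector p R.carrier →+* R.carrier) ≤
      RingHom.ker (wittToModV G) := by
  intro x hx
  rw [RingHom.mem_ker] at hx ⊢
  replace hx : x.coeff 0 = 0 := hx
  obtain ⟨y, hy⟩ := WittVector.exists_eq_teichmuller_add_verschiebung x
  rw [hx, WittVector.teichmuller_zero, zero_add] at hy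
  rw [hy, wittToModV, RingHom.comp_apply, RingHom.comp_apply, Ideal.Quotient.eq_zero_iff_mem,
    WittVector.map_verschiebung]
  exact ⟨_, congrArg Subtype.val (LogAlg.wittHom_verschiebung G B.isSaturated _)⟩

/-- The ring homomorphism `R → B^0 / V B^0` attached to a morphism from the log de Rham complex
of `W(R_red)`. -/
def descendRingHom : R.carrier →+* B.obj.gr 0 ⧸ B.isSaturated.VIdeal :=
  RingHom.liftOfSurjective (WittVector.constantCoeff : WittVector p R.carrier →+* R.carrier)
    constantCoeff_surjective ⟨_, ker_constantCoeff_le G⟩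

theorem descendRingHom_coeff (x : WittVector p R.carrier) :
    descendRingHom G (x.coeff 0) = Ideal.Quotient.mk B.isSaturated.VIdeal
      (LogAlg.wittHom G (WittVector.map R.redMk x)) :=
  RingHom.liftOfRightInverse_comp_apply _ _ _ ⟨_, ker_constantCoeff_le G⟩ x

end Descend

variable [PerfectRing k p]

section Descend

variable {R : LogAlg β} {B : StrictLogDieudonneAlg p β} (G : R.wittDeRham p ⟶ B.obj)

/-- The morphism `R → (B^0 / V B^0, L)` attached to a morphism from the log de Rham complex of
`W(R_red)`. -/
def descend : R ⟶ (modV p β).obj B where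
  f :=
    { descendRingHom G with
      commutes' := fun a => by
        obtain ⟨w, rfl⟩ := constantCoeff_surjective (p := p) a
        have h1 := descendRingHom_coeff G (WittVector.map (algebraMap k R.carrier) w)
        rw [WittVector.map_coeff] at h1
        refine h1.trans (Eq.trans ?_ (B.baseMap_coeff w).symm)
        rw [← LogAlg.wittHom_algebraMap G]
        rfl }
  ψ := LogDieudonneAlg.Hom.ψ G
  f_α m := by
    have h1 := descendRingHom_coeff G (WittVector.teichmuller p (R.α m))
    rw [WittVector.teichmuller_coeff_zero, WittVector.map_teichmuller] at h1
    exact h1.trans (congrArg (Ideal.Quotient.mk B.isSaturated.VIdeal)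
      (Subtype.ext (LogAlg.wittHom_teichmuller G m)))
  ψ_ι := LogDieudonneAlg.Hom.ψ_ι G

theorem descend_comp {B' : StrictLogDieudonneAlg p β} (g : B ⟶ B') :
    descend G ≫ (modV p β).map g = descend (G ≫ g.hom) := by
  refine LogAlg.Hom.ext (AlgHom.ext fun a => ?_) rfl
  obtain ⟨x, rfl⟩ := constantCoeff_surjective (p := p) a
  have h1 := descendRingHom_coeff G x
  have h2 := descendRingHom_coeff (B := B') (G ≫ g.hom) x
  refine Eq.trans ?_ h2.symm
  exact (congrArg (LogAlg.Hom.f (modVMap g)) h1 :)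

end Descend

variable {R : LogAlg β} {B : StrictLogDieudonneAlg p β}

/-- The map on `W(R_red)` is Frobenius-equivariant, so `lift_unique` recovers it from its reduction
modulo `V`, and the whole morphism is then determined. -/
theorem descend_injective :
    Function.Injective (descend : (R.wittDeRham p ⟶ B.obj) → (R ⟶ (modV p β).obj B)) := by
  intro G G' hGG'
  have hf : LogAlg.wittHom G = LogAlg.wittHom G' := by
    refine B.property.2.isVComplete.lift_unique R.natCast_red_eq_zero
      (LogAlg.wittHom_frobenius G) (LogAlg.wittHom_frobenius G') fun x => ?_
    obtain ⟨x, rfl⟩ := WittVector.map_surjective R.redMk Ideal.Quotient.mk_surjective x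
    have h1 := descendRingHom_coeff G x
    have h2 := descendRingHom_coeff G' x
    have h3 : descendRingHom G (x.coeff 0) = descendRingHom G' (x.coeff 0) :=
      congrArg (fun v => LogAlg.Hom.f v (x.coeff 0)) hGG'
    exact h1.symm.trans (h3.trans h2)
  exact LogAlg.IsFrobeniusLift.logDeRham_hom_ext _
    (fun a => congrArg Subtype.val (RingHom.congr_fun hf a))
    (congrArg (fun v : R ⟶ (modV p β).obj B => LogAlg.Hom.ψ v) hGG')

theorem descend_surjective :
    Function.Surjective (descend : (R.wittDeRham p ⟶ B.obj) → (R ⟶ (modV p β).obj B)) := by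
  intro v
  have hV := B.property.2.isVComplete
  have := hV.isReduced
  let v0 : R.carrier →+* B.obj.gr 0 ⧸ B.isSaturated.VIdeal := (LogAlg.Hom.f v).toRingHom
  -- `B^0/VB^0` is reduced, so nilpotents of `R` are killed.
  let g : R.red.carrier →+* B.obj.gr 0 ⧸ B.isSaturated.VIdeal :=
    Ideal.Quotient.lift (nilradical R.carrier) v0 fun a ha =>
      (((mem_nilradical.1 ha).map v0).eq_zero)
  obtain ⟨f, hfF, hf⟩ := hV.exists_lift g
  -- Linearity over `W(k)` is not part of the Witt lift; it holds modulo `V`, and perfectness of `k`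
  -- propagates it.
  have hf_alg : ∀ w, f (WittVector.map (algebraMap k R.red.carrier) w) =
      algebraMap _ (B.obj.gr 0) w := by
    intro w
    refine RingHom.congr_fun (f := f.comp (WittVector.map (algebraMap k R.red.carrier)))
      (g := algebraMap _ (B.obj.gr 0)) (hV.hom_ext_of_perfect fun w => ?_) w
    rw [RingHom.comp_apply, hf, WittVector.map_coeff]
    exact ((LogAlg.Hom.f v).commutes (w.coeff 0)).trans (B.baseMap_coeff w)
  let ψ0 : R.M →* B.obj.L := LogAlg.Hom.ψ v
  -- Both sides solve `φ b = b^p`, the right one by `p`-compatibility of `B`, and they agree modulo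
  -- `V`.
  have hf_α : ∀ m : R.M, f (WittVector.teichmuller p (R.red.α m)) =
      ⟨B.obj.α (ψ0 m), B.obj.α_mem _⟩ := by
    intro m
    refine hV.eq_of_φ_eq_pow ?_ ?_ ?_
    · rw [← hfF, WittVector.frobenius_teichmuller R.natCast_red_eq_zero, map_pow]
    · refine Subtype.ext ((B.obj.F_α _).trans ?_)
      rw [B.property.1, map_pow]
      rfl
    · rw [hf, WittVector.teichmuller_coeff_zero]
      exact LogAlg.Hom.f_α v m
  let γ : R.red.witt p ⟶ B.obj.zero := LogAlg.Hom.mk (A := R.red.witt p) (B := B.obj.zero)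
    { f with commutes' := hf_alg } ψ0 hf_α (LogAlg.Hom.ψ_ι v :)
  obtain ⟨G, hG⟩ := (R.isFrobeniusLift_witt (p := p)).exists_logDeRham_lift
    B.isSaturated.torsionFree B.property.1 γ (fun a => congrArg Subtype.val (hfF a))
  refine ⟨G, LogAlg.Hom.ext (AlgHom.ext fun a => ?_) ?_⟩
  · obtain ⟨x, rfl⟩ := constantCoeff_surjective (p := p) a
    refine (descendRingHom_coeff G x).trans ?_
    have hGf : LogAlg.wittHom G = f := RingHom.ext fun y =>
      congrArg (fun q : R.red.witt p ⟶ B.obj.zero => LogAlg.Hom.f q y) hG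
    rw [hGf, hf, WittVector.map_coeff]
    rfl
  · exact congrArg (fun q : R.red.witt p ⟶ B.obj.zero => LogAlg.Hom.ψ q) hG

/-- The saturated log de Rham–Witt complex exists and is the completed saturated log de Rham
complex of `W(R_red)`. -/
theorem exists_isSaturatedLogDRW (R : LogAlg β) :
    ∃ (C : StrictLogDieudonneAlg p β) (u : R ⟶ (modV p β).obj C),
      IsSaturatedLogDRW u ∧ IsCompletedSaturatedLogDeRham u := by
  let E := R.wittDeRham p
  let q := E.toTorsionFreeQuotient
  have hq : LogDieudonneAlg.IsTorsionFreeQuotient q :=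
    E.isTorsionFreeQuotient_toTorsionFreeQuotient
  let j := LogDieudonneAlg.toSaturation hq.torsionFree
  have hj : LogDieudonneAlg.IsSaturationMap j :=
    LogDieudonneAlg.isSaturationMap_toSaturation hq.torsionFree
  let C : StrictLogDieudonneAlg p β :=
    ⟨hj.isSaturated.completion, fun _ => rfl, hj.isSaturated.isStrict_completion⟩
  let ρ : LogDieudonneAlg.saturation hq.torsionFree ⟶ C.obj := hj.isSaturated.toCompletion
  refine ⟨C, descend ((q ≫ j) ≫ ρ), fun B => ?_, E, _, R.wittDeRhamZeroIso p, q ≫ j, ρ,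
    (R.isFrobeniusLift_witt (p := p)).isLogDeRham, ⟨_, q, j, _, hq, hj.isEtaColimit, rfl⟩,
    hj.isSaturated.isVCompletion_toCompletion, descendRingHom_coeff _, fun _ => rfl⟩
  -- Under `descend` the natural map becomes precomposition with `E → C`, to which the three
  -- universal properties apply.
  have hcomp : (fun g : C ⟶ B => descend ((q ≫ j) ≫ ρ) ≫ (modV p β).map g) =
      fun g : C ⟶ B => descend (((q ≫ j) ≫ ρ) ≫ g.hom) :=
    funext fun g => descend_comp _ g
  rw [hcomp]
  constructor
  · intro g g' hgg'
    have h1 := descend_injective hgg'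
    rw [Category.assoc, Category.assoc, Category.assoc, Category.assoc] at h1
    exact ObjectProperty.hom_ext _ (hj.isSaturated.completion_hom_ext B.property.2
      (hj.hom_ext B.isSaturated (hq.hom_ext h1)))
  · intro v
    obtain ⟨G, rfl⟩ := descend_surjective v
    obtain ⟨G1, rfl⟩ := hq.exists_lift B.isSaturated G
    obtain ⟨G2, rfl⟩ := hj.exists_lift B.isSaturated G1
    obtain ⟨G3, rfl⟩ := hj.isSaturated.completion_exists_lift B.property.2 G2
    exact ⟨⟨G3⟩, congrArg descend (by simp only [Category.assoc]; rfl)⟩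

end StrictLogDieudonneAlg
end

/-! ### Functoriality from representability -/

theorem theorem4 (p : ℕ) [Fact p.Prime] (k : Type u) [Field k] [CharP k p] [PerfectRing k p]
    (N : Type u) [CommMonoid N] (β : N →* k) :
    ∃ (Wω : LogAlg β ⥤ StrictLogDieudonneAlg p β)
      (η : 𝟭 (LogAlg β) ⟶ Wω ⋙ StrictLogDieudonneAlg.modV p β),
      ∀ R : LogAlg β,
        StrictLogDieudonneAlg.IsSaturatedLogDRW (C := Wω.obj R) (η.app R) ∧
        StrictLogDieudonneAlg.IsCompletedSaturatedLogDeRham (C := Wω.obj R) (η.app R) := by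
  choose C u hu hu' using fun R : LogAlg β =>
    StrictLogDieudonneAlg.exists_isSaturatedLogDRW (p := p) R
  -- The universal property represents `B ↦ Hom(R, B^0/VB^0)` by `C R`, naturally in `B`. This
  -- determines the action on morphisms of `R` and yields a left adjoint of `modV`, with unit `u`.
  let e : ∀ (R : LogAlg β) (B : StrictLogDieudonneAlg p β),
      (C R ⟶ B) ≃ (R ⟶ (StrictLogDieudonneAlg.modV p β).obj B) := fun R B =>
    Equiv.ofBijective (fun g => u R ≫ (StrictLogDieudonneAlg.modV p β).map g) (hu R B)
  have he : ∀ R B B' (g : B ⟶ B') (h : C R ⟶ B),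
      e R B' (h ≫ g) = e R B h ≫ (StrictLogDieudonneAlg.modV p β).map g := fun R B B' g h => by
    simp [e]
  have hη : ∀ R, (Adjunction.adjunctionOfEquivLeft e he).unit.app R = u R := fun R => by
    simp [e]
  refine ⟨Adjunction.leftAdjointOfEquiv e he, (Adjunction.adjunctionOfEquivLeft e he).unit,
    fun R => ?_⟩
  rw [hη]
  exact ⟨hu R, hu' R⟩
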